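/- Let $\widetilde M$ be a complex manifold of dimension $n$ (Hausdorff, second countable), and let $\Gamma$ be a group acting freely and properly discontinuously on $\widetilde M$ by holomorphic automorphisms such that the quotient $M=\widetilde M/\Gamma$ is compact. Let $\Gamma=\Gamma_1\supset\Gamma_2\supset\cdots$ be a tower of subgroups, i.e. a nested sequence of normal subgroups of $\Gamma$ of finite index with $\bigcap_j\Gamma_j=\{\mathrm{id}\}$. Let $M_j=\widetilde M/\Gamma_j$ be the corresponding tower of coverings of $M$, with projections $\widetilde p_j:\widetilde M\to M_j$. For a complex manifold $X$ of dimension $n$, let $A^2_{(n,0)}(X)$ be the Hilbert space of square integrable holomorphic $(n,0)$-forms with inner product $\langle f,g\rangle=i^{n^2}2^{-n}\int_X f\wedge\bar g$, and let $K_X$ be its Bergman kernel on the diagonal, i.e. the nonnegative $(n,n)$-form $K_X=i^{n^2}2^{-n}\sum_k b_k\wedge\overline{b_k}$, where $\{b_k\}$ is an orthonormal basis of $A^2_{(n,0)}(X)$; in local coordinates, $K_X=K_X^*\,\omega_n$ with $\omega_n=\bigwedge_{l=1}^n\frac i2\,dz_l\wedge d\bar z_l$ and $K_X^*=\sum_k|b_k^*|^2$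 if $b_k=b_k^*\,dz_1\wedge\cdots\wedge dz_n$. Let $h^{n,0}(X)$ be the dimension of the space of all holomorphic $(n,0)$-forms on $X$. The form $K_{\widetilde M}$ is invariant under $\Gamma$, and its push-down to $M$ is denoted by the same symbol. The tower is called Bergman stable if the pull-backs $\widetilde p_j^{\,*}K_{M_j}$ converge to $K_{\widetilde M}$ locally uniformly on $\widetilde M$ as $j\to\infty$ (that is, their coefficients converge locally uniformly in every local coordinate chart of $\widetilde M$). **Proposition 4.1.** The tower $\{M_j\}$ is Bergman stable if and only if $$\lim_{j\to\infty}\frac{h^{n,0}(M_j)}{[\Gamma:\Gamma_j]}=\int_M K_{\widetilde M}.$$ -/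

import Mathlib

open scoped Manifold ContDiff Topology ComplexConjugate
open Filter MeasureTheory

noncomputable section

namespace BergmanTower

/-! ### Forms of top degree on a complex manifold

A complex manifold of dimension `n` is a charted space over `ℂⁿ = Fin n → ℂ` with
`IsManifold 𝓘(ℂ, Fin n → ℂ) ω X`.  The fibre `TangentSpace 𝓘(ℂ, Fin n → ℂ) x` is the holomorphic
tangent space at `x`. -/

/-- An `(n,0)`-form: at each point a complex `n`-linear alternating form on the tangent space. -/
abbrev TopForm (n : ℕ) (X : Type*) [TopologicalSpace X] [ChartedSpace (Fin n → ℂ) X] :=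
  ∀ x : X, TangentSpace 𝓘(ℂ, Fin n → ℂ) x [⋀^Fin n]→L[ℂ] ℂ

/-- An `(n,n)`-form `η`, given by its values on frames `v = (v₁, …, vₙ)`: the form which is
`η* ω_n`, `ω_n = ⋀ (i/2) dz_j ∧ dz̄_j`, in local coordinates takes the value `η*` on the coordinate
frame `(∂/∂z₁, …, ∂/∂zₙ)`. -/
abbrev Density (n : ℕ) (X : Type*) [TopologicalSpace X] [ChartedSpace (Fin n → ℂ) X] :=
  ∀ x : X, (Fin n → TangentSpace 𝓘(ℂ, Fin n → ℂ) x) → ℂ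

/-- The coordinate frame of the chart `e` at the point with coordinates `u`. -/
def coordFrame {n : ℕ} {X : Type*} [TopologicalSpace X] [ChartedSpace (Fin n → ℂ) X]
    (e : OpenPartialHomeomorph X (Fin n → ℂ)) (u : Fin n → ℂ) :
    Fin n → TangentSpace 𝓘(ℂ, Fin n → ℂ) (e.symm u) :=
  fun i => mfderiv 𝓘(ℂ, Fin n → ℂ) 𝓘(ℂ, Fin n → ℂ) e.symm u (Pi.single i (1 : ℂ) : Fin n → ℂ)

/-- The function `f*` with `f = f* dz₁ ∧ ⋯ ∧ dzₙ` in the chart `e`. -/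
def TopForm.coeff {n : ℕ} {X : Type*} [TopologicalSpace X] [ChartedSpace (Fin n → ℂ) X]
    (f : TopForm n X) (e : OpenPartialHomeomorph X (Fin n → ℂ)) (u : Fin n → ℂ) : ℂ :=
  f (e.symm u) (coordFrame e u)

/-- The function `η*` with `η = η* ω_n` in the chart `e`. -/
def Density.coeff {n : ℕ} {X : Type*} [TopologicalSpace X] [ChartedSpace (Fin n → ℂ) X]
    (η : Density n X) (e : OpenPartialHomeomorph X (Fin n → ℂ)) (u : Fin n → ℂ) : ℂ :=
  η (e.symm u) (coordFrame e u)

/-- The space of holomorphic `(n,0)`-forms, i.e. of global sections of the canonical bundle: the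
forms whose coefficient is holomorphic in every chart of the complex structure. -/
def holomorphicForms (n : ℕ) (X : Type*) [TopologicalSpace X] [ChartedSpace (Fin n → ℂ) X] :
    Submodule ℂ (TopForm n X) where
  carrier := {f | ∀ e ∈ IsManifold.maximalAtlas 𝓘(ℂ, Fin n → ℂ) ω X,
    DifferentiableOn ℂ (f.coeff e) e.target}
  add_mem' := fun hf hg e he => (hf e he).add (hg e he)
  zero_mem' := fun _ _ => differentiableOn_const (0 : ℂ)
  smul_mem' := fun c _ hf e he => (hf e he).const_smul c

/-- The Hodge number `h^{n,0}(X)`, the dimension of the space of holomorphic `(n,0)`-forms. -/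
def hodgeNumber (n : ℕ) (X : Type*) [TopologicalSpace X] [ChartedSpace (Fin n → ℂ) X] : ℕ :=
  Module.finrank ℂ (holomorphicForms n X)

/-- The `(n,n)`-form `i^{n²} 2^{-n} f ∧ ḡ`; if `f = f* dz₁ ∧ ⋯ ∧ dzₙ` and `g = g* dz₁ ∧ ⋯ ∧ dzₙ`
then it equals `f* ḡ* ω_n`. -/
def wedgeConj {n : ℕ} {X : Type*} [TopologicalSpace X] [ChartedSpace (Fin n → ℂ) X]
    (f g : TopForm n X) : Density n X :=
  fun x v => f x v * conj (g x v)

/-! ### Integration of `(n,n)`-forms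

The manifold is cut into countably many Borel pieces, each lying in the domain of a preferred
chart, and the integrals over the pieces are computed in these charts with respect to the Lebesgue
measure `ω_n` of `ℂⁿ`. -/

/-- A decomposition of `X` into countably many Borel pieces: the fibres of `center`; the piece
`center ⁻¹' {y}` lies in the domain of the preferred chart at `y`. -/
structure ChartDecomposition (n : ℕ) (X : Type*) [TopologicalSpace X]
    [ChartedSpace (Fin n → ℂ) X] where
  center : X → X
  mem_source : ∀ x, x ∈ (chartAt (Fin n → ℂ) (center x)).source
  countable_range : (Set.range center).Countable
  measurableSet_fiber : ∀ y, MeasurableSet[borel X] (center ⁻¹' {y})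

theorem nonempty_chartDecomposition (n : ℕ) (X : Type*) [TopologicalSpace X]
    [SecondCountableTopology X] [ChartedSpace (Fin n → ℂ) X] :
    Nonempty (ChartDecomposition n X) := by
  classical
  obtain ⟨s, hs, hcov⟩ := TopologicalSpace.countable_cover_nhds
    (fun x : X => (chartAt (Fin n → ℂ) x).open_source.mem_nhds (mem_chart_source _ x))
  obtain ⟨code, hcode⟩ : ∃ code : X → ℕ, Set.InjOn code s := Set.countable_iff_exists_injOn.1 hs
  have hex : ∀ x : X, ∃ k, ∃ y ∈ s, code y = k ∧ x ∈ (chartAt (Fin n → ℂ) y).source := by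
    intro x
    have : x ∈ ⋃ y ∈ s, (chartAt (Fin n → ℂ) y).source := by rw [hcov]; trivial
    simp only [Set.mem_iUnion] at this
    obtain ⟨y, hy, hxy⟩ := this
    exact ⟨_, y, hy, rfl, hxy⟩
  choose c hcs hck hcx using fun x => Nat.find_spec (hex x)
  refine ⟨⟨c, hcx, hs.mono (by rintro _ ⟨x, rfl⟩; exact hcs x), fun y => ?_⟩⟩
  let := borel X
  have : BorelSpace X := ⟨rfl⟩
  by_cases hy : y ∈ s
  · have : c ⁻¹' {y} = (chartAt (Fin n → ℂ) y).source \
        ⋃ z ∈ {z ∈ s | code z < code y}, (chartAt (Fin n → ℂ) z).source := by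
      ext x
      simp only [Set.mem_preimage, Set.mem_singleton_iff, Set.mem_sdiff, Set.mem_iUnion,
        Set.mem_ofPred_eq, not_exists]
      constructor
      · rintro rfl
        refine ⟨hcx x, fun z hz hxz => ?_⟩
        have h1 := hz.2
        rw [hck x] at h1
        exact Nat.find_min (hex x) h1 ⟨z, hz.1, rfl, hxz⟩
      · rintro ⟨h1, h2⟩
        apply hcode (hcs x) hy
        have h3 : code (c x) ≤ code y := by
          rw [hck x]; exact Nat.find_min' _ ⟨y, hy, rfl, h1⟩
        refine le_antisymm h3 (not_lt.1 fun h4 => h2 (c x) ⟨hcs x, h4⟩ (hcx x))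
    rw [this]
    refine (chartAt (Fin n → ℂ) y).open_source.measurableSet.diff ?_
    exact MeasurableSet.biUnion (hs.mono fun z hz => hz.1)
      fun z _ => (chartAt (Fin n → ℂ) z).open_source.measurableSet
  · have : c ⁻¹' {y} = ∅ := by
      ext x
      simp only [Set.mem_preimage, Set.mem_singleton_iff, Set.mem_empty_iff_false, iff_false]
      rintro rfl
      exact hy (hcs x)
    rw [this]
    exact MeasurableSet.empty

/-- The decomposition used for integration; the integral does not depend on this choice. -/
def decomposition (n : ℕ) (X : Type*) [TopologicalSpace X] [SecondCountableTopology X]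
    [ChartedSpace (Fin n → ℂ) X] : ChartDecomposition n X :=
  (nonempty_chartDecomposition n X).some

/-- The set of (countably many) centres of the pieces. -/
def centers (n : ℕ) (X : Type*) [TopologicalSpace X] [SecondCountableTopology X]
    [ChartedSpace (Fin n → ℂ) X] : Set X :=
  Set.range (decomposition n X).center

/-- The image in `ℂⁿ` of the piece with centre `y` under the preferred chart at `y`. -/
def piece (n : ℕ) {X : Type*} [TopologicalSpace X] [SecondCountableTopology X]
    [ChartedSpace (Fin n → ℂ) X] (y : X) : Set (Fin n → ℂ) :=
  chartAt (Fin n → ℂ) y '' ((decomposition n X).center ⁻¹' {y})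

/-- The integral over `X` of a complex valued `(n,n)`-form. -/
def Density.integral {n : ℕ} {X : Type*} [TopologicalSpace X] [SecondCountableTopology X]
    [ChartedSpace (Fin n → ℂ) X] (η : Density n X) : ℂ :=
  ∑' y : centers n X, ∫ u in piece n (y : X), η.coeff (chartAt (Fin n → ℂ) (y : X)) u

/-- The integral over `X`, with values in `[0, ∞]`, of a nonnegative `(n,n)`-form. -/
def Density.lintegral {n : ℕ} {X : Type*} [TopologicalSpace X] [SecondCountableTopology X]
    [ChartedSpace (Fin n → ℂ) X] (η : Density n X) : ENNReal :=
  ∑' y : centers n X,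
    ∫⁻ u in piece n (y : X), ENNReal.ofReal (η.coeff (chartAt (Fin n → ℂ) (y : X)) u).re

/-! ### The Bergman space and the Bergman kernel -/

/-- The squared norm `i^{n²} 2^{-n} ∫ f ∧ f̄`. -/
def normSq {n : ℕ} {X : Type*} [TopologicalSpace X] [SecondCountableTopology X]
    [ChartedSpace (Fin n → ℂ) X] (f : TopForm n X) : ENNReal :=
  (wedgeConj f f).lintegral

/-- The inner product `⟨f, g⟩ = i^{n²} 2^{-n} ∫ f ∧ ḡ`. -/
def l2Inner {n : ℕ} {X : Type*} [TopologicalSpace X] [SecondCountableTopology X]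
    [ChartedSpace (Fin n → ℂ) X] (f g : TopForm n X) : ℂ :=
  (wedgeConj f g).integral

/-- The space of square integrable holomorphic `(n,0)`-forms. -/
def bergmanSpace (n : ℕ) (X : Type*) [TopologicalSpace X] [SecondCountableTopology X]
    [ChartedSpace (Fin n → ℂ) X] : Set (TopForm n X) :=
  {f | f ∈ holomorphicForms n X ∧ normSq f < ⊤}

/-- `S` is an orthonormal basis (complete orthonormal system) of the Bergman space. -/
structure IsBergmanBasis {n : ℕ} {X : Type*} [TopologicalSpace X] [SecondCountableTopology X]
    [ChartedSpace (Fin n → ℂ) X] (S : Set (TopForm n X)) : Prop where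
  subset : S ⊆ bergmanSpace n X
  norm_one : ∀ f ∈ S, l2Inner f f = 1
  orthogonal : S.Pairwise fun f g => l2Inner f g = 0
  complete : ∀ f ∈ bergmanSpace n X, (∀ g ∈ S, l2Inner f g = 0) → f = 0

theorem measurableSet_piece {n : ℕ} {X : Type*} [TopologicalSpace X] [SecondCountableTopology X]
    [ChartedSpace (Fin n → ℂ) X] (y : X) : MeasurableSet (piece n y) := by
  let := borel X
  have : BorelSpace X := ⟨rfl⟩
  let e := chartAt (Fin n → ℂ) y
  let A := (decomposition n X).center ⁻¹' {y}
  have hA : MeasurableSet A := (decomposition n X).measurableSet_fiber y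
  have hAs : A ⊆ e.source := by
    intro x hx
    have hx' : (decomposition n X).center x = y := hx
    have := (decomposition n X).mem_source x
    rwa [hx'] at this
  have h1 : piece n y = Subtype.val '' ((fun u : e.target => e.symm u) ⁻¹' A) := by
    ext u
    simp only [piece, Set.mem_image, Set.mem_preimage, Subtype.exists, exists_and_left,
      exists_prop, exists_eq_right_right]
    constructor
    · rintro ⟨x, hx, rfl⟩
      refine ⟨?_, e.map_source (hAs hx)⟩
      rwa [e.left_inv (hAs hx)]
    · rintro ⟨h, h'⟩
      exact ⟨_, h, e.right_inv h'⟩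
  rw [h1]
  refine MeasurableSet.subtype_image e.open_target.measurableSet ?_
  exact (continuousOn_iff_continuous_domRestrict.1 e.continuousOn_symm).measurable hA

theorem piece_subset {n : ℕ} {X : Type*} [TopologicalSpace X] [SecondCountableTopology X]
    [ChartedSpace (Fin n → ℂ) X] (y : X) : piece n y ⊆ (chartAt (Fin n → ℂ) y).target := by
  rintro _ ⟨x, rfl, rfl⟩
  exact (chartAt (Fin n → ℂ) _).map_source ((decomposition n X).mem_source x)

theorem l2Inner_smul_left {n : ℕ} {X : Type*} [TopologicalSpace X] [SecondCountableTopology X]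
    [ChartedSpace (Fin n → ℂ) X] (c : ℂ) (f g : TopForm n X) :
    l2Inner (c • f) g = c * l2Inner f g := by
  simp only [l2Inner, Density.integral, Density.coeff, wedgeConj]
  rw [← tsum_mul_left]
  congr with y
  rw [← integral_const_mul]
  congr with u
  simp [mul_assoc]

theorem conj_l2Inner {n : ℕ} {X : Type*} [TopologicalSpace X] [SecondCountableTopology X]
    [ChartedSpace (Fin n → ℂ) X] (f g : TopForm n X) :
    conj (l2Inner f g) = l2Inner g f := by
  simp only [l2Inner, Density.integral, Density.coeff, wedgeConj]
  rw [Complex.conj_tsum]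
  congr with y
  rw [← integral_conj]
  congr with u
  simp [mul_comm]

theorem l2Inner_self {n : ℕ} {X : Type*} [TopologicalSpace X] [SecondCountableTopology X]
    [ChartedSpace (Fin n → ℂ) X] [IsManifold 𝓘(ℂ, Fin n → ℂ) ω X] {f : TopForm n X}
    (hf : f ∈ bergmanSpace n X) :
    l2Inner f f = (((normSq f).toReal : ℝ) : ℂ) := by
  have hre : ∀ z : ℂ, z * conj z = ((‖z‖ ^ 2 : ℝ) : ℂ) := fun z => by
    rw [Complex.mul_conj, Complex.normSq_eq_norm_sq]
  have hfin : ∀ y : centers n X, ∫⁻ u in piece n (y : X),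
      ENNReal.ofReal (‖f.coeff (chartAt (Fin n → ℂ) (y : X)) u‖ ^ 2) ≠ ⊤ := by
    have := hf.2
    simp only [normSq, Density.lintegral, Density.coeff, wedgeConj, hre, Complex.ofReal_re] at this
    exact fun y => ENNReal.ne_top_of_tsum_ne_top this.ne y
  simp only [l2Inner, normSq, Density.integral, Density.lintegral, Density.coeff, wedgeConj, hre,
    Complex.ofReal_re]
  refine Eq.trans ?_ (congrArg _ (ENNReal.tsum_toReal_eq hfin).symm)
  rw [Complex.ofReal_tsum]
  congr with y
  rw [integral_complex_ofReal, integral_eq_lintegral_of_nonneg_ae]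
  · rfl
  · exact Eventually.of_forall fun u => by positivity
  · have h1 : ContinuousOn (f.coeff (chartAt (Fin n → ℂ) (y : X))) (piece n (y : X)) :=
      ((hf.1 _ (IsManifold.chart_mem_maximalAtlas _)).continuousOn).mono (piece_subset _)
    exact (h1.norm.pow 2).aestronglyMeasurable (measurableSet_piece _)


/-- A top degree form vanishes where its coefficient vanishes. -/
theorem TopForm.eq_zero_of_coeff {n : ℕ} {X : Type*} [TopologicalSpace X]
    [ChartedSpace (Fin n → ℂ) X] [IsManifold 𝓘(ℂ, Fin n → ℂ) ω X] (f : TopForm n X)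
    (y : X) {u : Fin n → ℂ} (hu : u ∈ (chartAt (Fin n → ℂ) y).target)
    (h : f.coeff (chartAt (Fin n → ℂ) y) u = 0) : f ((chartAt (Fin n → ℂ) y).symm u) = 0 := by
  have hman : IsManifold 𝓘(ℂ, Fin n → ℂ) 1 X := inferInstance
  have he := mdifferentiable_chart (I := 𝓘(ℂ, Fin n → ℂ)) y
  let L : (Fin n → ℂ) ≃L[ℂ] TangentSpace 𝓘(ℂ, Fin n → ℂ) ((chartAt (Fin n → ℂ) y).symm u) :=
    he.symm.mfderiv (x := u) hu
  let B := (Pi.basisFun ℂ (Fin n)).map L.toLinearEquiv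
  have hB : (B : Fin n → TangentSpace 𝓘(ℂ, Fin n → ℂ) ((chartAt (Fin n → ℂ) y).symm u)) =
      coordFrame (chartAt (Fin n → ℂ) y) u := by
    ext i : 1
    simp only [B, Module.Basis.map_apply, Pi.basisFun_apply]
    rfl
  apply ContinuousAlternatingMap.toAlternatingMap_injective
  refine (AlternatingMap.map_basis_eq_zero_iff B _).1 ?_
  rw [hB]
  exact h

/-- The norm of the Bergman space is definite. -/
theorem eq_zero_of_normSq_eq_zero {n : ℕ} {X : Type*} [TopologicalSpace X]
    [SecondCountableTopology X] [ChartedSpace (Fin n → ℂ) X] [IsManifold 𝓘(ℂ, Fin n → ℂ) ω X]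
    {f : TopForm n X} (hf : f ∈ holomorphicForms n X) (h : normSq f = 0) : f = 0 := by
  have hman : IsManifold 𝓘(ℂ, Fin n → ℂ) 1 X := inferInstance
  have hre : ∀ z : ℂ, z * conj z = ((‖z‖ ^ 2 : ℝ) : ℂ) := fun z => by
    rw [Complex.mul_conj, Complex.normSq_eq_norm_sq]
  let N : X → Set (Fin n → ℂ) := fun y =>
    {u ∈ piece n y | f.coeff (chartAt (Fin n → ℂ) y) u ≠ 0}
  have hN : ∀ y : centers n X, volume (N y) = 0 := by
    intro y
    simp only [normSq, Density.lintegral, Density.coeff, wedgeConj, hre, Complex.ofReal_re] at h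
    have h2 := ENNReal.tsum_eq_zero.1 h y
    have h1 : ContinuousOn (f.coeff (chartAt (Fin n → ℂ) (y : X))) (piece n (y : X)) :=
      ((hf _ (IsManifold.chart_mem_maximalAtlas _)).continuousOn).mono (piece_subset _)
    have h3 := (lintegral_eq_zero_iff'
      ((h1.norm.pow 2).aemeasurable (measurableSet_piece _)).ennreal_ofReal).1 h2
    rw [Filter.EventuallyEq, ae_restrict_iff' (measurableSet_piece _)] at h3
    refine measure_mono_null (fun u hu => ?_) (ae_iff.1 h3)
    simp only [Set.mem_ofPred_eq, Classical.not_imp]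
    refine ⟨hu.1, ?_⟩
    have : 0 < ‖f.coeff (chartAt (Fin n → ℂ) (y : X)) u‖ := norm_pos_iff.2 hu.2
    simp only [Pi.zero_apply, ENNReal.ofReal_eq_zero, not_le, Pi.pow_apply]
    positivity
  funext x
  by_contra hx
  let e := chartAt (Fin n → ℂ) x
  have hcont : ContinuousOn (f.coeff e) e.target :=
    (hf _ (IsManifold.chart_mem_maximalAtlas _)).continuousOn
  let W : Set (Fin n → ℂ) := e.target ∩ f.coeff e ⁻¹' {0}ᶜ
  have hW : IsOpen W := hcont.isOpen_inter_preimage e.open_target isOpen_compl_singleton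
  have hxW : e x ∈ W := by
    refine ⟨mem_chart_target _ x, fun h0 => hx ?_⟩
    have := TopForm.eq_zero_of_coeff f x (mem_chart_target _ x) h0
    rwa [(chartAt (Fin n → ℂ) x).left_inv (mem_chart_source _ x)] at this
  refine (hW.measure_pos volume ⟨_, hxW⟩).ne' ?_
  have hsub : W ⊆ ⋃ y : centers n X, ((chartAt (Fin n → ℂ) (y : X)).symm.trans e) ''
      (N y ∩ ((chartAt (Fin n → ℂ) (y : X)).symm.trans e).source) := by
    intro u hu
    let c := (decomposition n X).center (e.symm u)
    have hc := (decomposition n X).mem_source (e.symm u)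
    refine Set.mem_iUnion.2 ⟨⟨c, Set.mem_range_self _⟩, chartAt (Fin n → ℂ) c (e.symm u),
      ⟨⟨⟨e.symm u, rfl, rfl⟩, fun h0 => hu.2 ?_⟩, ?_⟩, ?_⟩
    · have h1 := TopForm.eq_zero_of_coeff f c ((chartAt (Fin n → ℂ) c).map_source hc) h0
      rw [(chartAt (Fin n → ℂ) c).left_inv hc] at h1
      simp [TopForm.coeff, h1]
    · rw [OpenPartialHomeomorph.trans_source]
      refine ⟨(chartAt (Fin n → ℂ) c).map_source hc, ?_⟩
      rw [Set.mem_preimage, (chartAt (Fin n → ℂ) c).left_inv hc]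
      exact e.map_target hu.1
    · simp only [OpenPartialHomeomorph.coe_trans, Function.comp_apply]
      rw [(chartAt (Fin n → ℂ) c).left_inv hc]
      exact e.right_inv hu.1
  refine measure_mono_null hsub ?_
  have : Countable (centers n X) := (decomposition n X).countable_range
  refine measure_iUnion_null fun y => ?_
  refine addHaar_image_eq_zero_of_differentiableOn_of_addHaar_eq_zero volume ?_
    (measure_mono_null Set.inter_subset_left (hN y))
  have h1 : ContDiffOn ℂ ω ((chartAt (Fin n → ℂ) (y : X)).symm.trans e)
      ((chartAt (Fin n → ℂ) (y : X)).symm.trans e).source := by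
    rw [← contMDiffOn_iff_contDiffOn]
    refine ContMDiffOn.comp (t := e.source) (I' := 𝓘(ℂ, Fin n → ℂ))
      (contMDiffOn_chart (I := 𝓘(ℂ, Fin n → ℂ)))
      ((contMDiffOn_chart_symm (I := 𝓘(ℂ, Fin n → ℂ))).mono ?_) ?_
    · intro u hu
      exact hu.1
    · intro u hu
      exact hu.2
  have h2 := (h1.differentiableOn (by simp)).mono (s := N y ∩
    ((chartAt (Fin n → ℂ) (y : X)).symm.trans e).source) Set.inter_subset_right
  exact h2.restrictScalars ℝ

/-- The Bergman space has an orthonormal basis. -/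
theorem exists_isBergmanBasis (n : ℕ) (X : Type*) [TopologicalSpace X]
    [SecondCountableTopology X] [ChartedSpace (Fin n → ℂ) X] [IsManifold 𝓘(ℂ, Fin n → ℂ) ω X] :
    ∃ S : Set (TopForm n X), IsBergmanBasis S := by
  let P : Set (Set (TopForm n X)) := {S | S ⊆ bergmanSpace n X ∧ (∀ f ∈ S, l2Inner f f = 1) ∧
    S.Pairwise fun f g => l2Inner f g = 0}
  obtain ⟨S, hS⟩ : ∃ S, Maximal (· ∈ P) S := by
    refine zorn_subset P fun c hc hchain => ⟨⋃₀ c, ⟨?_, ?_, ?_⟩, fun s hs => Set.subset_sUnion_of_mem hs⟩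
    · exact Set.sUnion_subset fun s hs => (hc hs).1
    · rintro f ⟨s, hs, hf⟩
      exact (hc hs).2.1 f hf
    · exact (Set.pairwise_sUnion hchain.directedOn).2 fun s hs => (hc hs).2.2
  refine ⟨S, hS.prop.1, hS.prop.2.1, hS.prop.2.2, fun f hf horth => ?_⟩
  by_contra hne
  have hpos : 0 < (normSq f).toReal :=
    ENNReal.toReal_pos (fun h0 => hne (eq_zero_of_normSq_eq_zero hf.1 h0)) hf.2.ne
  set r : ℝ := (normSq f).toReal with hr
  have hff : l2Inner f f = (r : ℂ) := l2Inner_self hf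
  let c : ℂ := ((Real.sqrt r)⁻¹ : ℝ)
  have hc0 : c ≠ 0 := by
    simp only [c, ne_eq, Complex.ofReal_eq_zero, inv_eq_zero]
    exact (Real.sqrt_pos.2 hpos).ne'
  have hright : ∀ g h : TopForm n X, l2Inner g (c • h) = c * l2Inner g h := by
    intro g h
    rw [← conj_l2Inner, l2Inner_smul_left, map_mul, conj_l2Inner]
    simp [c]
  have hgg : l2Inner (c • f) (c • f) = 1 := by
    rw [l2Inner_smul_left, hright, hff]
    simp only [c]
    rw [← Complex.ofReal_mul, ← Complex.ofReal_mul, ← mul_assoc, ← mul_inv,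
      Real.mul_self_sqrt hpos.le, inv_mul_cancel₀ hpos.ne', Complex.ofReal_one]
  have hmem : c • f ∈ bergmanSpace n X := by
    refine ⟨Submodule.smul_mem _ _ hf.1, ?_⟩
    have h1 : normSq (c • f) = ENNReal.ofReal (‖c‖ ^ 2) * normSq f := by
      have hre : ∀ z : ℂ, z * conj z = ((‖z‖ ^ 2 : ℝ) : ℂ) := fun z => by
        rw [Complex.mul_conj, Complex.normSq_eq_norm_sq]
      simp only [normSq, Density.lintegral, Density.coeff, wedgeConj, hre, Complex.ofReal_re]
      rw [← ENNReal.tsum_mul_left]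
      congr with y
      rw [← lintegral_const_mul' _ _ ENNReal.ofReal_ne_top]
      congr with u
      rw [← ENNReal.ofReal_mul (by positivity), ← mul_pow, ← norm_mul]
      rfl
    rw [h1]
    exact ENNReal.mul_lt_top ENNReal.ofReal_lt_top hf.2
  have hins : insert (c • f) S ∈ P := by
    refine ⟨Set.insert_subset hmem hS.prop.1, ?_, ?_⟩
    · rintro g (rfl | hg)
      · exact hgg
      · exact hS.prop.2.1 g hg
    · refine hS.prop.2.2.insert fun g hg _ => ⟨?_, ?_⟩
      · rw [l2Inner_smul_left, horth g hg, mul_zero]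
      · rw [hright, ← conj_l2Inner, horth g hg, map_zero, mul_zero]
  have hin : c • f ∈ S := hS.le_of_ge hins (Set.subset_insert _ _) (Set.mem_insert _ _)
  have h0 := horth _ hin
  rw [hright, hff] at h0
  exact mul_ne_zero hc0 (Complex.ofReal_ne_zero.2 hpos.ne') h0

/-- An orthonormal basis of the Bergman space; the kernel does not depend on this choice. -/
def bergmanBasis (n : ℕ) (X : Type*) [TopologicalSpace X] [SecondCountableTopology X]
    [ChartedSpace (Fin n → ℂ) X] [IsManifold 𝓘(ℂ, Fin n → ℂ) ω X] : Set (TopForm n X) :=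
  (exists_isBergmanBasis n X).choose

/-- The Bergman kernel `K_X(z, w) = ∑ b(z) ∧ conj b(w)` (sum over an orthonormal basis), evaluated
on a frame `v` at `z` and a frame `v'` at `w`. -/
def bergmanKernel (n : ℕ) {X : Type*} [TopologicalSpace X] [SecondCountableTopology X]
    [ChartedSpace (Fin n → ℂ) X] [IsManifold 𝓘(ℂ, Fin n → ℂ) ω X] (z w : X)
    (v : Fin n → TangentSpace 𝓘(ℂ, Fin n → ℂ) z)
    (v' : Fin n → TangentSpace 𝓘(ℂ, Fin n → ℂ) w) : ℂ :=
  ∑' b : bergmanBasis n X, (b : TopForm n X) z v * conj ((b : TopForm n X) w v')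

/-- The Bergman kernel on the diagonal, the `(n,n)`-form `K_X(z) = K_X(z, z)`. In a chart it is
`K* ω_n` with `K* = ∑ |b*|²`. -/
def bergmanForm (n : ℕ) (X : Type*) [TopologicalSpace X] [SecondCountableTopology X]
    [ChartedSpace (Fin n → ℂ) X] [IsManifold 𝓘(ℂ, Fin n → ℂ) ω X] : Density n X :=
  fun z v => bergmanKernel n z z v v

/-! ### Quotients by groups of automorphisms -/

/-- The group `Γ` acts on the complex manifold `X` by holomorphic maps. -/
class HolomorphicSMul (n : ℕ) (Γ X : Type*) [Group Γ] [MulAction Γ X] [TopologicalSpace X]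
    [ChartedSpace (Fin n → ℂ) X] : Prop where
  contMDiff_smul : ∀ g : Γ,
    ContMDiff 𝓘(ℂ, Fin n → ℂ) 𝓘(ℂ, Fin n → ℂ) ω (fun x : X => g • x)

instance holomorphicSMul_subgroup {n : ℕ} {Γ X : Type*} [Group Γ] [MulAction Γ X]
    [TopologicalSpace X] [ChartedSpace (Fin n → ℂ) X] [HolomorphicSMul n Γ X] (G : Subgroup Γ) :
    HolomorphicSMul n G X where
  contMDiff_smul g := HolomorphicSMul.contMDiff_smul (g : Γ)

instance properlyDiscontinuousSMul_subgroup {Γ X : Type*} [Group Γ] [MulAction Γ X]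
    [TopologicalSpace X] [ProperlyDiscontinuousSMul Γ X] (G : Subgroup Γ) :
    ProperlyDiscontinuousSMul G X where
  finite_disjoint_inter_image {K L} hK hL := by
    have h : {γ : Γ | ((γ • ·) '' K ∩ L).Nonempty}.Finite :=
      ProperlyDiscontinuousSMul.finite_disjoint_inter_image hK hL
    exact h.preimage (f := fun g : G => (g : Γ)) Subtype.val_injective.injOn

instance continuousConstSMul_subgroup {Γ X : Type*} [Group Γ] [MulAction Γ X]
    [TopologicalSpace X] [ContinuousConstSMul Γ X] (G : Subgroup Γ) : ContinuousConstSMul G X where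
  continuous_const_smul g := continuous_const_smul (g : Γ)

/-- The quotient `X / Γ`. -/
abbrev QuotientManifold (Γ X : Type*) [Group Γ] [MulAction Γ X] := MulAction.orbitRel.Quotient Γ X

/-- The natural projection `X → X / Γ`. -/
def proj (Γ : Type*) {X : Type*} [Group Γ] [MulAction Γ X] (x : X) : QuotientManifold Γ X :=
  Quotient.mk (MulAction.orbitRel Γ X) x

instance QuotientManifold.secondCountableTopology {Γ X : Type*} [Group Γ] [MulAction Γ X] [TopologicalSpace X]
    [ContinuousConstSMul Γ X] [SecondCountableTopology X] :
    SecondCountableTopology (QuotientManifold Γ X) :=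
  ContinuousConstSMul.secondCountableTopology

/-- The quotient of a complex manifold by a free properly discontinuous group of automorphisms,
with the charts obtained from those of `X` by local inverses of the projection, is a complex
manifold. -/
instance QuotientManifold.isManifold {n : ℕ} {Γ X : Type*} [Group Γ] [MulAction Γ X] [TopologicalSpace X]
    [T2Space X] [LocallyCompactSpace X] [ChartedSpace (Fin n → ℂ) X]
    [IsManifold 𝓘(ℂ, Fin n → ℂ) ω X] [ContinuousConstSMul Γ X] [ProperlyDiscontinuousSMul Γ X]
    [IsCancelSMul Γ X] [HolomorphicSMul n Γ X] :
    IsManifold 𝓘(ℂ, Fin n → ℂ) ω (QuotientManifold Γ X) := by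
  have hf : IsLocalHomeomorph (Quotient.mk (MulAction.orbitRel Γ X)) :=
    (isQuotientCoveringMap_quotientMk_of_properlyDiscontinuousSMul
      (G := Γ) (E := X)).isCoveringMap.isLocalHomeomorph
  have key : ∀ a b : X, ContDiffOn ℂ ω
      (((hf.localInverseAt a).trans (chartAt (Fin n → ℂ) a)).symm.trans
        ((hf.localInverseAt b).trans (chartAt (Fin n → ℂ) b)))
      (((hf.localInverseAt a).trans (chartAt (Fin n → ℂ) a)).symm.trans
        ((hf.localInverseAt b).trans (chartAt (Fin n → ℂ) b))).source := by
    intro a b u hu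
    refine ContDiffAt.contDiffWithinAt ?_
    set φ := chartAt (Fin n → ℂ) a
    set ψ := chartAt (Fin n → ℂ) b
    set s := hf.localInverseAt b with hs
    have hu1 : u ∈ φ.target := by
      have h : u ∈ ((hf.localInverseAt a).trans φ).target := hu.1
      rw [OpenPartialHomeomorph.trans_target] at h
      exact h.1
    have hsymm : ∀ w, (((hf.localInverseAt a).trans φ).symm) w =
        Quotient.mk (MulAction.orbitRel Γ X) (φ.symm w) := by
      intro w
      rw [OpenPartialHomeomorph.trans_symm_eq_symm_trans_symm, OpenPartialHomeomorph.coe_trans,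
        Function.comp_apply, hf.localInverseAt_symm]
    have hu2 : Quotient.mk (MulAction.orbitRel Γ X) (φ.symm u) ∈ s.source ∧
        s (Quotient.mk (MulAction.orbitRel Γ X) (φ.symm u)) ∈ ψ.source := by
      have h : ((hf.localInverseAt a).trans φ).symm u ∈ (s.trans ψ).source := hu.2
      rw [hsymm, OpenPartialHomeomorph.trans_source] at h
      exact h
    have h3 : Quotient.mk (MulAction.orbitRel Γ X)
        (s (Quotient.mk (MulAction.orbitRel Γ X) (φ.symm u))) =
        Quotient.mk (MulAction.orbitRel Γ X) (φ.symm u) :=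
      hf.apply_localInverseAt_of_mem hu2.1
    obtain ⟨g, hg⟩ := Quotient.exact h3
    have hg : g • φ.symm u = s (Quotient.mk (MulAction.orbitRel Γ X) (φ.symm u)) := hg
    have hφ : ContMDiffAt 𝓘(ℂ, Fin n → ℂ) 𝓘(ℂ, Fin n → ℂ) ω φ.symm u :=
      (contMDiffOn_chart_symm (I := 𝓘(ℂ, Fin n → ℂ)) u hu1).contMDiffAt
        (φ.open_target.mem_nhds hu1)
    have hgφ : ContMDiffAt 𝓘(ℂ, Fin n → ℂ) 𝓘(ℂ, Fin n → ℂ) ω (fun w => g • φ.symm w) u :=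
      (HolomorphicSMul.contMDiff_smul (n := n) g).contMDiffAt.comp u hφ
    have hψ : ContMDiffAt 𝓘(ℂ, Fin n → ℂ) 𝓘(ℂ, Fin n → ℂ) ω ψ (g • φ.symm u) := by
      rw [hg]
      exact (contMDiffOn_chart (I := 𝓘(ℂ, Fin n → ℂ)) _ hu2.2).contMDiffAt
        (ψ.open_source.mem_nhds hu2.2)
    have htot : ContMDiffAt 𝓘(ℂ, Fin n → ℂ) 𝓘(ℂ, Fin n → ℂ) ω
        (fun w => ψ (g • φ.symm w)) u := ContMDiffAt.comp u hψ hgφ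
    refine (contMDiffAt_iff_contDiffAt.1 htot).congr_of_eventuallyEq ?_
    have hst : s.target ∈ 𝓝 (g • φ.symm u) := by
      rw [hg]
      exact s.open_target.mem_nhds (s.map_source hu2.1)
    filter_upwards [hgφ.continuousAt.preimage_mem_nhds hst] with w hw
    have hw : g • φ.symm w ∈ s.target := hw
    rw [OpenPartialHomeomorph.coe_trans, Function.comp_apply, hsymm,
      OpenPartialHomeomorph.coe_trans, Function.comp_apply]
    congr 1
    have h4 : s.symm (g • φ.symm w) = Quotient.mk (MulAction.orbitRel Γ X) (φ.symm w) := by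
      rw [hs, hf.localInverseAt_symm]
      exact Quotient.sound ⟨g, rfl⟩
    rw [← h4, s.right_inv hw]
  refine isManifold_of_contDiffOn _ _ _ ?_
  rintro _ _ ⟨q, rfl⟩ ⟨q', rfl⟩
  simpa using key _ _

/-- The pull-back of an `(n,n)`-form on `X / Γ` to `X`. -/
def pullBack {n : ℕ} {Γ X : Type*} [Group Γ] [MulAction Γ X] [TopologicalSpace X]
    [T2Space X] [LocallyCompactSpace X] [ChartedSpace (Fin n → ℂ) X] [ContinuousConstSMul Γ X]
    [ProperlyDiscontinuousSMul Γ X] [IsCancelSMul Γ X] (η : Density n (QuotientManifold Γ X)) : Density n X :=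
  fun x v => η (proj Γ x)
    (fun i => mfderiv 𝓘(ℂ, Fin n → ℂ) 𝓘(ℂ, Fin n → ℂ) (proj Γ (X := X)) x (v i))

/-- The push-down to `X / Γ` of a `Γ`-invariant `(n,n)`-form `η` on `X`: at `q` it is obtained from
the value of `η` at a point `x` over `q` through the inverse of the differential at `x` of the
projection. -/
def pushDown {n : ℕ} (Γ : Type*) {X : Type*} [Group Γ] [MulAction Γ X] [TopologicalSpace X]
    [T2Space X] [LocallyCompactSpace X] [ChartedSpace (Fin n → ℂ) X] [ContinuousConstSMul Γ X]
    [ProperlyDiscontinuousSMul Γ X] [IsCancelSMul Γ X] (η : Density n X) : Density n (QuotientManifold Γ X) :=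
  fun q v => η (Quotient.out q) (fun i =>
    (mfderiv 𝓘(ℂ, Fin n → ℂ) 𝓘(ℂ, Fin n → ℂ) (proj Γ (X := X)) (Quotient.out q)).inverse (v i))

/-! ### Towers of coverings and Bergman stability -/

/-- A tower of subgroups `Γ = Γ₀ ⊇ Γ₁ ⊇ ⋯` of `Γ`: a nested sequence of normal subgroups of finite
index with trivial intersection. -/
structure IsTower {Γ : Type*} [Group Γ] (G : ℕ → Subgroup Γ) : Prop where
  zero : G 0 = ⊤
  antitone : Antitone G
  normal : ∀ j, (G j).Normal
  finiteIndex : ∀ j, (G j).FiniteIndex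
  iInf_eq_bot : ⨅ j, G j = ⊥

/-- Bergman stability of the tower of coverings `X / G j`: the pull-backs to `X` of the Bergman
kernels of the manifolds `X / G j` converge to the Bergman kernel of `X` locally uniformly (in
every chart of the complex structure). -/
def IsBergmanStable (n : ℕ) {Γ : Type*} (X : Type*) [Group Γ] [MulAction Γ X] [TopologicalSpace X]
    [T2Space X] [LocallyCompactSpace X] [SecondCountableTopology X] [ChartedSpace (Fin n → ℂ) X]
    [IsManifold 𝓘(ℂ, Fin n → ℂ) ω X] [ContinuousConstSMul Γ X] [ProperlyDiscontinuousSMul Γ X]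
    [IsCancelSMul Γ X] [HolomorphicSMul n Γ X] (G : ℕ → Subgroup Γ) : Prop :=
  ∀ e ∈ IsManifold.maximalAtlas 𝓘(ℂ, Fin n → ℂ) ω X,
    TendstoLocallyUniformlyOn
      (fun j => (pullBack (bergmanForm n (QuotientManifold (G j) X)) : Density n X).coeff e)
      ((bergmanForm n X).coeff e) atTop e.target

end BergmanTower

end

noncomputable section

set_option linter.unusedSectionVars false

namespace BergmanTower

/-! ### Holomorphic functions on balls of `ℂⁿ` -/

/-! Two facts turn the ratio of Hodge number to index into an integral over a fixed domain. On a
compact manifold every holomorphic (n,0)-form is square integrable, and integrating the kernel term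
by term over a finite orthonormal basis gives h^{n,0} = ∫ K (`hodgeNumber_eq_lintegral`). Since Γ_j
is normal, Γ acts on M_j by automorphisms and K_{M_j} is invariant, so ∫_{M_j} K_{M_j} is the index
times an integral over pieces representing M (`FundamentalFamily.lintegral_bergmanForm_quotient`).
Write K_j and K for the kernels of M_j and of the covering manifold, read upstairs. The claim
becomes: K_j → K locally uniformly if and only if the integrals of K_j over these pieces converge to
that of K.

All estimates rest on the extremal description: K(x) is the largest |f(x)|² among forms f of norm at
most one. The mean value inequality bounds K on coordinate balls and a Schwarz-type estimate makes
it Lipschitz, with constants depending only on the dimension and the radius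
(`IsParam.kernelParam_le`, `IsParam.abs_kernelParam_sub_le`). A ball that embeds in M embeds in
every M_j, so these bounds are uniform in j. Stability therefore implies convergence of the
integrals by bounded convergence.

For the converse, limsup K_j ≤ K holds in every tower (`IsTower.eventually_kernelParam_le`):
extremal forms on M_j, pulled back, subconverge by Montel; each compact set eventually embeds in
M_j, so Fatou bounds the norm of the limit by one. Hence max(K_j, K) → K pointwise and in integral.
If also ∫ K_j → ∫ K, then ∫ (max(K_j, K) - K_j) → 0. A deficit K_j ≤ K - δ at a point persists,
halved, on a ball whose size does not depend on j and would cost a fixed amount of mass. This forces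
pointwise convergence (`IsTower.tendsto_kernelParam`), and the Lipschitz bounds make it locally
uniform. -/

theorem measurePreserving_smul_circle {n : ℕ} (a : Circle) :
    MeasurePreserving (fun u : Fin n → ℂ => (a : ℂ) • u) volume volume := by
  have h := (rotation a).measurePreserving
  exact volume_preserving_pi (fun _ : Fin n => h)

/-- The mean value property of the holomorphic function f², followed by the triangle inequality. The
margin `1 < r` makes f holomorphic on a neighbourhood of the closed unit disc. -/
theorem enorm_sq_le_lintegral_circle {f : ℂ → ℂ} {r : ℝ} (hr : 1 < r)
    (hf : DifferentiableOn ℂ f (Metric.ball 0 r)) :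
    ENNReal.ofReal (2 * Real.pi) * ‖f 0‖ₑ ^ 2 ≤
      ∫⁻ θ in Set.Ioc 0 (2 * Real.pi), ‖f (Circle.exp θ)‖ₑ ^ 2 := by
  have hpi : 0 < 2 * Real.pi := by positivity
  have hd : DiffContOnCl ℂ (fun z => f z ^ 2) (Metric.ball 0 |1|) := by
    refine DifferentiableOn.diffContOnCl ?_
    rw [abs_one, closure_ball _ one_ne_zero]
    exact (hf.mono (Metric.closedBall_subset_ball hr)).pow 2
  have h1 := hd.circleAverage
  rw [Real.circleAverage_def, inv_smul_eq_iff₀ hpi.ne',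
    intervalIntegral.integral_of_le hpi.le] at h1
  calc ENNReal.ofReal (2 * Real.pi) * ‖f 0‖ₑ ^ 2 = ‖(2 * Real.pi) • f 0 ^ 2‖ₑ := by
        rw [enorm_smul, enorm_pow, Real.enorm_of_nonneg hpi.le]
    _ ≤ ∫⁻ θ in Set.Ioc 0 (2 * Real.pi), ‖f (circleMap 0 1 θ) ^ 2‖ₑ := by
        rw [← h1]; exact enorm_integral_le_lintegral_enorm _
    _ = _ := by simp [circleMap, enorm_pow]

/-- The mean value inequality for the square of the modulus of a holomorphic function. -/
theorem volume_ball_mul_enorm_sq_le {n : ℕ} {f : (Fin n → ℂ) → ℂ} {c : Fin n → ℂ} {R : ℝ}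
    (hf : DifferentiableOn ℂ f (Metric.ball c R)) :
    volume (Metric.ball (0 : Fin n → ℂ) R) * ‖f c‖ₑ ^ 2 ≤ ∫⁻ u in Metric.ball c R, ‖f u‖ₑ ^ 2 := by
  have hpi : 0 < 2 * Real.pi := by positivity
  let B : Set (Fin n → ℂ) := Metric.ball 0 R
  let F : (Fin n → ℂ) → ENNReal := B.indicator fun u => ‖f (c + u)‖ₑ ^ 2
  have hB : MeasurableSet B := Metric.isOpen_ball.measurableSet
  have hmaps : Set.MapsTo (fun u : Fin n → ℂ => c + u) B (Metric.ball c R) := by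
    intro u hu
    simpa [B] using hu
  have hcont : ContinuousOn (fun u => f (c + u)) B :=
    hf.continuousOn.comp (by fun_prop) hmaps
  have hF : Measurable F := by
    have h1 : ContinuousOn (fun u => ‖f (c + u)‖ₑ ^ 2) B :=
      (ENNReal.continuous_pow 2).comp_continuousOn (continuous_enorm.comp_continuousOn hcont)
    classical
    have h2 := h1.measurable_piecewise (g := 0) continuousOn_const hB
    rwa [Set.piecewise_eq_indicator] at h2
  -- A common phase factor preserves Lebesgue measure, so averaging over all rotations leaves the
  -- integral unchanged. This reduces the estimate to one-dimensional circle means in the complex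
  -- line through each u.
  have hrot : ∀ θ : ℝ, ∫⁻ u, F ((Circle.exp θ : ℂ) • u) = ∫⁻ u, F u := fun θ =>
    (measurePreserving_smul_circle (Circle.exp θ)).lintegral_comp hF
  have htrans : ∫⁻ u, F u = ∫⁻ u in Metric.ball c R, ‖f u‖ₑ ^ 2 := by
    rw [← lintegral_indicator Metric.isOpen_ball.measurableSet,
      ← lintegral_add_left_eq_self ((Metric.ball c R).indicator _) c]
    refine lintegral_congr fun u => ?_
    by_cases hu : u ∈ B
    · exact (Set.indicator_of_mem hu _).trans
        (Set.indicator_of_mem (hmaps hu) fun u => ‖f u‖ₑ ^ 2).symm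
    · refine (Set.indicator_of_notMem hu _).trans (Set.indicator_of_notMem ?_ _).symm
      simpa [B] using hu
  have hpt : ∀ u ∈ B, ENNReal.ofReal (2 * Real.pi) * ‖f c‖ₑ ^ 2 ≤
      ∫⁻ θ in Set.Ioc 0 (2 * Real.pi), F ((Circle.exp θ : ℂ) • u) := by
    intro u hu
    have huR : ‖u‖ < R := by simpa [B] using hu
    -- A disc slightly larger than the unit disc still maps into the ball under z ↦ c + z u; for u =
    -- 0 any radius above 1 serves.
    obtain ⟨r, hr1, hr⟩ : ∃ r : ℝ, 1 < r ∧ r * ‖u‖ < R := by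
      rcases (norm_nonneg u).eq_or_lt with h0 | h0
      · exact ⟨2, one_lt_two, by rw [← h0] at huR ⊢; simpa using huR⟩
      · obtain ⟨r, h1, h2⟩ := exists_between ((one_lt_div h0).2 huR)
        exact ⟨r, h1, (lt_div_iff₀ h0).1 h2⟩
    have hd : DifferentiableOn ℂ (fun z : ℂ => f (c + z • u)) (Metric.ball 0 r) := by
      refine hf.comp (by fun_prop) fun z hz => ?_
      rw [mem_ball_zero_iff] at hz
      rw [mem_ball_iff_norm, add_sub_cancel_left, norm_smul]
      exact (mul_le_mul_of_nonneg_right hz.le (norm_nonneg _)).trans_lt hr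
    have h1 := enorm_sq_le_lintegral_circle hr1 hd
    simp only [zero_smul, add_zero] at h1
    refine h1.trans_eq (lintegral_congr fun θ => ?_)
    refine (Set.indicator_of_mem (?_ : (Circle.exp θ : ℂ) • u ∈ B) fun u => ‖f (c + u)‖ₑ ^ 2).symm
    rw [mem_ball_zero_iff, norm_smul, Circle.norm_coe, one_mul]
    exact huR
  have hswap : ∫⁻ u, ∫⁻ θ in Set.Ioc 0 (2 * Real.pi), F ((Circle.exp θ : ℂ) • u) =
      ∫⁻ θ in Set.Ioc 0 (2 * Real.pi), ∫⁻ u, F ((Circle.exp θ : ℂ) • u) := by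
    refine lintegral_lintegral_swap (Measurable.aemeasurable ?_)
    refine hF.comp (Continuous.measurable ?_)
    fun_prop
  have h2 : ENNReal.ofReal (2 * Real.pi) * (volume B * ‖f c‖ₑ ^ 2) ≤
      ENNReal.ofReal (2 * Real.pi) * ∫⁻ u in Metric.ball c R, ‖f u‖ₑ ^ 2 := by
    calc ENNReal.ofReal (2 * Real.pi) * (volume B * ‖f c‖ₑ ^ 2)
        = ∫⁻ u in B, ENNReal.ofReal (2 * Real.pi) * ‖f c‖ₑ ^ 2 := by
          rw [setLIntegral_const]; ring
      _ ≤ ∫⁻ u in B, ∫⁻ θ in Set.Ioc 0 (2 * Real.pi), F ((Circle.exp θ : ℂ) • u) :=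
          setLIntegral_mono' hB hpt
      _ ≤ ∫⁻ u, ∫⁻ θ in Set.Ioc 0 (2 * Real.pi), F ((Circle.exp θ : ℂ) • u) :=
          setLIntegral_le_lintegral _ _
      _ = _ := by
          rw [hswap]
          simp only [hrot, htrans]
          rw [setLIntegral_const, Real.volume_Ioc, sub_zero, mul_comm]
  exact (ENNReal.mul_le_mul_iff_right (by simpa using hpi) ENNReal.ofReal_ne_top).1 h2

theorem mapsTo_closedBall_of_norm_le {E : Type*} {f : E → ℂ} {s : Set E} {c : E} (hc : c ∈ s)
    {C : ℝ} (h : ∀ u ∈ s, ‖f u‖ ≤ C) : Set.MapsTo f s (Metric.closedBall (f c) (2 * C)) := by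
  intro u hu
  rw [mem_closedBall_iff_norm]
  linarith [norm_sub_le (f u) (f c), h u hu, h c hc]

/-- A bounded holomorphic function is Lipschitz on a smaller ball. -/
theorem norm_sub_le_of_bounded_ball {E : Type*} [NormedAddCommGroup E] [NormedSpace ℂ E]
    {f : E → ℂ} {c : E} {R C : ℝ} (hf : DifferentiableOn ℂ f (Metric.ball c R))
    (h : ∀ u ∈ Metric.ball c R, ‖f u‖ ≤ C) {u w : E}
    (hu : u ∈ Metric.ball c (R / 4)) (hw : w ∈ Metric.ball c (R / 4)) :
    ‖f u - f w‖ ≤ 4 * C / R * ‖u - w‖ := by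
  rw [Metric.mem_ball] at hu hw
  have hR : 0 < R := by linarith [dist_nonneg (x := u) (y := c)]
  -- The ball of radius R/2 about w contains u, since both points lie within R/4 of c. On it f
  -- varies by at most 2C, and the Schwarz lemma gives the constant 2C/(R/2).
  have hsub : Metric.ball w (R / 2) ⊆ Metric.ball c R :=
    Metric.ball_subset_ball' (by linarith)
  have hw0 : w ∈ Metric.ball w (R / 2) := Metric.mem_ball_self (by positivity)
  have h1 := Complex.dist_le_div_mul_dist_of_mapsTo_ball (hf.mono hsub)
    (mapsTo_closedBall_of_norm_le hw0 fun u hu => h u (hsub hu)) (z := u) (by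
      rw [Metric.mem_ball]
      linarith [dist_triangle_right u w c])
  rw [dist_eq_norm, dist_eq_norm] at h1
  convert h1 using 2
  field_simp
  ring

/-- A pointwise limit of bounded holomorphic functions is holomorphic. -/
theorem differentiableAt_of_tendsto {E : Type*} [NormedAddCommGroup E] [NormedSpace ℂ E]
    [FiniteDimensional ℂ E] {ι : Type*} {l : Filter ι} [l.NeBot] {f : ι → E → ℂ} {g : E → ℂ} {c : E}
    {R C : ℝ} (hR : 0 < R) (hf : ∀ᶠ i in l, DifferentiableOn ℂ (f i) (Metric.ball c R))
    (h : ∀ᶠ i in l, ∀ u ∈ Metric.ball c R, ‖f i u‖ ≤ C)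
    (hlim : ∀ u ∈ Metric.ball c R, Tendsto (fun i => f i u) l (𝓝 (g u))) :
    DifferentiableAt ℂ g c := by
  have hc : c ∈ Metric.ball c R := Metric.mem_ball_self hR
  -- The derivatives at c stay in a compact ball by the Cauchy estimate, so along an ultrafilter
  -- they have a limit D, the candidate derivative of g.
  let 𝓤 : Ultrafilter ι := Ultrafilter.of l
  have hle : (𝓤 : Filter ι) ≤ l := Ultrafilter.of_le l
  have : ProperSpace (E →L[ℂ] ℂ) := FiniteDimensional.proper ℂ _
  have hD : ∀ᶠ i in l, fderiv ℂ (f i) c ∈ Metric.closedBall (0 : E →L[ℂ] ℂ) (2 * C / R) := by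
    filter_upwards [hf, h] with i h1 h2
    rw [mem_closedBall_zero_iff]
    exact Complex.norm_fderiv_le_div_of_mapsTo_ball h1 (mapsTo_closedBall_of_norm_le hc h2) hR
  obtain ⟨D, -, hDlim⟩ := (isCompact_closedBall (0 : E →L[ℂ] ℂ) (2 * C / R)).ultrafilter_le_nhds
    (𝓤.map fun i => fderiv ℂ (f i) c) (by
      rw [Ultrafilter.coe_map, le_principal_iff]
      exact hle hD)
  have hDlim : Tendsto (fun i => fderiv ℂ (f i) c) 𝓤 (𝓝 D) := hDlim
  -- A first-order Taylor remainder that is quadratic uniformly in i survives the pointwise limit.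
  -- The constant 4C is 2C for the variation of f and 2C for its linear part on the ball.
  have hquad : ∀ᶠ i in l, ∀ u ∈ Metric.ball c R,
      ‖f i u - f i c - fderiv ℂ (f i) c (u - c)‖ ≤ 4 * C / R ^ 2 * ‖u - c‖ ^ 2 := by
    filter_upwards [hf, h, hD] with i h1 h2 h3 u hu
    rw [mem_closedBall_zero_iff] at h3
    have h4 : DifferentiableAt ℂ (f i) c := h1.differentiableAt (Metric.ball_mem_nhds _ hR)
    let F : E → ℂ := fun w => f i w - fderiv ℂ (f i) c (w - c)
    have hFc : F c = f i c := by simp [F]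
    have hF1 : DifferentiableOn ℂ F (Metric.ball c R) := h1.sub (by fun_prop)
    have hF2 : Set.MapsTo F (Metric.ball c R) (Metric.closedBall (F c) (4 * C)) := by
      intro w hw
      have h5 := mapsTo_closedBall_of_norm_le hc h2 hw
      rw [mem_closedBall_iff_norm] at h5 ⊢
      rw [hFc]
      have h6 : ‖fderiv ℂ (f i) c (w - c)‖ ≤ 2 * C := by
        refine (ContinuousLinearMap.le_opNorm _ _).trans ?_
        rw [mem_ball_iff_norm] at hw
        calc _ ≤ 2 * C / R * R := mul_le_mul h3 hw.le (norm_nonneg _) ((norm_nonneg _).trans h3)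
          _ = _ := by field_simp
      have h7 : F w - f i c = (f i w - f i c) - fderiv ℂ (f i) c (w - c) := by
        simp only [F]; ring
      rw [h7]
      linarith [norm_sub_le (f i w - f i c) (fderiv ℂ (f i) c (w - c))]
    -- With the linear part removed, F - F c vanishes to second order at c, and the higher-order
    -- Schwarz lemma supplies the square.
    have hF3 : (fun w => F w - F c) =o[𝓝 c] (fun w => ‖w - c‖ ^ 1) := by
      have h5 := h4.hasFDerivAt.isLittleO
      simp only [pow_one]
      refine (h5.norm_right).congr_left fun w => ?_
      rw [hFc]; simp only [F]; ring
    have h8 := Complex.dist_le_mul_div_pow_of_mapsTo_ball_of_isLittleO hF1 hF2 hF3 hu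
    rw [dist_eq_norm, dist_eq_norm, hFc] at h8
    have h9 : f i u - f i c - fderiv ℂ (f i) c (u - c) = F u - f i c := by
      simp only [F]; ring
    rw [h9]
    refine h8.trans_eq ?_
    rw [one_add_one_eq_two, div_pow]
    field_simp
  have hlim2 : ∀ u ∈ Metric.ball c R, ‖g u - g c - D (u - c)‖ ≤ 4 * C / R ^ 2 * ‖u - c‖ ^ 2 := by
    intro u hu
    have h1 : Tendsto (fun i => fderiv ℂ (f i) c (u - c)) 𝓤 (𝓝 (D (u - c))) :=
      ((ContinuousLinearMap.apply ℂ ℂ (u - c)).continuous.tendsto D).comp hDlim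
    refine le_of_tendsto ((((hlim u hu).mono_left hle).sub ((hlim c hc).mono_left hle)).sub h1).norm ?_
    filter_upwards [hle hquad] with i hi using hi u hu
  refine HasFDerivAt.differentiableAt (f' := D) (HasFDerivAt.of_isLittleO ?_)
  refine Asymptotics.IsBigO.trans_isLittleO (g := fun u => ‖u - c‖ ^ 2) ?_ ?_
  · refine Asymptotics.IsBigO.of_bound (4 * C / R ^ 2) ?_
    filter_upwards [Metric.ball_mem_nhds c hR] with u hu
    simpa using hlim2 u hu
  · exact Asymptotics.isLittleO_pow_sub_sub c one_lt_two

/-! ### Jacobians -/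

section Jacobian

variable {n : ℕ} {X : Type*} [TopologicalSpace X] [ChartedSpace (Fin n → ℂ) X]
  {Y : Type*} [TopologicalSpace Y] [ChartedSpace (Fin n → ℂ) Y]
  {Z : Type*} [TopologicalSpace Z] [ChartedSpace (Fin n → ℂ) Z]

/-- The differential, read in the standard bases of the tangent spaces. -/
def dmap (n : ℕ) {X Y : Type*} [TopologicalSpace X] [ChartedSpace (Fin n → ℂ) X]
    [TopologicalSpace Y] [ChartedSpace (Fin n → ℂ) Y] (Φ : X → Y) (x : X) :
    (Fin n → ℂ) →L[ℂ] (Fin n → ℂ) :=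
  mfderiv 𝓘(ℂ, Fin n → ℂ) 𝓘(ℂ, Fin n → ℂ) Φ x

/-- The Jacobian determinant in the standard bases of the tangent spaces. -/
def jac (n : ℕ) {X Y : Type*} [TopologicalSpace X] [ChartedSpace (Fin n → ℂ) X]
    [TopologicalSpace Y] [ChartedSpace (Fin n → ℂ) Y] (Φ : X → Y) (x : X) : ℂ :=
  (dmap n Φ x).det

/-- Holomorphic maps between `n`-dimensional complex manifolds, at a point. -/
abbrev HolAt (n : ℕ) {X Y : Type*} [TopologicalSpace X] [ChartedSpace (Fin n → ℂ) X]
    [TopologicalSpace Y] [ChartedSpace (Fin n → ℂ) Y] (Φ : X → Y) (x : X) : Prop :=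
  ContMDiffAt 𝓘(ℂ, Fin n → ℂ) 𝓘(ℂ, Fin n → ℂ) ω Φ x

theorem HolAt.mdiff {Φ : X → Y} {x : X} (h : HolAt n Φ x) :
    MDifferentiableAt 𝓘(ℂ, Fin n → ℂ) 𝓘(ℂ, Fin n → ℂ) Φ x :=
  h.mdifferentiableAt (by simp)

theorem dmap_comp {Ψ : Y → Z} {Φ : X → Y} {x : X} (hΨ : HolAt n Ψ (Φ x)) (hΦ : HolAt n Φ x) :
    dmap n (Ψ ∘ Φ) x = (dmap n Ψ (Φ x)).comp (dmap n Φ x) :=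
  mfderiv_comp x hΨ.mdiff hΦ.mdiff

theorem dmap_congr {Φ Ψ : X → Y} {x : X} (h : Φ =ᶠ[𝓝 x] Ψ) : dmap n Φ x = dmap n Ψ x :=
  h.mfderiv_eq

theorem dmap_id (x : X) : dmap n (id : X → X) x = ContinuousLinearMap.id ℂ _ := mfderiv_id

theorem det_comp (A B : (Fin n → ℂ) →L[ℂ] (Fin n → ℂ)) : (A.comp B).det = A.det * B.det := by
  simp only [ContinuousLinearMap.det]
  exact LinearMap.det_comp _ _

theorem jac_comp {Ψ : Y → Z} {Φ : X → Y} {x : X} (hΨ : HolAt n Ψ (Φ x)) (hΦ : HolAt n Φ x) :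
    jac n (Ψ ∘ Φ) x = jac n Ψ (Φ x) * jac n Φ x := by
  rw [jac, dmap_comp hΨ hΦ, det_comp]; rfl

theorem jac_congr {Φ Ψ : X → Y} {x : X} (h : Φ =ᶠ[𝓝 x] Ψ) : jac n Φ x = jac n Ψ x := by
  rw [jac, dmap_congr h]; rfl

theorem jac_id (x : X) : jac n (id : X → X) x = 1 := by
  rw [jac, dmap_id]
  simp [ContinuousLinearMap.det]

theorem dmap_eq_fderiv (T : (Fin n → ℂ) → (Fin n → ℂ)) (u : Fin n → ℂ) :
    dmap n T u = fderiv ℂ T u := mfderiv_eq_fderiv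

theorem jac_mul_jac_eq_one {Ψ : Y → X} {Φ : X → Y} {x : X} (hΨ : HolAt n Ψ (Φ x))
    (hΦ : HolAt n Φ x) (h : ∀ᶠ z in 𝓝 x, Ψ (Φ z) = z) : jac n Ψ (Φ x) * jac n Φ x = 1 := by
  rw [← jac_comp hΨ hΦ, jac_congr (Φ := Ψ ∘ Φ) (Ψ := id) h, jac_id]

/-- The real determinant is the norm from ℂ to ℝ of the complex one. This matches the real change of
variables formula with the weight by which (n,n)-forms transform. -/
theorem det_restrictScalars_abs (A : (Fin n → ℂ) →L[ℂ] (Fin n → ℂ)) :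
    |(A.restrictScalars ℝ).det| = ‖A.det‖ ^ 2 := by
  have h1 : (A.restrictScalars ℝ).det = Algebra.norm ℝ A.det := by
    simp only [ContinuousLinearMap.det]
    exact LinearMap.det_restrictScalars
  rw [h1, Algebra.norm_complex_apply, Complex.normSq_eq_norm_sq, abs_of_nonneg (by positivity)]

theorem holAt_chart {e : OpenPartialHomeomorph X (Fin n → ℂ)}
    (he : e ∈ IsManifold.maximalAtlas 𝓘(ℂ, Fin n → ℂ) ω X) {x : X} (hx : x ∈ e.source) :
    HolAt n e x :=
  (contMDiffOn_of_mem_maximalAtlas he).contMDiffAt (e.open_source.mem_nhds hx)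

theorem holAt_chart_symm {e : OpenPartialHomeomorph X (Fin n → ℂ)}
    (he : e ∈ IsManifold.maximalAtlas 𝓘(ℂ, Fin n → ℂ) ω X) {u : Fin n → ℂ} (hu : u ∈ e.target) :
    HolAt n e.symm u :=
  (contMDiffOn_symm_of_mem_maximalAtlas he).contMDiffAt (e.open_target.mem_nhds hu)

theorem jac_chart_symm_ne_zero {e : OpenPartialHomeomorph X (Fin n → ℂ)}
    (he : e ∈ IsManifold.maximalAtlas 𝓘(ℂ, Fin n → ℂ) ω X) {u : Fin n → ℂ} (hu : u ∈ e.target) :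
    jac n e.symm u ≠ 0 := by
  refine right_ne_zero_of_mul_eq_one (jac_mul_jac_eq_one
    (holAt_chart he (e.map_target hu)) (holAt_chart_symm he hu) ?_)
  filter_upwards [e.open_target.mem_nhds hu] with w hw using e.right_inv hw

/-- Near u the map factors through the chart as `e.symm ∘ (e ∘ φ)`. The second factor is a map of
ℂⁿ, to which ordinary calculus applies. -/
theorem jac_eq_of_chart {e : OpenPartialHomeomorph X (Fin n → ℂ)}
    (he : e ∈ IsManifold.maximalAtlas 𝓘(ℂ, Fin n → ℂ) ω X) {φ : (Fin n → ℂ) → X} {u : Fin n → ℂ}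
    (hφ : HolAt n φ u) (hu : φ u ∈ e.source) :
    jac n φ u = jac n e.symm (e (φ u)) * (fderiv ℂ (e ∘ φ) u).det := by
  have h1 : φ =ᶠ[𝓝 u] e.symm ∘ (e ∘ φ) := by
    filter_upwards [hφ.continuousAt.preimage_mem_nhds (e.open_source.mem_nhds hu)] with w hw
    exact (e.left_inv hw).symm
  have h2 : HolAt n (e ∘ φ) u := (holAt_chart he hu).comp u hφ
  rw [jac_congr h1, jac_comp (Φ := e ∘ φ) (x := u) (holAt_chart_symm he (e.map_source hu)) h2,
    ← dmap_eq_fderiv]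
  rfl

theorem fderiv_chart_comp {e : OpenPartialHomeomorph X (Fin n → ℂ)}
    (he : e ∈ IsManifold.maximalAtlas 𝓘(ℂ, Fin n → ℂ) ω X) {φ : (Fin n → ℂ) → X} {u : Fin n → ℂ}
    (hφ : HolAt n φ u) (hu : φ u ∈ e.source) : ContDiffAt ℂ ω (e ∘ φ) u :=
  contMDiffAt_iff_contDiffAt.1 ((holAt_chart he hu).comp u hφ)

end Jacobian

/-! ### Forms of top degree as functions -/

section Forms

variable {n : ℕ} {X : Type*} [TopologicalSpace X] [ChartedSpace (Fin n → ℂ) X]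

/-- The standard basis of the tangent space. -/
def stdFrame (x : X) : Fin n → TangentSpace 𝓘(ℂ, Fin n → ℂ) x :=
  fun i => (Pi.single i (1 : ℂ) : Fin n → ℂ)

/-- The value of a form on the standard basis of the tangent space. -/
def TopForm.toFun (f : TopForm n X) (x : X) : ℂ :=
  f x (stdFrame x)

/-- The value of a density on the standard basis of the tangent space. -/
def Density.toFun (η : Density n X) (x : X) : ℂ :=
  η x (stdFrame x)

/-- The determinant of a frame of the tangent space. -/
def frameDet {x : X} (v : Fin n → TangentSpace 𝓘(ℂ, Fin n → ℂ) x) : ℂ :=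
  Matrix.det (fun i j => (v i : Fin n → ℂ) j)

theorem frameDet_map {x : X} (L : (Fin n → ℂ) →L[ℂ] (Fin n → ℂ)) :
    frameDet (x := x) (fun i => L (Pi.single i (1 : ℂ) : Fin n → ℂ)) = L.det := by
  rw [ContinuousLinearMap.det, ← LinearMap.det_toMatrix', ← Matrix.det_transpose]
  refine congrArg Matrix.det ?_
  ext i j
  rw [Matrix.transpose_apply, LinearMap.toMatrix'_apply]
  rfl

/-- The frame is itself the image of the standard basis under a linear map A, so this is
multiplicativity of the determinant for L and A. -/
theorem frameDet_comp {x : X} (L : (Fin n → ℂ) →L[ℂ] (Fin n → ℂ))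
    (v : Fin n → TangentSpace 𝓘(ℂ, Fin n → ℂ) x) {Y : Type*} [TopologicalSpace Y]
    [ChartedSpace (Fin n → ℂ) Y] {y : Y} :
    frameDet (x := y) (fun i => L (v i)) = L.det * frameDet v := by
  let A : (Fin n → ℂ) →L[ℂ] (Fin n → ℂ) :=
    LinearMap.toContinuousLinearMap (Matrix.toLin' (Matrix.transpose fun i j => (v i : Fin n → ℂ) j))
  have hA : ∀ i, A (Pi.single i 1) = v i := by
    intro i
    ext j
    simp only [A, LinearMap.coe_toContinuousLinearMap', Matrix.toLin'_apply, Matrix.mulVec_single,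
      MulOpposite.op_one, one_smul]
    rfl
  have h1 := frameDet_map (x := x) A
  have h2 := frameDet_map (x := y) (L.comp A)
  simp only [ContinuousLinearMap.comp_apply, hA] at h1 h2
  rw [h2, det_comp, ← h1]

/-- Top-degree alternating forms are multiples of the determinant. Forms may thus be handled as
scalar functions `toFun`, with Jacobians recording how they transform. -/
theorem TopForm.apply_eq (f : TopForm n X) (x : X)
    (v : Fin n → TangentSpace 𝓘(ℂ, Fin n → ℂ) x) : f x v = frameDet v * f.toFun x := by
  have h := AlternatingMap.eq_smul_basis_det (Pi.basisFun ℂ (Fin n))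
    ((f x).toAlternatingMap : (Fin n → ℂ) [⋀^Fin n]→ₗ[ℂ] ℂ)
  have h1 : f x v = f x (fun i => Pi.basisFun ℂ (Fin n) i) * (Pi.basisFun ℂ (Fin n)).det v :=
    congrArg (fun g : (Fin n → ℂ) [⋀^Fin n]→ₗ[ℂ] ℂ => g v) h
  have h2 : (Pi.basisFun ℂ (Fin n)).det v = frameDet v :=
    Pi.basisFun_det_apply (fun i j => (v i : Fin n → ℂ) j)
  rw [mul_comm]
  refine h1.trans (congrArg₂ (· * ·) ?_ h2)
  change f x (fun i => Pi.basisFun ℂ (Fin n) i) = f x (stdFrame x)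
  congr with i
  rw [Pi.basisFun_apply]
  rfl

/-- The form with a given value on the standard basis of the tangent space. -/
def TopForm.ofFun (s : X → ℂ) : TopForm n X := fun x =>
  s x • ({ (Matrix.detRowAlternating : (Fin n → ℂ) [⋀^Fin n]→ₗ[ℂ] ℂ) with
    cont := by
      change Continuous fun v : Fin n → Fin n → ℂ => Matrix.det v
      exact Continuous.matrix_det continuous_id } : (Fin n → ℂ) [⋀^Fin n]→L[ℂ] ℂ)

theorem TopForm.toFun_ofFun (s : X → ℂ) (x : X) : (TopForm.ofFun (n := n) s).toFun x = s x := by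
  have h : Matrix.det (fun i => (Pi.single i (1 : ℂ) : Fin n → ℂ)) = 1 := by
    rw [← Matrix.det_one (n := Fin n) (R := ℂ)]
    congr 1
    ext i j
    simp [Matrix.one_apply, Pi.single_apply, eq_comm]
  change s x * Matrix.det (fun i => (Pi.single i (1 : ℂ) : Fin n → ℂ)) = s x
  rw [h, mul_one]

/-- The coefficient of a form in a holomorphic parametrization. -/
def TopForm.param (f : TopForm n X) (φ : (Fin n → ℂ) → X) (u : Fin n → ℂ) : ℂ :=
  jac n φ u * f.toFun (φ u)

/-- The coefficient of a density in a holomorphic parametrization. -/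
def Density.param (η : Density n X) (φ : (Fin n → ℂ) → X) (u : Fin n → ℂ) : ℂ :=
  (‖jac n φ u‖ ^ 2 : ℝ) * η.toFun (φ u)

/-- Densities which transform as `(n,n)`-forms. -/
def Density.IsForm (η : Density n X) : Prop :=
  ∀ x v, η x v = (‖frameDet v‖ ^ 2 : ℝ) * η.toFun x

theorem TopForm.coeff_eq_param (f : TopForm n X) (e : OpenPartialHomeomorph X (Fin n → ℂ)) :
    f.coeff e = f.param e.symm := by
  funext u
  rw [TopForm.coeff, TopForm.apply_eq, TopForm.param, jac, ← frameDet_map (x := e.symm u)]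
  rfl

theorem Density.IsForm.coeff_eq_param {η : Density n X} (hη : η.IsForm)
    (e : OpenPartialHomeomorph X (Fin n → ℂ)) : η.coeff e = η.param e.symm := by
  funext u
  rw [Density.coeff, hη, Density.param, jac, ← frameDet_map (x := e.symm u)]
  rfl

theorem wedgeConj_self_apply (f : TopForm n X) (x : X)
    (v : Fin n → TangentSpace 𝓘(ℂ, Fin n → ℂ) x) : wedgeConj f f x v = (‖f x v‖ ^ 2 : ℝ) := by
  rw [wedgeConj, Complex.mul_conj, Complex.normSq_eq_norm_sq]

theorem isForm_wedgeConj (f : TopForm n X) : (wedgeConj f f).IsForm := by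
  intro x v
  rw [wedgeConj_self_apply, Density.toFun, wedgeConj_self_apply, f.apply_eq]
  rw [norm_mul, mul_pow, Complex.ofReal_mul]
  rfl

theorem wedgeConj_param (f : TopForm n X) (φ : (Fin n → ℂ) → X) (u : Fin n → ℂ) :
    (wedgeConj f f).param φ u = (‖f.param φ u‖ ^ 2 : ℝ) := by
  rw [Density.param, Density.toFun, wedgeConj_self_apply, TopForm.param, norm_mul, mul_pow,
    Complex.ofReal_mul]
  rfl

/-- The derivative of an analytic map is again differentiable, and the determinant is a polynomial
in its entries. -/
theorem differentiableAt_det {T : (Fin n → ℂ) → (Fin n → ℂ)} {u : Fin n → ℂ}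
    (hT : ContDiffAt ℂ ω T u) : DifferentiableAt ℂ (fun w => (fderiv ℂ T w).det) u := by
  have h1 : DifferentiableAt ℂ (fderiv ℂ T) u :=
    (hT.fderiv_right (m := ω) (by simp)).differentiableAt (by simp)
  have h2 : ∀ w, (fderiv ℂ T w).det =
      Matrix.det (Matrix.of fun i j => fderiv ℂ T w (Pi.single i (1 : ℂ)) j) :=
    fun w => (frameDet_map (x := (0 : Fin n → ℂ)) (fderiv ℂ T w)).symm
  simp only [h2, Matrix.det_apply, Matrix.of_apply]
  refine DifferentiableAt.fun_sum fun σ _ =>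
    DifferentiableAt.const_smul (R := ℤˣ) ?_ (Equiv.Perm.sign σ)
  have h3 : ∀ i, DifferentiableAt ℂ (fun w => fderiv ℂ T w (Pi.single (σ i) (1 : ℂ)) i) u :=
    fun i => differentiableAt_pi.1
      (h1.clm_apply (differentiableAt_const (Pi.single (σ i) (1 : ℂ)))) i
  exact (HasFDerivAt.finsetProd fun i _ => (h3 i).hasFDerivAt).differentiableAt

theorem TopForm.param_eq_of_chart (f : TopForm n X) {e : OpenPartialHomeomorph X (Fin n → ℂ)}
    (he : e ∈ IsManifold.maximalAtlas 𝓘(ℂ, Fin n → ℂ) ω X) {φ : (Fin n → ℂ) → X} {u : Fin n → ℂ}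
    (hφ : HolAt n φ u) (hu : φ u ∈ e.source) :
    f.param φ u = f.coeff e (e (φ u)) * (fderiv ℂ (e ∘ φ) u).det := by
  rw [f.coeff_eq_param, TopForm.param, TopForm.param, jac_eq_of_chart he hφ hu, e.left_inv hu]
  ring

theorem Density.param_eq_of_chart (η : Density n X) {e : OpenPartialHomeomorph X (Fin n → ℂ)}
    (he : e ∈ IsManifold.maximalAtlas 𝓘(ℂ, Fin n → ℂ) ω X) {φ : (Fin n → ℂ) → X} {u : Fin n → ℂ}
    (hφ : HolAt n φ u) (hu : φ u ∈ e.source) :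
    η.param φ u = (‖(fderiv ℂ (e ∘ φ) u).det‖ ^ 2 : ℝ) * η.param e.symm (e (φ u)) := by
  rw [Density.param, Density.param, jac_eq_of_chart he hφ hu, e.left_inv hu, norm_mul, mul_pow]
  push_cast
  ring

variable [IsManifold 𝓘(ℂ, Fin n → ℂ) ω X]

/-- The coefficient of a holomorphic form in a holomorphic parametrization is holomorphic. -/
theorem differentiableAt_param {f : TopForm n X} (hf : f ∈ holomorphicForms n X)
    {φ : (Fin n → ℂ) → X} {u : Fin n → ℂ} (hφ : ∀ᶠ w in 𝓝 u, HolAt n φ w) :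
    DifferentiableAt ℂ (f.param φ) u := by
  let e := chartAt (Fin n → ℂ) (φ u)
  have he : e ∈ IsManifold.maximalAtlas 𝓘(ℂ, Fin n → ℂ) ω X :=
    IsManifold.chart_mem_maximalAtlas _
  have hu : φ u ∈ e.source := mem_chart_source _ _
  have hT := fderiv_chart_comp he hφ.self_of_nhds hu
  have h1 : f.param φ =ᶠ[𝓝 u] fun w => f.coeff e ((e ∘ φ) w) * (fderiv ℂ (e ∘ φ) w).det := by
    filter_upwards [hφ, hφ.self_of_nhds.continuousAt.preimage_mem_nhds (e.open_source.mem_nhds hu)]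
      with w hw hw'
    exact f.param_eq_of_chart he hw hw'
  refine DifferentiableAt.congr_of_eventuallyEq ?_ h1
  refine DifferentiableAt.mul ?_ (differentiableAt_det hT)
  have h2 : DifferentiableAt ℂ (f.coeff e) ((e ∘ φ) u) :=
    (hf e he).differentiableAt (e.open_target.mem_nhds (e.map_source hu))
  exact h2.comp u (hT.differentiableAt (by simp))

end Forms

/-! ### Change of variables -/

/-- Since φ is continuous only on B, the preimage is taken in the subtype B and then mapped into ℂⁿ.
-/
theorem measurableSet_inter_preimage {n : ℕ} {X : Type*} [TopologicalSpace X]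
    {φ : (Fin n → ℂ) → X} {B : Set (Fin n → ℂ)}
    (hB : MeasurableSet B) (hφ : ContinuousOn φ B) {A : Set X} (hA : MeasurableSet[borel X] A) :
    MeasurableSet (B ∩ φ ⁻¹' A) := by
  let := borel X
  have : BorelSpace X := ⟨rfl⟩
  have h : B ∩ φ ⁻¹' A = Subtype.val '' ((fun u : B => φ u) ⁻¹' A) := by
    ext u
    simp [and_comm]
  rw [h]
  exact hB.subtype_image ((continuousOn_iff_continuous_domRestrict.1 hφ).measurable hA)

section ChangeOfVariables

variable {n : ℕ} {X : Type*} [TopologicalSpace X] [SecondCountableTopology X]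
  [ChartedSpace (Fin n → ℂ) X] [IsManifold 𝓘(ℂ, Fin n → ℂ) ω X]

instance countable_centers : Countable (centers n X) :=
  (decomposition n X).countable_range

theorem chartAt_mem (y : X) :
    chartAt (Fin n → ℂ) y ∈ IsManifold.maximalAtlas 𝓘(ℂ, Fin n → ℂ) ω X :=
  IsManifold.chart_mem_maximalAtlas _

theorem mem_chart_source_of_center {x y : X} (h : (decomposition n X).center x = y) :
    x ∈ (chartAt (Fin n → ℂ) y).source := by
  subst h
  exact (decomposition n X).mem_source x

theorem mem_piece_iff {y : X} {u : Fin n → ℂ} (hu : u ∈ (chartAt (Fin n → ℂ) y).target) :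
    u ∈ piece n y ↔ (decomposition n X).center ((chartAt (Fin n → ℂ) y).symm u) = y := by
  constructor
  · rintro ⟨x, hx, rfl⟩
    rwa [(chartAt (Fin n → ℂ) y).left_inv (mem_chart_source_of_center hx)]
  · exact fun h => ⟨_, h, (chartAt (Fin n → ℂ) y).right_inv hu⟩

/-- The two local expressions of η differ by |det|², which is exactly the real Jacobian of the
transition map `e ∘ φ`. -/
theorem lintegral_param_eq_of_chart {η : Density n X} {e : OpenPartialHomeomorph X (Fin n → ℂ)}
    (he : e ∈ IsManifold.maximalAtlas 𝓘(ℂ, Fin n → ℂ) ω X) {φ : (Fin n → ℂ) → X}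
    {B : Set (Fin n → ℂ)} (hB : MeasurableSet B) (hφ : ∀ u ∈ B, HolAt n φ u)
    (hinj : Set.InjOn φ B) (hsub : Set.MapsTo φ B e.source) :
    MeasurableSet ((e ∘ φ) '' B) ∧ ∫⁻ u in B, ENNReal.ofReal (η.param φ u).re =
      ∫⁻ u in (e ∘ φ) '' B, ENNReal.ofReal (η.param e.symm u).re := by
  have hd : ∀ u ∈ B, HasFDerivWithinAt (e ∘ φ) ((fderiv ℂ (e ∘ φ) u).restrictScalars ℝ) B u :=
    fun u hu => (((fderiv_chart_comp he (hφ u hu) (hsub hu)).differentiableAt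
      (by simp)).hasFDerivAt.restrictScalars ℝ).hasFDerivWithinAt
  have hinj' : Set.InjOn (e ∘ φ) B := e.injOn.comp hinj hsub
  refine ⟨measurable_image_of_fderivWithin hB hd hinj', ?_⟩
  rw [lintegral_image_eq_lintegral_abs_det_fderiv_mul volume hB hd hinj']
  refine setLIntegral_congr_fun hB fun u hu => ?_
  rw [η.param_eq_of_chart he (hφ u hu) (hsub hu), det_restrictScalars_abs, Complex.re_ofReal_mul,
    ENNReal.ofReal_mul (by positivity)]
  rfl

/-- The integral of an `(n,n)`-form over the disjoint union of countably many parametrized sets. -/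
theorem tsum_lintegral_param {η : Density n X} (hη : η.IsForm) {ι : Type*} [Countable ι]
    {φ : ι → (Fin n → ℂ) → X} {B : ι → Set (Fin n → ℂ)} (hB : ∀ i, MeasurableSet (B i))
    (hφ : ∀ i, ∀ u ∈ B i, HolAt n (φ i) u) (hinj : ∀ i, Set.InjOn (φ i) (B i))
    (hdisj : Pairwise (Function.onFun Disjoint fun i => φ i '' B i)) :
    ∑' i, ∫⁻ u in B i, ENNReal.ofReal ((η.param (φ i) u).re) =
      ∑' y : centers n X, ∫⁻ u in piece n (y : X) ∩
        (chartAt (Fin n → ℂ) (y : X)).symm ⁻¹' (⋃ i, φ i '' B i),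
        ENNReal.ofReal (η.coeff (chartAt (Fin n → ℂ) (y : X)) u).re := by
  have hcont : ∀ i, ContinuousOn (φ i) (B i) :=
    fun i u hu => (hφ i u hu).continuousAt.continuousWithinAt
  -- Common refinement of the given parametrized sets and the pieces defining the integral. On each
  -- cell one transition map suffices; the rest is an exchange of two sums.
  let P : ι → X → Set (Fin n → ℂ) := fun i y => B i ∩ φ i ⁻¹' ((decomposition n X).center ⁻¹' {y})
  have hPB : ∀ i y, P i y ⊆ B i := fun i y => Set.inter_subset_left
  have hP : ∀ i y, MeasurableSet (P i y) := fun i y =>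
    measurableSet_inter_preimage (hB i) (hcont i) ((decomposition n X).measurableSet_fiber y)
  have hmaps : ∀ i y, Set.MapsTo (φ i) (P i y) (chartAt (Fin n → ℂ) y).source :=
    fun i y u hu => mem_chart_source_of_center hu.2
  have hkey := fun i (y : X) => lintegral_param_eq_of_chart (η := η) (chartAt_mem y) (hP i y)
    (fun u hu => hφ i u hu.1) ((hinj i).mono (hPB i y)) (hmaps i y)
  have hleft : ∀ i, ∫⁻ u in B i, ENNReal.ofReal ((η.param (φ i) u).re) =
      ∑' y : centers n X, ∫⁻ u in P i y, ENNReal.ofReal ((η.param (φ i) u).re) := by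
    intro i
    rw [← lintegral_iUnion (s := fun y : centers n X => P i y) (fun y => hP i y)]
    · congr 2
      ext u
      simp only [P, Set.mem_iUnion, Set.mem_inter_iff, Set.mem_preimage, Set.mem_singleton_iff]
      exact ⟨fun h => ⟨⟨_, Set.mem_range_self (φ i u)⟩, h, rfl⟩, fun ⟨_, h, _⟩ => h⟩
    · intro y z hyz
      refine Set.disjoint_left.2 fun u hu hu' => hyz (Subtype.ext ?_)
      exact hu.2.symm.trans hu'.2
  have hright : ∀ y : X, ∫⁻ u in piece n y ∩
        (chartAt (Fin n → ℂ) y).symm ⁻¹' (⋃ i, φ i '' B i),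
        ENNReal.ofReal (η.coeff (chartAt (Fin n → ℂ) y) u).re =
      ∑' i, ∫⁻ u in (chartAt (Fin n → ℂ) y ∘ φ i) '' P i y,
        ENNReal.ofReal (η.param (chartAt (Fin n → ℂ) y).symm u).re := by
    intro y
    rw [hη.coeff_eq_param, ← lintegral_iUnion (fun i => (hkey i y).1)]
    · congr 2
      ext u
      simp only [Set.mem_inter_iff, Set.mem_preimage, Set.mem_iUnion, Set.mem_image,
        Function.comp_apply]
      constructor
      · rintro ⟨hu, i, w, hw, hwu⟩
        have hut := piece_subset y hu
        refine ⟨i, w, ⟨hw, ?_⟩, ?_⟩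
        · rw [Set.mem_preimage, hwu]
          exact (mem_piece_iff hut).1 hu
        · rw [hwu]
          exact (chartAt (Fin n → ℂ) y).right_inv hut
      · rintro ⟨i, w, hw, rfl⟩
        refine ⟨⟨φ i w, hw.2, rfl⟩, i, w, hw.1, ?_⟩
        exact ((chartAt (Fin n → ℂ) y).left_inv (hmaps i y hw)).symm
    · intro i j hij
      refine Set.disjoint_left.2 ?_
      rintro _ ⟨w, hw, rfl⟩ ⟨w', hw', hww⟩
      have h1 := (chartAt (Fin n → ℂ) y).injOn (hmaps j y hw') (hmaps i y hw) hww
      exact Set.disjoint_left.1 (hdisj hij) (Set.mem_image_of_mem _ hw.1)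
        (h1 ▸ Set.mem_image_of_mem _ hw'.1)
  simp only [hleft, hright]
  rw [ENNReal.tsum_comm]
  exact tsum_congr fun y => tsum_congr fun i => (hkey i y).2

theorem tsum_lintegral_param_le {η : Density n X} (hη : η.IsForm) {ι : Type*} [Countable ι]
    {φ : ι → (Fin n → ℂ) → X} {B : ι → Set (Fin n → ℂ)} (hB : ∀ i, MeasurableSet (B i))
    (hφ : ∀ i, ∀ u ∈ B i, HolAt n (φ i) u) (hinj : ∀ i, Set.InjOn (φ i) (B i))
    (hdisj : Pairwise (Function.onFun Disjoint fun i => φ i '' B i)) :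
    ∑' i, ∫⁻ u in B i, ENNReal.ofReal ((η.param (φ i) u).re) ≤ η.lintegral := by
  rw [tsum_lintegral_param hη hB hφ hinj hdisj]
  exact ENNReal.tsum_le_tsum fun y => lintegral_mono_set Set.inter_subset_left

/-- In particular the integral does not depend on the chosen decomposition. This is what allows the
integrals over all the quotients to be computed with one family of pieces upstairs. -/
theorem lintegral_eq_tsum_param {η : Density n X} (hη : η.IsForm) {ι : Type*} [Countable ι]
    {φ : ι → (Fin n → ℂ) → X} {B : ι → Set (Fin n → ℂ)} (hB : ∀ i, MeasurableSet (B i))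
    (hφ : ∀ i, ∀ u ∈ B i, HolAt n (φ i) u) (hinj : ∀ i, Set.InjOn (φ i) (B i))
    (hdisj : Pairwise (Function.onFun Disjoint fun i => φ i '' B i))
    (hcov : ⋃ i, φ i '' B i = Set.univ) :
    η.lintegral = ∑' i, ∫⁻ u in B i, ENNReal.ofReal ((η.param (φ i) u).re) := by
  rw [tsum_lintegral_param hη hB hφ hinj hdisj, hcov]
  simp only [Set.preimage_univ, Set.inter_univ]
  rfl

theorem lintegral_param_le {η : Density n X} (hη : η.IsForm) {φ : (Fin n → ℂ) → X}
    {B : Set (Fin n → ℂ)} (hB : MeasurableSet B) (hφ : ∀ u ∈ B, HolAt n φ u)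
    (hinj : Set.InjOn φ B) :
    ∫⁻ u in B, ENNReal.ofReal ((η.param φ u).re) ≤ η.lintegral := by
  have h := tsum_lintegral_param_le hη (ι := Unit) (φ := fun _ => φ) (B := fun _ => B)
    (fun _ => hB) (fun _ => hφ) (fun _ => hinj) (fun i j h => (h (Subsingleton.elim i j)).elim)
  simpa using h

end ChangeOfVariables

/-! ### Finite covers by parametrized sets -/

section Cover

variable {n : ℕ} {X : Type*} [TopologicalSpace X]

/-- Countably many open parametrized sets are made disjoint. -/
theorem exists_disjoint_pieces {ι : Type*} [LinearOrder ι] [WellFoundedLT ι] [Countable ι]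
    {φ : ι → (Fin n → ℂ) → X} {U : ι → Set (Fin n → ℂ)} (hU : ∀ i, IsOpen (U i))
    (hφ : ∀ i, ContinuousOn (φ i) (U i)) (hop : ∀ i, IsOpen (φ i '' U i)) :
    ∃ B : ι → Set (Fin n → ℂ), (∀ i, MeasurableSet (B i)) ∧ (∀ i, B i ⊆ U i) ∧
      (∀ i, IsMin i → B i = U i) ∧
      (Pairwise (Function.onFun Disjoint fun i => φ i '' B i)) ∧
      ⋃ i, φ i '' B i = ⋃ i, φ i '' U i := by
  -- From each set remove what the earlier ones already cover.
  refine ⟨fun i => U i ∩ φ i ⁻¹' (⋃ k : Set.Iio i, φ k '' U k)ᶜ, fun i => ?_,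
    fun i => Set.inter_subset_left, fun i hi => ?_, ?_, ?_⟩
  · refine measurableSet_inter_preimage (hU i).measurableSet (hφ i) ?_
    let := borel X
    have : BorelSpace X := ⟨rfl⟩
    exact (isOpen_iUnion fun k : Set.Iio i => hop k).measurableSet.compl
  -- Nothing precedes a minimal index, so its piece stays a full open set. The converse direction
  -- needs one piece that is an entire ball about a prescribed point.
  · refine Set.inter_eq_left.2 fun u _ => ?_
    simp only [Set.mem_preimage, Set.mem_compl_iff, Set.mem_iUnion, not_exists]
    exact fun k => (hi.not_lt k.2).elim
  · have key : ∀ i j, i < j → Disjoint (φ i '' (U i ∩ φ i ⁻¹' (⋃ k : Set.Iio i, φ k '' U k)ᶜ))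
        (φ j '' (U j ∩ φ j ⁻¹' (⋃ k : Set.Iio j, φ k '' U k)ᶜ)) := by
      intro i j hij
      refine Set.disjoint_left.2 ?_
      rintro _ ⟨u, hu, rfl⟩ ⟨w, hw, hwu⟩
      exact hw.2 (Set.mem_iUnion.2 ⟨⟨i, hij⟩, u, hu.1, hwu.symm⟩)
    intro i j hij
    rcases lt_or_gt_of_ne hij with h | h
    · exact key i j h
    · exact (key j i h).symm
  · refine subset_antisymm
      (Set.iUnion_mono fun i => Set.image_mono Set.inter_subset_left) fun x hx => ?_
    have hx' : ∃ i, x ∈ φ i '' U i := Set.mem_iUnion.1 hx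
    obtain ⟨i, ⟨u, hu, rfl⟩, hmin⟩ :=
      (wellFounded_lt (α := ι)).has_min {i | x ∈ φ i '' U i} hx'
    refine Set.mem_iUnion.2 ⟨i, u, ⟨hu, ?_⟩, rfl⟩
    simp only [Set.mem_preimage, Set.mem_compl_iff, Set.mem_iUnion, not_exists]
    exact fun k hk => hmin k hk k.2

variable [SecondCountableTopology X] [ChartedSpace (Fin n → ℂ) X]
  [IsManifold 𝓘(ℂ, Fin n → ℂ) ω X]

theorem exists_ball_subset_target {e : OpenPartialHomeomorph X (Fin n → ℂ)} {u : Fin n → ℂ}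
    (hu : u ∈ e.target) : ∃ R > 0, Metric.ball u R ⊆ e.target :=
  Metric.isOpen_iff.1 e.open_target u hu

/-- A locally bounded `(n,n)`-form on a compact manifold has a finite integral. -/
theorem lintegral_lt_top_of_locally_bounded [CompactSpace X] {η : Density n X} (hη : η.IsForm)
    (h : ∀ x : X, ∃ C : ℝ, ∀ᶠ u in 𝓝 (chartAt (Fin n → ℂ) x x),
      (η.coeff (chartAt (Fin n → ℂ) x) u).re ≤ C) : η.lintegral < ⊤ := by
  have h1 : ∀ x : X, ∃ C : ℝ, ∃ R > 0, Metric.ball (chartAt (Fin n → ℂ) x x) R ⊆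
      (chartAt (Fin n → ℂ) x).target ∧ ∀ u ∈ Metric.ball (chartAt (Fin n → ℂ) x x) R,
        (η.coeff (chartAt (Fin n → ℂ) x) u).re ≤ C := by
    intro x
    obtain ⟨C, hC⟩ := h x
    obtain ⟨R, hR, hR'⟩ := Metric.eventually_nhds_iff_ball.1
      (hC.and ((chartAt (Fin n → ℂ) x).open_target.mem_nhds (mem_chart_target _ x)))
    exact ⟨C, R, hR, fun u hu => (hR' u hu).2, fun u hu => (hR' u hu).1⟩
  choose C R hR hsub hC using h1
  let U : X → Set (Fin n → ℂ) := fun x => Metric.ball (chartAt (Fin n → ℂ) x x) (R x)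
  have hop : ∀ x, IsOpen ((chartAt (Fin n → ℂ) x).symm '' U x) := fun x =>
    (chartAt (Fin n → ℂ) x).isOpen_image_symm_of_subset_target Metric.isOpen_ball (hsub x)
  obtain ⟨t, ht⟩ := isCompact_univ.elim_finite_subcover
    (fun x => (chartAt (Fin n → ℂ) x).symm '' U x) hop fun x _ => Set.mem_iUnion.2
      ⟨x, _, Metric.mem_ball_self (hR x), (chartAt (Fin n → ℂ) x).left_inv (mem_chart_source _ x)⟩
  -- Numbering the finite subcover provides the well-order along which the sets are made disjoint.
  let c : Fin t.card → X := fun i => (t.equivFin.symm i : X)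
  obtain ⟨B, hB1, hB2, -, hB4, hB5⟩ := exists_disjoint_pieces
    (φ := fun i => (chartAt (Fin n → ℂ) (c i)).symm) (U := fun i => U (c i))
    (fun i => Metric.isOpen_ball)
    (fun i => (chartAt (Fin n → ℂ) (c i)).continuousOn_symm.mono (hsub _)) (fun i => hop _)
  have hcov : ⋃ i, (chartAt (Fin n → ℂ) (c i)).symm '' B i = Set.univ := by
    rw [hB5, Set.eq_univ_iff_forall]
    intro x
    obtain ⟨y, hy, hxy⟩ := Set.mem_iUnion₂.1 (ht (Set.mem_univ x))
    refine Set.mem_iUnion.2 ⟨t.equivFin ⟨y, hy⟩, ?_⟩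
    simpa [c] using hxy
  rw [lintegral_eq_tsum_param hη hB1
    (fun i u hu => holAt_chart_symm (chartAt_mem _) (hsub _ (hB2 i hu)))
    (fun i => (chartAt (Fin n → ℂ) (c i)).symm.injOn.mono ((hB2 i).trans (hsub _))) hB4 hcov,
    tsum_fintype]
  refine ENNReal.sum_lt_top.2 fun i _ => ?_
  calc _ ≤ ∫⁻ u in B i, ENNReal.ofReal (C (c i)) := by
        refine setLIntegral_mono' (hB1 i) fun u hu => ENNReal.ofReal_le_ofReal ?_
        rw [← hη.coeff_eq_param]
        exact hC _ u (hB2 i hu)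
    _ ≤ ENNReal.ofReal (C (c i)) * volume (U (c i)) := by
        rw [setLIntegral_const]
        gcongr
        exact hB2 i
    _ < ⊤ := ENNReal.mul_lt_top ENNReal.ofReal_lt_top measure_ball_lt_top

end Cover

/-! ### Local estimates for holomorphic forms -/

section Estimates

variable {n : ℕ} {X : Type*} [TopologicalSpace X] [SecondCountableTopology X]
  [ChartedSpace (Fin n → ℂ) X] [IsManifold 𝓘(ℂ, Fin n → ℂ) ω X]

theorem ofReal_norm_sq (z : ℂ) : ENNReal.ofReal (‖z‖ ^ 2) = ‖z‖ₑ ^ 2 := by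
  rw [ENNReal.ofReal_pow (norm_nonneg _), ofReal_norm]

theorem ofReal_wedgeConj_param_re (f : TopForm n X) (φ : (Fin n → ℂ) → X) (u : Fin n → ℂ) :
    ENNReal.ofReal ((wedgeConj f f).param φ u).re = ‖f.param φ u‖ₑ ^ 2 := by
  rw [wedgeConj_param, Complex.ofReal_re, ofReal_norm_sq]

theorem normSq_eq_tsum (f : TopForm n X) : normSq f = ∑' y : centers n X,
    ∫⁻ u in piece n (y : X), ‖f.coeff (chartAt (Fin n → ℂ) (y : X)) u‖ₑ ^ 2 := by
  simp only [normSq, Density.lintegral, (isForm_wedgeConj f).coeff_eq_param,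
    ofReal_wedgeConj_param_re, f.coeff_eq_param]

/-- A map which is a holomorphic parametrization of a subset of `X` on a ball. -/
structure IsParam (φ : (Fin n → ℂ) → X) (c : Fin n → ℂ) (R : ℝ) : Prop where
  pos : 0 < R
  hol : ∀ u ∈ Metric.ball c R, HolAt n φ u
  inj : Set.InjOn φ (Metric.ball c R)

theorem IsParam.differentiableOn {φ : (Fin n → ℂ) → X} {c : Fin n → ℂ} {R : ℝ}
    (h : IsParam φ c R) {f : TopForm n X} (hf : f ∈ holomorphicForms n X) :
    DifferentiableOn ℂ (f.param φ) (Metric.ball c R) := fun u hu =>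
  (differentiableAt_param hf (by
    filter_upwards [Metric.isOpen_ball.mem_nhds hu] with w hw using h.hol w hw)).differentiableWithinAt

/-- The constant in the pointwise bound of a square integrable holomorphic function on a ball of
radius `R / 2` by its norm on the ball of radius `R`. -/
def ballConst (n : ℕ) (R : ℝ) : ℝ :=
  ((volume (Metric.ball (0 : Fin n → ℂ) (R / 2))).toReal)⁻¹

theorem ballConst_pos {n : ℕ} {R : ℝ} (hR : 0 < R) : 0 < ballConst n R :=
  inv_pos.2 (ENNReal.toReal_pos (Metric.measure_ball_pos volume _ (by positivity)).ne'
    measure_ball_lt_top.ne)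

/-- The mean value inequality on the ball of radius R/2 about u, which is still inside the large
ball. Injectivity of φ bounds the integral there by the full norm. The constant sees only n and R,
not the manifold, hence the uniformity along the tower. -/
theorem IsParam.norm_sq_le {φ : (Fin n → ℂ) → X} {c : Fin n → ℂ} {R : ℝ}
    (h : IsParam φ c R) {f : TopForm n X} (hf : f ∈ bergmanSpace n X) {u : Fin n → ℂ}
    (hu : u ∈ Metric.ball c (R / 2)) :
    ‖f.param φ u‖ ^ 2 ≤ ballConst n R * (normSq f).toReal := by
  have hR := h.pos
  have hsub : Metric.ball u (R / 2) ⊆ Metric.ball c R :=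
    Metric.ball_subset_ball' (by rw [Metric.mem_ball] at hu; linarith)
  have h1 := volume_ball_mul_enorm_sq_le ((h.differentiableOn hf.1).mono hsub)
  have h2 : ∫⁻ w in Metric.ball u (R / 2), ‖f.param φ w‖ₑ ^ 2 ≤ normSq f := by
    simp only [← ofReal_wedgeConj_param_re]
    exact lintegral_param_le (isForm_wedgeConj f) Metric.isOpen_ball.measurableSet
      (fun w hw => h.hol w (hsub hw)) (h.inj.mono hsub)
  have h3 := ENNReal.toReal_mono hf.2.ne (h1.trans h2)
  rw [ENNReal.toReal_mul, ENNReal.toReal_pow, toReal_enorm] at h3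
  rw [ballConst, inv_mul_eq_div, le_div_iff₀' (inv_pos.1 (ballConst_pos (n := n) hR))]
  exact h3

theorem isParam_chart {e : OpenPartialHomeomorph X (Fin n → ℂ)}
    (he : e ∈ IsManifold.maximalAtlas 𝓘(ℂ, Fin n → ℂ) ω X) {c : Fin n → ℂ} {R : ℝ} (hR : 0 < R)
    (h : Metric.ball c R ⊆ e.target) : IsParam (X := X) e.symm c R where
  pos := hR
  hol _ hu := holAt_chart_symm he (h hu)
  inj := e.symm.injOn.mono h

/-- Provides the continuity of point evaluations on the Bergman space. -/
theorem exists_norm_toFun_le (x : X) :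
    ∃ C : ℝ, 0 ≤ C ∧ ∀ f ∈ bergmanSpace n X, ‖f.toFun x‖ ^ 2 ≤ C * (normSq f).toReal := by
  let e := chartAt (Fin n → ℂ) x
  have hx : e x ∈ e.target := mem_chart_target _ x
  obtain ⟨R, hR, hsub⟩ := exists_ball_subset_target hx
  have hp := isParam_chart (chartAt_mem x) hR hsub
  have hj := jac_chart_symm_ne_zero (chartAt_mem x) hx
  have hj' : 0 < ‖jac n e.symm (e x)‖ ^ 2 := by positivity
  refine ⟨ballConst n R / ‖jac n e.symm (e x)‖ ^ 2,
    div_nonneg (ballConst_pos hR).le hj'.le, fun f hf => ?_⟩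
  have h1 := hp.norm_sq_le hf (Metric.mem_ball_self (by positivity))
  rw [TopForm.param, e.left_inv (mem_chart_source _ x), norm_mul, mul_pow] at h1
  rw [div_mul_eq_mul_div, le_div_iff₀ hj']
  linarith

/-- A pointwise limit of locally bounded holomorphic forms is holomorphic. -/
theorem mem_holomorphicForms_of_tendsto {ι : Type*} {l : Filter ι} [l.NeBot]
    {F : ι → TopForm n X} {f : TopForm n X} (hF : ∀ i, F i ∈ holomorphicForms n X)
    (hlim : ∀ x, Tendsto (fun i => (F i).toFun x) l (𝓝 (f.toFun x)))
    (hbd : ∀ e ∈ IsManifold.maximalAtlas 𝓘(ℂ, Fin n → ℂ) ω X, ∀ u ∈ e.target, ∃ C : ℝ,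
      ∃ R > 0, Metric.ball u R ⊆ e.target ∧
        ∀ᶠ i in l, ∀ w ∈ Metric.ball u R, ‖(F i).coeff e w‖ ≤ C) :
    f ∈ holomorphicForms n X := by
  intro e he u hu
  obtain ⟨C, R, hR, hsub, hC⟩ := hbd e he u hu
  refine (differentiableAt_of_tendsto (f := fun i => (F i).coeff e) hR
    (Eventually.of_forall fun i => (hF i e he).mono hsub) hC
    fun w hw => ?_).differentiableWithinAt
  simp only [TopForm.coeff_eq_param, TopForm.param]
  exact (hlim _).const_mul _

end Estimates

/-! ### The Bergman space as a Hilbert space -/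

/-- Integrals over a disjoint union of charts split into integrals over the summands, so the Bergman
norm becomes an honest L² norm on a single measure space. -/
theorem measurableEmbedding_sigmaMk {ι : Type*} {β : ι → Type*} [∀ i, MeasurableSpace (β i)] (i : ι) :
    MeasurableEmbedding (Sigma.mk i : β i → Sigma β) where
  injective := sigma_mk_injective
  measurable := by
    intro s hs
    exact MeasurableSpace.measurableSet_iInf.1 hs i
  measurableSet_image' := by
    intro s hs
    refine MeasurableSpace.measurableSet_iInf.2 fun j => ?_
    change MeasurableSet (Sigma.mk j ⁻¹' (Sigma.mk i '' s))
    by_cases h : i = j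
    · subst h
      rwa [Set.preimage_image_eq _ sigma_mk_injective]
    · rw [Set.preimage_image_sigmaMk_of_ne (Ne.symm h)]
      exact MeasurableSet.empty

section Hilbert

variable {n : ℕ} {X : Type*} [TopologicalSpace X] [SecondCountableTopology X]
  [ChartedSpace (Fin n → ℂ) X] [IsManifold 𝓘(ℂ, Fin n → ℂ) ω X]

variable (n X) in
/-- The disjoint union of the charts used for integration. -/
abbrev ChartSum : Type _ := Σ _ : centers n X, (Fin n → ℂ)

variable (n X) in
/-- The Lebesgue measure on the disjoint union of the pieces used for integration. -/
def chartMeasure : Measure (ChartSum n X) :=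
  Measure.sum fun y : centers n X => (volume.restrict (piece n (y : X))).map (Sigma.mk y)

/-- The coefficients of a form in the charts used for integration. -/
def TopForm.coeffs (f : TopForm n X) (z : ChartSum n X) : ℂ :=
  f.coeff (chartAt (Fin n → ℂ) (z.1 : X)) z.2

theorem lintegral_chartMeasure (g : ChartSum n X → ENNReal) :
    ∫⁻ z, g z ∂(chartMeasure n X) = ∑' y : centers n X, ∫⁻ u in piece n (y : X), g ⟨y, u⟩ := by
  rw [chartMeasure, lintegral_sum_measure]
  exact tsum_congr fun y => (measurableEmbedding_sigmaMk y).lintegral_map _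

theorem normSq_eq_lintegral (f : TopForm n X) :
    normSq f = ∫⁻ z, ‖f.coeffs z‖ₑ ^ 2 ∂(chartMeasure n X) := by
  rw [normSq_eq_tsum, lintegral_chartMeasure]
  rfl

theorem aestronglyMeasurable_coeffs {f : TopForm n X} (hf : f ∈ holomorphicForms n X) :
    AEStronglyMeasurable f.coeffs (chartMeasure n X) := by
  refine aestronglyMeasurable_sum_measure_iff.2 fun y =>
    (measurableEmbedding_sigmaMk y).aestronglyMeasurable_map_iff.2 ?_
  exact (((hf _ (chartAt_mem (y : X))).continuousOn).mono (piece_subset _)).aestronglyMeasurable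
    (measurableSet_piece _)

theorem eLpNorm_coeffs (f : TopForm n X) :
    eLpNorm f.coeffs 2 (chartMeasure n X) = normSq f ^ (1 / 2 : ℝ) := by
  rw [eLpNorm_eq_lintegral_rpow_enorm_toReal two_ne_zero ENNReal.ofNat_ne_top, normSq_eq_lintegral]
  simp

theorem memLp_coeffs_iff {f : TopForm n X} (hf : f ∈ holomorphicForms n X) :
    MemLp f.coeffs 2 (chartMeasure n X) ↔ f ∈ bergmanSpace n X := by
  rw [MemLp, eLpNorm_coeffs, ENNReal.rpow_lt_top_iff_of_pos (by norm_num)]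
  exact ⟨fun h => ⟨hf, h.2⟩, fun h => ⟨aestronglyMeasurable_coeffs hf, h.2⟩⟩

theorem coeffs_add (f g : TopForm n X) : (f + g).coeffs = f.coeffs + g.coeffs := rfl

theorem coeffs_smul (c : ℂ) (f : TopForm n X) : (c • f).coeffs = c • f.coeffs := rfl

variable (n X) in
/-- The square integrable holomorphic forms. -/
def bergmanSubmodule : Submodule ℂ (TopForm n X) where
  carrier := bergmanSpace n X
  add_mem' := fun {f g} hf hg => by
    have h := ((memLp_coeffs_iff hf.1).2 hf).add ((memLp_coeffs_iff hg.1).2 hg)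
    rw [← coeffs_add] at h
    exact (memLp_coeffs_iff (Submodule.add_mem _ hf.1 hg.1)).1 h
  zero_mem' := by
    refine (memLp_coeffs_iff (Submodule.zero_mem _)).1 ?_
    exact MemLp.zero
  smul_mem' := fun c f hf => by
    have h := ((memLp_coeffs_iff hf.1).2 hf).const_smul c
    rw [← coeffs_smul] at h
    exact (memLp_coeffs_iff (Submodule.smul_mem _ _ hf.1)).1 h

theorem memLp_coeffs (f : bergmanSubmodule n X) :
    MemLp (f : TopForm n X).coeffs 2 (chartMeasure n X) :=
  (memLp_coeffs_iff f.2.1).2 f.2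

variable (n X) in
/-- The embedding of the Bergman space into an `L²` space. -/
def toL2 : bergmanSubmodule n X →ₗ[ℂ] Lp ℂ 2 (chartMeasure n X) where
  toFun f := (memLp_coeffs f).toLp
  map_add' _ _ := rfl
  map_smul' _ _ := rfl

theorem norm_toL2_sq (f : bergmanSubmodule n X) :
    ‖toL2 n X f‖ ^ 2 = (normSq (f : TopForm n X)).toReal := by
  change ‖(memLp_coeffs f).toLp‖ ^ 2 = _
  rw [Lp.norm_toLp, eLpNorm_coeffs, ← ENNReal.toReal_pow, ← ENNReal.rpow_natCast,
    ← ENNReal.rpow_mul]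
  simp

theorem toL2_injective : Function.Injective (toL2 n X) := by
  have key : ∀ f, toL2 n X f = 0 → f = 0 := by
    intro f hf
    have h := norm_toL2_sq f
    rw [hf, norm_zero] at h
    have h1 : normSq (f : TopForm n X) = 0 := by
      rcases (ENNReal.toReal_eq_zero_iff _).1 ((zero_pow two_ne_zero).symm.trans h).symm with h2 | h2
      · exact h2
      · exact (f.2.2.ne h2).elim
    exact Subtype.ext (eq_zero_of_normSq_eq_zero f.2.1 h1)
  intro f g hfg
  refine sub_eq_zero.1 (key _ ?_)
  rw [map_sub, hfg, sub_self]

variable (n X) in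
/-- The Bergman space as a subspace of an `L²` space. -/
abbrev BergmanHilbert : Submodule ℂ (Lp ℂ 2 (chartMeasure n X)) := LinearMap.range (toL2 n X)

variable (n X) in
/-- The Bergman space is isomorphic to its image in the `L²` space. -/
def bergmanEquiv : bergmanSubmodule n X ≃ₗ[ℂ] BergmanHilbert n X :=
  LinearEquiv.ofInjective (toL2 n X) toL2_injective

theorem norm_bergmanEquiv_sq (f : bergmanSubmodule n X) :
    ‖bergmanEquiv n X f‖ ^ 2 = (normSq (f : TopForm n X)).toReal := norm_toL2_sq f

theorem coeFn_toL2 (f : bergmanSubmodule n X) :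
    toL2 n X f =ᵐ[chartMeasure n X] (f : TopForm n X).coeffs :=
  MemLp.coeFn_toLp (memLp_coeffs f)

/-- The arguments are swapped because `inner` is conjugate-linear in its first variable while
`l2Inner` is so in its second. -/
theorem inner_bergmanEquiv (f g : bergmanSubmodule n X) :
    inner ℂ (bergmanEquiv n X f) (bergmanEquiv n X g) =
      l2Inner (g : TopForm n X) (f : TopForm n X) := by
  change inner ℂ (toL2 n X f) (toL2 n X g) = _
  have hae : (fun z => inner ℂ (toL2 n X f z) (toL2 n X g z)) =ᵐ[chartMeasure n X]
      fun z => inner ℂ ((f : TopForm n X).coeffs z) ((g : TopForm n X).coeffs z) := by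
    filter_upwards [coeFn_toL2 f, coeFn_toL2 g] with z h1 h2
    rw [h1, h2]
  have hint := (L2.integrable_inner (𝕜 := ℂ) (toL2 n X f) (toL2 n X g)).congr hae
  rw [L2.inner_def, integral_congr_ae hae]
  rw [chartMeasure] at hint ⊢
  rw [integral_sum_measure hint]
  refine tsum_congr fun y => ?_
  rw [(measurableEmbedding_sigmaMk y).integral_map]
  rfl

/-- The evaluation of the elements of the Bergman space at a point, as linear functional. -/
def evalLM (x : X) : BergmanHilbert n X →ₗ[ℂ] ℂ where
  toFun w := ((bergmanEquiv n X).symm w : TopForm n X).toFun x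
  map_add' v w := by rw [map_add]; rfl
  map_smul' c w := by rw [map_smul]; rfl

/-- The evaluation of the elements of the Bergman space at a point. -/
def evalCLM (x : X) : BergmanHilbert n X →L[ℂ] ℂ :=
  (evalLM x).mkContinuous (Real.sqrt (exists_norm_toFun_le (n := n) x).choose) fun w => by
    obtain ⟨h0, h⟩ := (exists_norm_toFun_le (n := n) x).choose_spec
    obtain ⟨f, rfl⟩ := (bergmanEquiv n X).surjective w
    rw [← pow_le_pow_iff_left₀ (norm_nonneg _) (by positivity) two_ne_zero, mul_pow,
      Real.sq_sqrt h0, norm_bergmanEquiv_sq]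
    have h1 : evalLM x (bergmanEquiv n X f) = (f : TopForm n X).toFun x := by
      change ((bergmanEquiv n X).symm (bergmanEquiv n X f) : TopForm n X).toFun x = _
      rw [LinearEquiv.symm_apply_apply]
    rw [h1]
    exact h _ f.2

theorem evalCLM_bergmanEquiv (x : X) (f : bergmanSubmodule n X) :
    evalCLM x (bergmanEquiv n X f) = (f : TopForm n X).toFun x := by
  change ((bergmanEquiv n X).symm (bergmanEquiv n X f) : TopForm n X).toFun x = _
  rw [LinearEquiv.symm_apply_apply]

/-- Evaluations are continuous, so an L²-convergent sequence of forms converges at every point.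
Bounded norms give local bounds, hence the pointwise limit is holomorphic; it represents the L²
limit. -/
theorem isClosed_bergmanHilbert : IsClosed (BergmanHilbert n X : Set (Lp ℂ 2 (chartMeasure n X))) := by
  refine IsSeqClosed.isClosed fun w g hw hg => ?_
  choose F hF using hw
  have hcauchy : CauchySeq fun k => bergmanEquiv n X (F k) := by
    have h1 : CauchySeq fun k => toL2 n X (F k) := by
      simp only [hF]
      exact hg.cauchySeq
    refine Metric.cauchySeq_iff.2 fun ε hε => ?_
    obtain ⟨N, hN⟩ := Metric.cauchySeq_iff.1 h1 ε hε
    exact ⟨N, hN⟩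
  obtain ⟨M, hM⟩ : ∃ M : ℝ, ∀ k, (normSq (F k : TopForm n X)).toReal ≤ M := by
    obtain ⟨M, hM⟩ := hcauchy.norm_bddAbove
    refine ⟨M ^ 2, fun k => ?_⟩
    rw [← norm_bergmanEquiv_sq]
    exact pow_le_pow_left₀ (norm_nonneg _) (hM (Set.mem_range_self k)) 2
  have hlim : ∀ x : X, ∃ s : ℂ, Tendsto (fun k => (F k : TopForm n X).toFun x) atTop (𝓝 s) := by
    intro x
    have h1 := hcauchy.map (evalCLM (n := n) x).uniformContinuous
    obtain ⟨s, hs⟩ := cauchySeq_tendsto_of_complete h1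
    refine ⟨s, hs.congr fun k => ?_⟩
    exact evalCLM_bergmanEquiv x (F k)
  choose s hs using hlim
  let f : TopForm n X := TopForm.ofFun s
  have hs : ∀ x, Tendsto (fun k => (F k : TopForm n X).toFun x) atTop (𝓝 (f.toFun x)) := by
    intro x
    rw [TopForm.toFun_ofFun]
    exact hs x
  have hf : f ∈ holomorphicForms n X := by
    refine mem_holomorphicForms_of_tendsto (fun k => (F k).2.1) hs fun e he u hu => ?_
    obtain ⟨R, hR, hsub⟩ := exists_ball_subset_target hu
    have hp := isParam_chart he hR hsub
    refine ⟨Real.sqrt (ballConst n R * M), R / 2, by positivity,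
      (Metric.ball_subset_ball (by linarith)).trans hsub, Eventually.of_forall fun k w hw => ?_⟩
    rw [TopForm.coeff_eq_param]
    refine Real.le_sqrt_of_sq_le ((hp.norm_sq_le (F k).2 hw).trans ?_)
    exact mul_le_mul_of_nonneg_left (hM k) (ballConst_pos hR).le
  -- Convergence in L² gives almost everywhere convergence only along a subsequence, which is enough
  -- to identify g with the pointwise limit.
  obtain ⟨ns, hmono, hns⟩ := (tendstoInMeasure_of_tendsto_Lp hg).exists_seq_tendsto_ae
  have hae : f.coeffs =ᵐ[chartMeasure n X] g := by
    have h1 : ∀ᵐ z ∂(chartMeasure n X), ∀ k, w k z = (F k : TopForm n X).coeffs z := by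
      refine ae_all_iff.2 fun k => ?_
      rw [← hF k]
      exact coeFn_toL2 (F k)
    filter_upwards [hns, h1] with z h2 h3
    simp only [h3] at h2
    refine tendsto_nhds_unique ?_ h2
    simp only [TopForm.coeffs, TopForm.coeff_eq_param, TopForm.param]
    exact ((hs _).comp hmono.tendsto_atTop).const_mul _
  have hfm : MemLp f.coeffs 2 (chartMeasure n X) := (memLp_congr_ae hae).2 (Lp.memLp g)
  refine ⟨⟨f, (memLp_coeffs_iff hf).1 hfm⟩, ?_⟩
  refine Lp.ext ?_
  exact (MemLp.coeFn_toLp hfm).trans hae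

instance completeSpace_bergmanHilbert : CompleteSpace (BergmanHilbert n X) :=
  isClosed_bergmanHilbert.completeSpace_coe

/-! ### Hilbert bases, the reproducing vector and extremal forms -/

theorem isBergmanBasis_bergmanBasis : IsBergmanBasis (bergmanBasis n X) :=
  (exists_isBergmanBasis n X).choose_spec

/-- The elements of the chosen orthonormal basis, in the Hilbert space. -/
def basisVector (b : bergmanBasis n X) : BergmanHilbert n X :=
  bergmanEquiv n X ⟨b, isBergmanBasis_bergmanBasis.subset b.2⟩

theorem orthonormal_basisVector : Orthonormal ℂ (basisVector (n := n) (X := X)) := by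
  classical
  rw [orthonormal_iff_ite]
  intro b c
  rw [basisVector, basisVector, inner_bergmanEquiv]
  split_ifs with h
  · subst h
    exact isBergmanBasis_bergmanBasis.norm_one _ b.2
  · exact isBergmanBasis_bergmanBasis.orthogonal c.2 b.2 fun h' => h (Subtype.ext h'.symm)

variable (n X) in
/-- The Hilbert basis given by the chosen orthonormal basis of the Bergman space. -/
def bergmanHilbertBasis : HilbertBasis (bergmanBasis n X) ℂ (BergmanHilbert n X) :=
  HilbertBasis.mkOfOrthogonalEqBot orthonormal_basisVector (by
    rw [Submodule.eq_bot_iff]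
    intro w hw
    obtain ⟨f, rfl⟩ := (bergmanEquiv n X).surjective w
    have h : (f : TopForm n X) = 0 := by
      refine isBergmanBasis_bergmanBasis.complete _ f.2 fun g hg => ?_
      have h1 := (Submodule.mem_orthogonal _ _).1 hw (basisVector ⟨g, hg⟩)
        (Submodule.subset_span (Set.mem_range_self _))
      rwa [basisVector, inner_bergmanEquiv] at h1
    rw [show f = 0 from Subtype.ext h, map_zero])

theorem bergmanHilbertBasis_apply (b : bergmanBasis n X) :
    bergmanHilbertBasis n X b = basisVector b := by
  rw [bergmanHilbertBasis, HilbertBasis.coe_mkOfOrthogonalEqBot]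

/-- The representing vector of the evaluation at a point. -/
def kernelVector (n : ℕ) {X : Type*} [TopologicalSpace X] [SecondCountableTopology X]
    [ChartedSpace (Fin n → ℂ) X] [IsManifold 𝓘(ℂ, Fin n → ℂ) ω X] (x : X) : BergmanHilbert n X :=
  (InnerProductSpace.toDual ℂ (BergmanHilbert n X)).symm (evalCLM x)

theorem inner_kernelVector (x : X) (f : bergmanSubmodule n X) :
    inner ℂ (kernelVector n x) (bergmanEquiv n X f) = (f : TopForm n X).toFun x := by
  rw [kernelVector, InnerProductSpace.toDual_symm_apply, evalCLM_bergmanEquiv]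

/-- The Bergman kernel on the diagonal, evaluated on the standard basis of the tangent space. -/
def diagKernel (n : ℕ) {X : Type*} [TopologicalSpace X] [SecondCountableTopology X]
    [ChartedSpace (Fin n → ℂ) X] [IsManifold 𝓘(ℂ, Fin n → ℂ) ω X] (x : X) : ℝ :=
  ‖kernelVector n x‖ ^ 2

theorem diagKernel_nonneg (x : X) : 0 ≤ diagKernel n x := by
  rw [diagKernel]; positivity

/-- Parseval's identity for the vector representing evaluation at x. It also shows that the sum over
the basis does not depend on the basis. -/
theorem hasSum_diagKernel (x : X) :
    HasSum (fun b : bergmanBasis n X => ‖(b : TopForm n X).toFun x‖ ^ 2) (diagKernel n x) := by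
  have h := (bergmanHilbertBasis n X).hasSum_inner_mul_inner (kernelVector n x) (kernelVector n x)
  rw [inner_self_eq_norm_sq_to_K] at h
  have h1 : ∀ b : bergmanBasis n X, inner ℂ (kernelVector n x) (bergmanHilbertBasis n X b) *
      inner ℂ (bergmanHilbertBasis n X b) (kernelVector n x) =
      ((‖(b : TopForm n X).toFun x‖ ^ 2 : ℝ) : ℂ) := by
    intro b
    rw [← inner_conj_symm (bergmanHilbertBasis n X b), bergmanHilbertBasis_apply, basisVector,
      inner_kernelVector, Complex.mul_conj, Complex.normSq_eq_norm_sq]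
  simp only [h1] at h
  have h2 := Complex.hasSum_re h
  simp only [Complex.ofReal_re] at h2
  convert h2 using 1
  rw [diagKernel]
  norm_cast

/-- Cauchy–Schwarz against the reproducing vector. -/
theorem norm_toFun_sq_le {f : TopForm n X} (hf : f ∈ bergmanSpace n X) (x : X) :
    ‖f.toFun x‖ ^ 2 ≤ diagKernel n x * (normSq f).toReal := by
  let F : bergmanSubmodule n X := ⟨f, hf⟩
  have h := norm_inner_le_norm (𝕜 := ℂ) (kernelVector n x) (bergmanEquiv n X F)
  rw [inner_kernelVector] at h
  rw [diagKernel, ← norm_bergmanEquiv_sq F, ← mul_pow]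
  exact pow_le_pow_left₀ (norm_nonneg _) h 2

/-- Equality in Cauchy–Schwarz is attained by the normalized reproducing vector. If that vector
vanishes, the kernel is zero at x and the zero form serves. -/
theorem exists_extremal (x : X) : ∃ f ∈ bergmanSpace n X, normSq f ≤ 1 ∧
    ‖f.toFun x‖ ^ 2 = diagKernel n x := by
  by_cases hk : kernelVector n x = 0
  · refine ⟨0, (0 : bergmanSubmodule n X).2, ?_, ?_⟩
    · have h := norm_bergmanEquiv_sq (0 : bergmanSubmodule n X)
      rw [map_zero, norm_zero, zero_pow two_ne_zero] at h
      have h0 := (0 : bergmanSubmodule n X).2.2.ne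
      refine (ENNReal.ofReal_toReal h0).symm.trans_le ?_
      rw [← h, ENNReal.ofReal_zero]
      exact zero_le_one
    · rw [diagKernel, hk]
      change ‖(0 : ℂ)‖ ^ 2 = _
      simp
  · let c : ℂ := ((‖kernelVector n x‖⁻¹ : ℝ) : ℂ)
    let w : BergmanHilbert n X := c • kernelVector n x
    obtain ⟨F, hF⟩ := (bergmanEquiv n X).surjective w
    have hw : ‖w‖ = 1 := by
      simp only [w, c]
      rw [norm_smul, Complex.norm_real, norm_inv, norm_norm, inv_mul_cancel₀ (norm_ne_zero_iff.2 hk)]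
    refine ⟨F, F.2, ?_, ?_⟩
    · have h := norm_bergmanEquiv_sq F
      rw [hF, hw, one_pow] at h
      rw [← ENNReal.ofReal_toReal F.2.2.ne, ← h, ENNReal.ofReal_one]
    · have h := inner_smul_right (𝕜 := ℂ) (kernelVector n x) (kernelVector n x) c
      rw [← inner_kernelVector, hF, h, inner_self_eq_norm_sq_to_K, diagKernel, norm_mul]
      simp only [c, norm_inv, norm_pow, Complex.coe_algebraMap, Complex.norm_real, norm_norm]
      have := norm_ne_zero_iff.2 hk
      field_simp

end Hilbert

/-! ### The Bergman kernel on the diagonal -/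

section Kernel

variable {n : ℕ} {X : Type*} [TopologicalSpace X] [SecondCountableTopology X]
  [ChartedSpace (Fin n → ℂ) X] [IsManifold 𝓘(ℂ, Fin n → ℂ) ω X]

theorem frameDet_stdFrame (x : X) : frameDet (stdFrame (n := n) x) = 1 := by
  have h := frameDet_map (x := x) (ContinuousLinearMap.id ℂ (Fin n → ℂ))
  simp only [ContinuousLinearMap.coe_id', id_eq] at h
  refine Eq.trans h ?_
  simp [ContinuousLinearMap.det]

theorem bergmanForm_apply (x : X) (v : Fin n → TangentSpace 𝓘(ℂ, Fin n → ℂ) x) :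
    bergmanForm n X x v = ((‖frameDet v‖ ^ 2 * diagKernel n x : ℝ) : ℂ) := by
  rw [bergmanForm, bergmanKernel, ← (hasSum_diagKernel x).tsum_eq, ← tsum_mul_left,
    Complex.ofReal_tsum]
  refine tsum_congr fun b => ?_
  rw [Complex.mul_conj, Complex.normSq_eq_norm_sq, TopForm.apply_eq, norm_mul, mul_pow]

theorem bergmanForm_toFun (x : X) : (bergmanForm n X).toFun x = (diagKernel n x : ℂ) := by
  rw [Density.toFun, bergmanForm_apply, frameDet_stdFrame]
  simp

theorem isForm_bergmanForm : (bergmanForm n X).IsForm := by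
  intro x v
  rw [bergmanForm_toFun, bergmanForm_apply, Complex.ofReal_mul]

/-- The coefficient of the Bergman kernel in a holomorphic parametrization. -/
def kernelParam (φ : (Fin n → ℂ) → X) (u : Fin n → ℂ) : ℝ :=
  ‖jac n φ u‖ ^ 2 * diagKernel n (φ u)

theorem bergmanForm_param (φ : (Fin n → ℂ) → X) (u : Fin n → ℂ) :
    (bergmanForm n X).param φ u = (kernelParam φ u : ℂ) := by
  rw [Density.param, bergmanForm_toFun, kernelParam, Complex.ofReal_mul]

theorem kernelParam_nonneg (φ : (Fin n → ℂ) → X) (u : Fin n → ℂ) : 0 ≤ kernelParam φ u :=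
  mul_nonneg (by positivity) (diagKernel_nonneg _)

theorem norm_param_sq_le {f : TopForm n X} (hf : f ∈ bergmanSpace n X) (φ : (Fin n → ℂ) → X)
    (u : Fin n → ℂ) : ‖f.param φ u‖ ^ 2 ≤ kernelParam φ u * (normSq f).toReal := by
  rw [TopForm.param, norm_mul, mul_pow, kernelParam, mul_assoc]
  exact mul_le_mul_of_nonneg_left (norm_toFun_sq_le hf _) (by positivity)

theorem toReal_le_one {a : ENNReal} (h : a ≤ 1) : a.toReal ≤ 1 := by
  simpa using ENNReal.toReal_mono ENNReal.one_ne_top h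

theorem exists_extremal_param (φ : (Fin n → ℂ) → X) (u : Fin n → ℂ) :
    ∃ f ∈ bergmanSpace n X, normSq f ≤ 1 ∧ ‖f.param φ u‖ ^ 2 = kernelParam φ u := by
  obtain ⟨f, hf, h1, h2⟩ := exists_extremal (n := n) (φ u)
  exact ⟨f, hf, h1, by
    rw [TopForm.param, norm_mul, mul_pow, h2, kernelParam]⟩

theorem hasSum_kernelParam (φ : (Fin n → ℂ) → X) (u : Fin n → ℂ) :
    HasSum (fun b : bergmanBasis n X => ‖(b : TopForm n X).param φ u‖ ^ 2) (kernelParam φ u) := by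
  refine ((hasSum_diagKernel (n := n) (φ u)).mul_left (‖jac n φ u‖ ^ 2)).congr_fun fun b => ?_
  rw [TopForm.param, norm_mul, mul_pow]

theorem IsParam.norm_le {φ : (Fin n → ℂ) → X} {c : Fin n → ℂ} {R : ℝ} (h : IsParam φ c R)
    {f : TopForm n X} (hf : f ∈ bergmanSpace n X) (h1 : normSq f ≤ 1) {u : Fin n → ℂ}
    (hu : u ∈ Metric.ball c (R / 2)) : ‖f.param φ u‖ ≤ Real.sqrt (ballConst n R) := by
  refine Real.le_sqrt_of_sq_le ((h.norm_sq_le hf hu).trans ?_)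
  exact mul_le_of_le_one_right (ballConst_pos h.pos).le (toReal_le_one h1)

theorem IsParam.kernelParam_le {φ : (Fin n → ℂ) → X} {c : Fin n → ℂ} {R : ℝ} (h : IsParam φ c R)
    {u : Fin n → ℂ} (hu : u ∈ Metric.ball c (R / 2)) : kernelParam φ u ≤ ballConst n R := by
  obtain ⟨f, hf, h1, h2⟩ := exists_extremal_param φ u
  rw [← h2]
  exact (h.norm_sq_le hf hu).trans
    (mul_le_of_le_one_right (ballConst_pos h.pos).le (toReal_le_one h1))

/-- A Lipschitz constant of the Bergman kernel in a parametrization by a ball of radius `R`. -/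
def lipConst (n : ℕ) (R : ℝ) : ℝ := 16 * ballConst n R / R

theorem lipConst_nonneg {n : ℕ} {R : ℝ} (hR : 0 < R) : 0 ≤ lipConst n R := by
  have := ballConst_pos (n := n) hR
  rw [lipConst]
  positivity

/-- For the form extremal at u, |f(u)| equals the root of the kernel at u, while |f(w)| is at most
the root at w. The difference is thus controlled by the Lipschitz constant of a single bounded
holomorphic function. -/
theorem IsParam.sqrt_kernelParam_sub_le {φ : (Fin n → ℂ) → X} {c : Fin n → ℂ} {R : ℝ}
    (h : IsParam φ c R) {u w : Fin n → ℂ} (hu : u ∈ Metric.ball c (R / 8))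
    (hw : w ∈ Metric.ball c (R / 8)) : Real.sqrt (kernelParam φ u) - Real.sqrt (kernelParam φ w) ≤
      8 * Real.sqrt (ballConst n R) / R * ‖u - w‖ := by
  have hR := h.pos
  obtain ⟨f, hf, h1, h2⟩ := exists_extremal_param φ u
  have h3 : ‖f.param φ w‖ ≤ Real.sqrt (kernelParam φ w) :=
    Real.le_sqrt_of_sq_le ((norm_param_sq_le hf φ w).trans
      (mul_le_of_le_one_right (kernelParam_nonneg _ _) (toReal_le_one h1)))
  -- Halving the radius costs the pointwise bound on f; taking a quarter of that costs its Lipschitz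
  -- bound. This is the origin of the radius R/8 used throughout.
  have h5 : R / 2 / 4 = R / 8 := by ring
  have h4 := norm_sub_le_of_bounded_ball
    ((h.differentiableOn hf.1).mono (Metric.ball_subset_ball (by linarith : R / 2 ≤ R)))
    (fun u hu => h.norm_le hf h1 hu) (u := u) (w := w)
    (by rwa [h5]) (by rwa [h5])
  rw [← h2, Real.sqrt_sq (norm_nonneg _)]
  have h6 : 4 * Real.sqrt (ballConst n R) / (R / 2) = 8 * Real.sqrt (ballConst n R) / R := by
    field_simp
    ring
  rw [h6] at h4
  linarith [norm_sub_norm_le (f.param φ u) (f.param φ w)]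

/-- In a parametrization, the Bergman kernel is Lipschitz, with a constant which depends only on
the size of the parametrized ball. -/
theorem IsParam.abs_kernelParam_sub_le {φ : (Fin n → ℂ) → X} {c : Fin n → ℂ} {R : ℝ}
    (h : IsParam φ c R) {u w : Fin n → ℂ} (hu : u ∈ Metric.ball c (R / 8))
    (hw : w ∈ Metric.ball c (R / 8)) :
    |kernelParam φ u - kernelParam φ w| ≤ lipConst n R * ‖u - w‖ := by
  have hR := h.pos
  have hsub : Metric.ball c (R / 8) ⊆ Metric.ball c (R / 2) :=
    Metric.ball_subset_ball (by linarith)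
  have hC := ballConst_pos (n := n) hR
  set C := Real.sqrt (ballConst n R)
  have hCC : C * C = ballConst n R := Real.mul_self_sqrt hC.le
  set a := Real.sqrt (kernelParam φ u)
  set b := Real.sqrt (kernelParam φ w)
  have ha : a * a = kernelParam φ u := Real.mul_self_sqrt (kernelParam_nonneg _ _)
  have hb : b * b = kernelParam φ w := Real.mul_self_sqrt (kernelParam_nonneg _ _)
  have haC : a ≤ C := Real.sqrt_le_sqrt (h.kernelParam_le (hsub hu))
  have hbC : b ≤ C := Real.sqrt_le_sqrt (h.kernelParam_le (hsub hw))
  have h1 : |a - b| ≤ 8 * C / R * ‖u - w‖ := by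
    rw [abs_sub_le_iff]
    refine ⟨h.sqrt_kernelParam_sub_le hu hw, ?_⟩
    rw [norm_sub_rev]
    exact h.sqrt_kernelParam_sub_le hw hu
  have h2 : |a + b| ≤ 2 * C := by
    rw [abs_of_nonneg (by positivity)]
    linarith
  -- The factor 16 in `lipConst` is 8 from the Lipschitz bound of the root times 2 from the bound on
  -- the sum of the two roots.
  calc |kernelParam φ u - kernelParam φ w| = |a - b| * |a + b| := by
        rw [← ha, ← hb, ← abs_mul]; ring_nf
    _ ≤ (8 * C / R * ‖u - w‖) * (2 * C) := mul_le_mul h1 h2 (abs_nonneg _) (by positivity)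
    _ = 16 * (C * C) / R * ‖u - w‖ := by ring
    _ = _ := by rw [hCC, lipConst]

/-! ### The integral of the kernel counts the basis -/

theorem normSq_basis (b : bergmanBasis n X) : normSq (b : TopForm n X) = 1 := by
  have hb := isBergmanBasis_bergmanBasis.subset b.2
  have h := isBergmanBasis_bergmanBasis.norm_one _ b.2
  rw [l2Inner_self hb] at h
  rw [← ENNReal.ofReal_toReal hb.2.ne, Complex.ofReal_eq_one.1 h, ENNReal.ofReal_one]

theorem lintegral_bergmanForm : (bergmanForm n X).lintegral =
    ∫⁻ z, ∑' b : bergmanBasis n X, ‖(b : TopForm n X).coeffs z‖ₑ ^ 2 ∂(chartMeasure n X) := by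
  rw [lintegral_chartMeasure]
  refine tsum_congr fun y => lintegral_congr fun u => ?_
  have h := hasSum_kernelParam (n := n) (chartAt (Fin n → ℂ) (y : X)).symm u
  rw [isForm_bergmanForm.coeff_eq_param, bergmanForm_param, Complex.ofReal_re, ← h.tsum_eq,
    ENNReal.ofReal_tsum_of_nonneg (fun _ => by positivity) h.summable]
  refine tsum_congr fun b => ?_
  rw [ofReal_norm_sq, TopForm.coeffs, TopForm.coeff_eq_param]

theorem card_eq_lintegral_sum (T : Finset (bergmanBasis n X)) : (T.card : ENNReal) =
    ∫⁻ z, ∑ b ∈ T, ‖(b : TopForm n X).coeffs z‖ₑ ^ 2 ∂(chartMeasure n X) := by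
  rw [lintegral_finsetSum' _ fun b _ => ((aestronglyMeasurable_coeffs
    (isBergmanBasis_bergmanBasis.subset b.2).1).enorm.pow_const 2)]
  simp [← normSq_eq_lintegral, normSq_basis]

/-- Restricting to finite subsets avoids exchanging the integral with a sum over an index set not
yet known to be countable. A finite integral then forces the basis to be finite. -/
theorem card_le_lintegral_bergmanForm (T : Finset (bergmanBasis n X)) :
    (T.card : ENNReal) ≤ (bergmanForm n X).lintegral := by
  rw [lintegral_bergmanForm, card_eq_lintegral_sum]
  exact lintegral_mono fun z => ENNReal.sum_le_tsum T

theorem mem_bergmanSpace_of_compact [CompactSpace X] {f : TopForm n X}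
    (hf : f ∈ holomorphicForms n X) : f ∈ bergmanSpace n X := by
  refine ⟨hf, lintegral_lt_top_of_locally_bounded (isForm_wedgeConj f) fun x => ?_⟩
  have h1 : ContinuousAt (f.coeff (chartAt (Fin n → ℂ) x)) (chartAt (Fin n → ℂ) x x) :=
    (hf _ (chartAt_mem x)).continuousOn.continuousAt
      ((chartAt (Fin n → ℂ) x).open_target.mem_nhds (mem_chart_target _ x))
  refine ⟨‖f.coeff (chartAt (Fin n → ℂ) x) (chartAt (Fin n → ℂ) x x)‖ ^ 2 + 1, ?_⟩
  filter_upwards [(h1.norm.pow 2).eventually_lt continuousAt_const (lt_add_one _)] with u hu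
  rw [(isForm_wedgeConj f).coeff_eq_param, wedgeConj_param, Complex.ofReal_re,
    ← f.coeff_eq_param]
  exact hu.le

theorem lintegral_bergmanForm_lt_top [CompactSpace X] : (bergmanForm n X).lintegral < ⊤ := by
  refine lintegral_lt_top_of_locally_bounded isForm_bergmanForm fun x => ?_
  obtain ⟨R, hR, hsub⟩ := exists_ball_subset_target (mem_chart_target (Fin n → ℂ) x)
  have hp := isParam_chart (chartAt_mem x) hR hsub
  refine ⟨ballConst n R, ?_⟩
  filter_upwards [Metric.ball_mem_nhds _ (half_pos hR)] with u hu
  rw [isForm_bergmanForm.coeff_eq_param, bergmanForm_param, Complex.ofReal_re]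
  exact hp.kernelParam_le hu

/-- On a compact manifold the Hodge number `h^{n,0}` is the integral of the Bergman kernel. -/
theorem hodgeNumber_eq_lintegral [CompactSpace X] :
    (hodgeNumber n X : ENNReal) = (bergmanForm n X).lintegral := by
  have hlt := lintegral_bergmanForm_lt_top (n := n) (X := X)
  -- An infinite basis would contain finite subsets larger than the finite integral of the kernel.
  have hfin : Finite (bergmanBasis n X) := by
    by_contra h
    rw [not_finite_iff_infinite] at h
    obtain ⟨k, hk⟩ := ENNReal.exists_nat_gt hlt.ne
    obtain ⟨T, hT⟩ := Infinite.exists_subset_card_eq (bergmanBasis n X) k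
    exact (hk.trans_le (hT ▸ card_le_lintegral_bergmanForm T)).false
  have : Fintype (bergmanBasis n X) := Fintype.ofFinite _
  -- On a compact manifold square integrability is automatic, so the Hodge number is the dimension
  -- of the Bergman space.
  have h1 : bergmanSubmodule n X = holomorphicForms n X :=
    le_antisymm (fun f hf => hf.1) (fun f hf => mem_bergmanSpace_of_compact hf)
  have h2 : hodgeNumber n X = Fintype.card (bergmanBasis n X) := by
    rw [hodgeNumber, ← h1, (bergmanEquiv n X).finrank_eq,
      Module.finrank_eq_card_basis (bergmanHilbertBasis n X).toOrthonormalBasis.toBasis]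
  rw [h2, ← Finset.card_univ, card_eq_lintegral_sum, lintegral_bergmanForm]
  simp only [tsum_fintype]

end Kernel

/-! ### Pull-back of forms -/

section PullBack

variable {n : ℕ} {X : Type*} [TopologicalSpace X] [SecondCountableTopology X]
  [ChartedSpace (Fin n → ℂ) X] [IsManifold 𝓘(ℂ, Fin n → ℂ) ω X]
  {Y : Type*} [TopologicalSpace Y] [SecondCountableTopology Y]
  [ChartedSpace (Fin n → ℂ) Y] [IsManifold 𝓘(ℂ, Fin n → ℂ) ω Y]

/-- The pull-back of a form by a map. -/
def TopForm.pull (f : TopForm n Y) (Φ : X → Y) : TopForm n X :=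
  TopForm.ofFun fun x => jac n Φ x * f.toFun (Φ x)

theorem TopForm.pull_toFun (f : TopForm n Y) (Φ : X → Y) (x : X) :
    (f.pull Φ).toFun x = jac n Φ x * f.toFun (Φ x) := TopForm.toFun_ofFun _ _

theorem TopForm.pull_param (f : TopForm n Y) {Φ : X → Y} {φ : (Fin n → ℂ) → X} {u : Fin n → ℂ}
    (hΦ : HolAt n Φ (φ u)) (hφ : HolAt n φ u) : (f.pull Φ).param φ u = f.param (Φ ∘ φ) u := by
  rw [TopForm.param, TopForm.pull_toFun, TopForm.param, jac_comp hΦ hφ, Function.comp_apply]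
  ring

theorem pull_mem_holomorphicForms {f : TopForm n Y} (hf : f ∈ holomorphicForms n Y) {Φ : X → Y}
    (hΦ : ∀ x, HolAt n Φ x) : f.pull Φ ∈ holomorphicForms n X := by
  intro e he u hu
  have h1 : ∀ᶠ w in 𝓝 u, HolAt n e.symm w := by
    filter_upwards [e.open_target.mem_nhds hu] with w hw using holAt_chart_symm he hw
  have h2 : ∀ᶠ w in 𝓝 u, HolAt n (Φ ∘ e.symm) w := by
    filter_upwards [h1] with w hw using (hΦ _).comp w hw
  refine ((differentiableAt_param hf h2).congr_of_eventuallyEq ?_).differentiableWithinAt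
  filter_upwards [h1] with w hw
  rw [TopForm.coeff_eq_param, f.pull_param (hΦ _) hw]

/-- Composing Φ with the charts parametrizes disjoint subsets of Y, because Φ is injective on A.
Injectivity on A alone is required, since the projections to the coverings are injective only on
compact sets. -/
theorem tsum_lintegral_pull_le (f : TopForm n Y) {Φ : X → Y} (hΦ : ∀ x, HolAt n Φ x) {A : Set X}
    (hA : MeasurableSet[borel X] A) (hinj : Set.InjOn Φ A) :
    ∑' y : centers n X, ∫⁻ u in piece n (y : X) ∩ (chartAt (Fin n → ℂ) (y : X)).symm ⁻¹' A,
      ‖(f.pull Φ).coeff (chartAt (Fin n → ℂ) (y : X)) u‖ₑ ^ 2 ≤ normSq f := by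
  have hB : ∀ y : centers n X,
      MeasurableSet (piece n (y : X) ∩ (chartAt (Fin n → ℂ) (y : X)).symm ⁻¹' A) := fun y =>
    measurableSet_inter_preimage (measurableSet_piece _)
      ((chartAt (Fin n → ℂ) (y : X)).continuousOn_symm.mono (piece_subset _)) hA
  have hhol : ∀ y : centers n X, ∀ u ∈ piece n (y : X),
      HolAt n (chartAt (Fin n → ℂ) (y : X)).symm u :=
    fun y u hu => holAt_chart_symm (chartAt_mem _) (piece_subset _ hu)
  have h := tsum_lintegral_param_le (isForm_wedgeConj f)
    (φ := fun y : centers n X => Φ ∘ (chartAt (Fin n → ℂ) (y : X)).symm) hB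
    (fun y u hu => (hΦ _).comp u (hhol y u hu.1))
    (fun y => hinj.comp ((chartAt (Fin n → ℂ) (y : X)).symm.injOn.mono fun u hu =>
      piece_subset _ hu.1) fun u hu => hu.2) ?_
  · refine le_of_eq_of_le (tsum_congr fun y => setLIntegral_congr_fun (hB y) fun u hu => ?_) h
    rw [ofReal_wedgeConj_param_re, TopForm.coeff_eq_param, f.pull_param (hΦ _) (hhol y u hu.1)]
  · intro y z hyz
    refine Set.disjoint_left.2 ?_
    rintro _ ⟨u, hu, rfl⟩ ⟨w, hw, hwu⟩
    have h1 : (chartAt (Fin n → ℂ) (z : X)).symm w = (chartAt (Fin n → ℂ) (y : X)).symm u :=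
      hinj hw.2 hu.2 hwu
    refine hyz (Subtype.ext ?_)
    rw [← (mem_piece_iff (piece_subset _ hu.1)).1 hu.1, ← h1,
      (mem_piece_iff (piece_subset _ hw.1)).1 hw.1]

theorem normSq_pull_le (f : TopForm n Y) {Φ : X → Y} (hΦ : ∀ x, HolAt n Φ x)
    (hinj : Function.Injective Φ) : normSq (f.pull Φ) ≤ normSq f := by
  have h := tsum_lintegral_pull_le f hΦ (@MeasurableSet.univ X (borel X)) hinj.injOn
  simp only [Set.preimage_univ, Set.inter_univ] at h
  rwa [normSq_eq_tsum]

/-- The pull-back of the form extremal at Φ(x) still has norm at most one, so it competes in the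
extremal problem at x. -/
theorem diagKernel_ge_of_injective {Φ : X → Y} (hΦ : ∀ x, HolAt n Φ x)
    (hinj : Function.Injective Φ) (x : X) :
    ‖jac n Φ x‖ ^ 2 * diagKernel n (Φ x) ≤ diagKernel n x := by
  obtain ⟨f, hf, h1, h2⟩ := exists_extremal (n := n) (Φ x)
  have h3 := (normSq_pull_le f hΦ hinj).trans h1
  have h4 := norm_toFun_sq_le ⟨pull_mem_holomorphicForms hf.1 hΦ,
    h3.trans_lt ENNReal.one_lt_top⟩ x
  rw [TopForm.pull_toFun, norm_mul, mul_pow, h2] at h4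
  exact h4.trans (mul_le_of_le_one_right (diagKernel_nonneg _) (toReal_le_one h3))

/-- The Bergman kernel is invariant under biholomorphic maps. -/
theorem diagKernel_biholomorphic {Φ : X → Y} {Ψ : Y → X} (hΦ : ∀ x, HolAt n Φ x)
    (hΨ : ∀ y, HolAt n Ψ y) (h1 : Function.LeftInverse Ψ Φ) (h2 : Function.RightInverse Ψ Φ)
    (x : X) : ‖jac n Φ x‖ ^ 2 * diagKernel n (Φ x) = diagKernel n x := by
  refine le_antisymm (diagKernel_ge_of_injective hΦ h1.injective x) ?_
  -- The opposite inequality is the same one for the inverse map, whose Jacobian is reciprocal.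
  have h3 := diagKernel_ge_of_injective hΨ h2.injective (Φ x)
  rw [h1 x] at h3
  have h4 := jac_mul_jac_eq_one (hΨ (Φ x)) (hΦ x) (Eventually.of_forall h1)
  have h5 : ‖jac n Φ x‖ ^ 2 * ‖jac n Ψ (Φ x)‖ ^ 2 = 1 := by
    rw [← mul_pow, ← norm_mul, mul_comm, h4]
    simp
  calc diagKernel n x = ‖jac n Φ x‖ ^ 2 * (‖jac n Ψ (Φ x)‖ ^ 2 * diagKernel n x) := by
        rw [← mul_assoc, h5, one_mul]
    _ ≤ _ := mul_le_mul_of_nonneg_left h3 (by positivity)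

theorem kernelParam_biholomorphic {Φ : X → Y} {Ψ : Y → X} (hΦ : ∀ x, HolAt n Φ x)
    (hΨ : ∀ y, HolAt n Ψ y) (h1 : Function.LeftInverse Ψ Φ) (h2 : Function.RightInverse Ψ Φ)
    {φ : (Fin n → ℂ) → X} {u : Fin n → ℂ} (hφ : HolAt n φ u) :
    kernelParam (Φ ∘ φ) u = kernelParam φ u := by
  rw [kernelParam, kernelParam, jac_comp (hΦ _) hφ, norm_mul, mul_pow,
    ← diagKernel_biholomorphic hΦ hΨ h1 h2, Function.comp_apply]
  ring

end PullBack

/-! ### Normal families of holomorphic forms -/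

section Montel

variable {n : ℕ} {X : Type*} [TopologicalSpace X] [SecondCountableTopology X]
  [ChartedSpace (Fin n → ℂ) X] [IsManifold 𝓘(ℂ, Fin n → ℂ) ω X]

/-- **Montel's theorem**: a locally bounded sequence of holomorphic forms has a subsequence which
converges pointwise to a holomorphic form. -/
theorem exists_subseq_tendsto_holomorphicForms {F : ℕ → TopForm n X}
    (hF : ∀ i, F i ∈ holomorphicForms n X)
    (hbd : ∀ e ∈ IsManifold.maximalAtlas 𝓘(ℂ, Fin n → ℂ) ω X, ∀ u ∈ e.target, ∃ C : ℝ,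
      ∃ R > 0, Metric.ball u R ⊆ e.target ∧ ∀ i, ∀ w ∈ Metric.ball u R, ‖(F i).coeff e w‖ ≤ C) :
    ∃ ψ : ℕ → ℕ, StrictMono ψ ∧ ∃ f ∈ holomorphicForms n X,
      ∀ x, Tendsto (fun k => (F (ψ k)).toFun x) atTop (𝓝 (f.toFun x)) := by
  have hpt : ∀ x : X, ∃ C : ℝ, ∀ i, ‖(F i).toFun x‖ ≤ C := by
    intro x
    have hx := mem_chart_target (Fin n → ℂ) x
    obtain ⟨C, R, hR, -, hC⟩ := hbd _ (chartAt_mem x) _ hx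
    have hj := norm_pos_iff.2 (jac_chart_symm_ne_zero (chartAt_mem x) hx)
    refine ⟨C / ‖jac n (chartAt (Fin n → ℂ) x).symm (chartAt (Fin n → ℂ) x x)‖, fun i => ?_⟩
    have h := hC i _ (Metric.mem_ball_self hR)
    rw [TopForm.coeff_eq_param, TopForm.param, norm_mul,
      (chartAt (Fin n → ℂ) x).left_inv (mem_chart_source _ x)] at h
    rwa [le_div_iff₀' hj]
  choose C hC using hpt
  -- A countable product of closed discs is sequentially compact, so one subsequence converges at
  -- all points of a countable dense set. The uniform Lipschitz bound carries convergence to every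
  -- other point.
  obtain ⟨D, hDc, hDd⟩ := TopologicalSpace.exists_countable_dense X
  have : Countable D := hDc
  obtain ⟨a, -, ψ, hψ, ha⟩ := (isCompact_univ_pi fun d : D =>
    isCompact_closedBall (0 : ℂ) (C d)).tendsto_subseq (x := fun i (d : D) => (F i).toFun d)
    fun i d _ => mem_closedBall_zero_iff.2 (hC d i)
  rw [tendsto_pi_nhds] at ha
  have hlim : ∀ x : X, ∃ s : ℂ, Tendsto (fun k => (F (ψ k)).toFun x) atTop (𝓝 s) := by
    intro x
    set e := chartAt (Fin n → ℂ) x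
    have he : e ∈ IsManifold.maximalAtlas 𝓘(ℂ, Fin n → ℂ) ω X := chartAt_mem x
    have hx : e x ∈ e.target := mem_chart_target (Fin n → ℂ) x
    have hxs : x ∈ e.source := mem_chart_source _ x
    have hj := jac_chart_symm_ne_zero he hx
    obtain ⟨M, R, hR, hsub, hM⟩ := hbd e he _ hx
    have hM0 : 0 ≤ M := (norm_nonneg _).trans (hM 0 _ (Metric.mem_ball_self hR))
    have hcauchy : CauchySeq fun k => (F (ψ k)).coeff e (e x) := by
      refine Metric.cauchySeq_iff.2 fun ε hε => ?_
      set L := 4 * M / R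
      have hL : 0 ≤ L := by positivity
      -- R/4 is the radius on which the Lipschitz bound is valid, and the second term makes the
      -- variation at most ε/3. Using `L + 1` keeps the denominator positive.
      let ρ := min (R / 4) (ε / (3 * (L + 1)))
      have hρ : 0 < ρ := by positivity
      have hρ1 : ρ ≤ R / 4 := min_le_left _ _
      have hρ2 : L * ρ ≤ ε / 3 := by
        calc L * ρ ≤ (L + 1) * (ε / (3 * (L + 1))) := by
              gcongr
              · linarith
              · exact min_le_right _ _
          _ = ε / 3 := by field_simp
      obtain ⟨d, hdD, hd⟩ := hDd.exists_mem_open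
        (e.isOpen_inter_preimage (Metric.isOpen_ball (x := e x) (ε := ρ)))
        ⟨x, hxs, Metric.mem_ball_self hρ⟩
      have hdconv : CauchySeq fun k => (F (ψ k)).coeff e (e d) := by
        simp only [TopForm.coeff_eq_param, TopForm.param, e.left_inv hd.1]
        exact ((ha ⟨d, hdD⟩).const_mul _).cauchySeq
      have hlip : ∀ k, ‖(F (ψ k)).coeff e (e x) - (F (ψ k)).coeff e (e d)‖ ≤ ε / 3 := by
        intro k
        refine (norm_sub_le_of_bounded_ball ((hF (ψ k) e he).mono hsub) (hM (ψ k))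
          (Metric.mem_ball_self (by positivity)) (Metric.ball_subset_ball hρ1 hd.2)).trans ?_
        refine le_trans (mul_le_mul_of_nonneg_left ?_ hL) hρ2
        rw [norm_sub_rev]
        exact (mem_ball_iff_norm.1 hd.2).le
      obtain ⟨N, hN⟩ := Metric.cauchySeq_iff.1 hdconv (ε / 3) (by positivity)
      refine ⟨N, fun k hk l hl => ?_⟩
      have h1 := hN k hk l hl
      rw [dist_eq_norm] at h1 ⊢
      have h2 := hlip k
      have h3 := hlip l
      rw [norm_sub_rev] at h3
      calc ‖(F (ψ k)).coeff e (e x) - (F (ψ l)).coeff e (e x)‖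
          = ‖((F (ψ k)).coeff e (e x) - (F (ψ k)).coeff e (e d)) +
            ((F (ψ k)).coeff e (e d) - (F (ψ l)).coeff e (e d)) +
            ((F (ψ l)).coeff e (e d) - (F (ψ l)).coeff e (e x))‖ := by congr 1; ring
        _ ≤ _ := norm_add₃_le
        _ < ε := by linarith
    obtain ⟨s, hs⟩ := cauchySeq_tendsto_of_complete hcauchy
    refine ⟨(jac n e.symm (e x))⁻¹ * s, (hs.const_mul _).congr fun k => ?_⟩
    rw [TopForm.coeff_eq_param, TopForm.param, e.left_inv hxs, inv_mul_cancel_left₀ hj]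
  choose s hs using hlim
  have hs' : ∀ x, Tendsto (fun k => (F (ψ k)).toFun x) atTop
      (𝓝 ((TopForm.ofFun s : TopForm n X).toFun x)) := by
    intro x
    rw [TopForm.toFun_ofFun]
    exact hs x
  refine ⟨ψ, hψ, TopForm.ofFun s, ?_, hs'⟩
  refine mem_holomorphicForms_of_tendsto (fun k => hF (ψ k)) hs' fun e he u hu => ?_
  obtain ⟨M, R, hR, hsub, hM⟩ := hbd e he u hu
  exact ⟨M, R, hR, hsub, Eventually.of_forall fun k => hM (ψ k)⟩

end Montel

/-! ### The projection to the quotient -/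

section Projection

variable {n : ℕ} {X : Type*} [TopologicalSpace X] [T2Space X] [LocallyCompactSpace X]
  [SecondCountableTopology X] [ChartedSpace (Fin n → ℂ) X] [IsManifold 𝓘(ℂ, Fin n → ℂ) ω X]
  {Γ : Type*} [Group Γ] [MulAction Γ X] [ContinuousConstSMul Γ X] [ProperlyDiscontinuousSMul Γ X]
  [IsCancelSMul Γ X] [HolomorphicSMul n Γ X]

theorem proj_eq_iff {x y : X} : proj Γ x = proj Γ y ↔ ∃ g : Γ, g • y = x := by
  rw [proj, proj, Quotient.eq]
  rfl

theorem proj_smul (g : Γ) (x : X) : proj Γ (g • x) = proj Γ x := proj_eq_iff.2 ⟨g, rfl⟩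

theorem proj_surjective : Function.Surjective (proj Γ (X := X)) := Quotient.mk_surjective

theorem isLocalHomeomorph_proj : IsLocalHomeomorph (proj Γ (X := X)) :=
  (isQuotientCoveringMap_quotientMk_of_properlyDiscontinuousSMul
      (G := Γ) (E := X)).isCoveringMap.isLocalHomeomorph

/-- The preferred chart of the quotient is built on a preimage of q chosen once and for all;
unfolding that choice is all that is needed. -/
theorem exists_chart_quotient (q : QuotientManifold Γ X) : ∃ a : X, proj Γ a = q ∧
    chartAt (Fin n → ℂ) q =
      (isLocalHomeomorph_proj (Γ := Γ).localInverseAt a).trans (chartAt (Fin n → ℂ) a) := by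
  let h : Function.Surjective (proj Γ (X := X)) := proj_surjective
  exact ⟨h.hasRightInverse.choose q, h.hasRightInverse.choose_spec q, rfl⟩

theorem holAt_smul (n : ℕ) {X Γ : Type*} [TopologicalSpace X] [ChartedSpace (Fin n → ℂ) X] [Group Γ]
    [MulAction Γ X] [HolomorphicSMul n Γ X] (g : Γ) (x : X) : HolAt n (fun x : X => g • x) x :=
  (HolomorphicSMul.contMDiff_smul (n := n) g).contMDiffAt

/-- The projection has local holomorphic inverses. -/
theorem exists_local_section (x : X) : HolAt n (proj Γ) x ∧ ∃ σ : QuotientManifold Γ X → X,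
    HolAt n σ (proj Γ x) ∧ σ (proj Γ x) = x ∧ (∀ᶠ q in 𝓝 (proj Γ x), proj Γ (σ q) = q) ∧
      ∀ᶠ z in 𝓝 x, σ (proj Γ z) = z := by
  obtain ⟨a, ha, hchart⟩ := exists_chart_quotient (n := n) (proj Γ x)
  -- The point a underlying the chart need not be x itself, only in its orbit. The section is
  -- constructed at a and transported by g.
  obtain ⟨g, rfl⟩ := proj_eq_iff.1 ha.symm
  rw [proj_smul] at hchart ⊢
  set q := proj Γ a with hq
  set s := isLocalHomeomorph_proj (Γ := Γ).localInverseAt a with hs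
  set E := chartAt (Fin n → ℂ) q with hE
  set e := chartAt (Fin n → ℂ) a with he
  have hsymm : ∀ u, E.symm u = proj Γ (e.symm u) := by
    intro u
    rw [hchart, OpenPartialHomeomorph.trans_symm_eq_symm_trans_symm, OpenPartialHomeomorph.coe_trans,
      Function.comp_apply, hs, IsLocalHomeomorph.localInverseAt_symm]
  have hsa : s q = a := isLocalHomeomorph_proj.localInverseAt_apply_self
  have hEq : E q = e a := by
    rw [hchart, OpenPartialHomeomorph.coe_trans, Function.comp_apply, hsa]
  have haE : e a ∈ E.target := hEq ▸ mem_chart_target _ q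
  have hae : a ∈ e.source := mem_chart_source _ a
  have hproj : ∀ᶠ z in 𝓝 a, proj Γ z = E.symm (e z) := by
    filter_upwards [e.open_source.mem_nhds hae] with z hz
    rw [hsymm, e.left_inv hz]
  have hhol : HolAt n (proj Γ) a := by
    have h1 : HolAt n (E.symm ∘ e) a :=
      (holAt_chart_symm (chartAt_mem q) haE).comp a (holAt_chart (chartAt_mem a) hae)
    exact h1.congr_of_eventuallyEq hproj
  have hqE : q ∈ E.source := mem_chart_source _ q
  have hσ : HolAt n (e.symm ∘ E) q := by
    have h1 : HolAt n e.symm (E q) := by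
      rw [hEq]
      exact holAt_chart_symm (chartAt_mem a) (e.map_source hae)
    exact h1.comp q (holAt_chart (chartAt_mem q) hqE)
  have hσq : e.symm (E q) = a := by rw [hEq, e.left_inv hae]
  refine ⟨?_, fun q' => g • e.symm (E q'), ?_, ?_, ?_, ?_⟩
  · have h1 : HolAt n (proj Γ ∘ fun z : X => g⁻¹ • z) (g • a) := by
      refine ContMDiffAt.comp (g • a) ?_ (holAt_smul n g⁻¹ (g • a))
      rwa [inv_smul_smul]
    refine h1.congr_of_eventuallyEq (Eventually.of_forall fun z => ?_)
    exact (proj_smul g⁻¹ z).symm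
  · exact (holAt_smul n g _).comp q hσ
  · simp only [hσq]
  · filter_upwards [E.open_source.mem_nhds hqE] with q' hq'
    rw [proj_smul, ← hsymm, E.left_inv hq']
  · have h1 : ∀ᶠ z in 𝓝 a, e.symm (E (proj Γ z)) = z := by
      filter_upwards [hproj, e.open_source.mem_nhds hae,
        e.continuousAt hae |>.preimage_mem_nhds (E.open_target.mem_nhds haE)] with z h1 h2 h3
      rw [h1, E.right_inv h3, e.left_inv h2]
    have h2 : Tendsto (fun z : X => g⁻¹ • z) (𝓝 (g • a)) (𝓝 a) := by
      have h3 := (continuous_const_smul g⁻¹).tendsto (g • a)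
      rwa [inv_smul_smul] at h3
    filter_upwards [h2.eventually h1] with z hz
    rw [proj_smul] at hz
    rw [hz, smul_inv_smul]

theorem holAt_proj (x : X) : HolAt n (proj Γ) x := (exists_local_section x).1

/-- A map on the quotient is holomorphic if its lift is. -/
theorem holAt_of_comp_proj {Y : Type*} [TopologicalSpace Y] [ChartedSpace (Fin n → ℂ) Y]
    {Φ : QuotientManifold Γ X → Y} {x : X} (h : HolAt n (Φ ∘ proj Γ) x) : HolAt n Φ (proj Γ x) := by
  obtain ⟨-, σ, hσ, hσx, h1, -⟩ := exists_local_section (n := n) (Γ := Γ) x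
  have h2 : HolAt n ((Φ ∘ proj Γ) ∘ σ) (proj Γ x) := by
    refine ContMDiffAt.comp (proj Γ x) ?_ hσ
    rwa [hσx]
  refine h2.congr_of_eventuallyEq ?_
  filter_upwards [h1] with q hq
  simp only [Function.comp_apply, hq]

theorem jac_proj_ne_zero (x : X) : jac n (proj Γ) x ≠ 0 := by
  obtain ⟨h, σ, hσ, -, -, h2⟩ := exists_local_section (n := n) (Γ := Γ) x
  exact right_ne_zero_of_mul_eq_one (jac_mul_jac_eq_one hσ h h2)

/-- The differential of a local section is a two-sided inverse of the differential of the
projection. -/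
theorem inverse_mfderiv_proj (x : X) :
    ∃ D : (Fin n → ℂ) →L[ℂ] (Fin n → ℂ), D.det * jac n (proj Γ) x = 1 ∧
    (mfderiv 𝓘(ℂ, Fin n → ℂ) 𝓘(ℂ, Fin n → ℂ) (proj Γ (X := X)) x).inverse = D := by
  obtain ⟨h, σ, hσ, hσx, h1, h2⟩ := exists_local_section (n := n) (Γ := Γ) x
  have h3 : (dmap n σ (proj Γ x)).comp (dmap n (proj Γ) x) = ContinuousLinearMap.id ℂ _ := by
    rw [← dmap_comp hσ h, dmap_congr (Φ := σ ∘ proj Γ) (Ψ := id) h2, dmap_id]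
  have h4 : (dmap n (proj Γ) x).comp (dmap n σ (proj Γ x)) = ContinuousLinearMap.id ℂ _ := by
    have h5 : HolAt n (proj Γ) (σ (proj Γ x)) := by rwa [hσx]
    have h6 := dmap_comp h5 hσ
    rw [dmap_congr (Φ := proj Γ ∘ σ) (Ψ := id) h1, dmap_id, hσx] at h6
    exact h6.symm
  exact ⟨dmap n σ (proj Γ x), jac_mul_jac_eq_one hσ h h2, ContinuousLinearMap.inverse_eq h4 h3⟩

theorem diagKernel_smul (g : Γ) (x : X) :
    ‖jac n (fun z : X => g • z) x‖ ^ 2 * diagKernel n (g • x) = diagKernel n x :=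
  diagKernel_biholomorphic (Φ := fun z : X => g • z) (Ψ := fun z : X => g⁻¹ • z) (holAt_smul n g)
    (holAt_smul n g⁻¹) (inv_smul_smul g) (smul_inv_smul g) x

theorem pullBack_bergmanForm_apply (x : X) (v : Fin n → TangentSpace 𝓘(ℂ, Fin n → ℂ) x) :
    pullBack (bergmanForm n (QuotientManifold Γ X)) x v =
      ((‖jac n (proj Γ) x * frameDet v‖ ^ 2 * diagKernel n (proj Γ x) : ℝ) : ℂ) := by
  rw [pullBack, bergmanForm_apply]
  congr 4
  exact frameDet_comp (y := proj Γ x) (dmap n (proj Γ) x) v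

theorem pullBack_bergmanForm_coeff {e : OpenPartialHomeomorph X (Fin n → ℂ)}
    (he : e ∈ IsManifold.maximalAtlas 𝓘(ℂ, Fin n → ℂ) ω X) {u : Fin n → ℂ} (hu : u ∈ e.target) :
    (pullBack (bergmanForm n (QuotientManifold Γ X)) : Density n X).coeff e u =
      (kernelParam (proj Γ ∘ e.symm) u : ℂ) := by
  rw [Density.coeff, pullBack_bergmanForm_apply, kernelParam,
    jac_comp (holAt_proj _) (holAt_chart_symm he hu)]
  congr 4
  exact congrArg (jac n (proj Γ) (e.symm u) * ·) (frameDet_map (x := e.symm u) (dmap n e.symm u))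

/-- The push-down is defined through the representative `Quotient.out`. Passing to an arbitrary x
over the same point introduces the Jacobian of a group element, which the invariance of the kernel
cancels. -/
theorem pushDown_bergmanForm_apply (x : X)
    (v : Fin n → TangentSpace 𝓘(ℂ, Fin n → ℂ) (proj Γ x)) :
    pushDown Γ (bergmanForm n X) (proj Γ x) v =
      ((‖frameDet v‖ ^ 2 * (diagKernel n x / ‖jac n (proj Γ) x‖ ^ 2) : ℝ) : ℂ) := by
  obtain ⟨g, hg⟩ : ∃ g : Γ, g • x = Quotient.out (proj Γ x) :=
    proj_eq_iff.1 (Quotient.out_eq (proj Γ x))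
  obtain ⟨D, hD, hinv⟩ := inverse_mfderiv_proj (n := n) (Γ := Γ) (Quotient.out (proj Γ x))
  have h1 : pushDown Γ (bergmanForm n X) (proj Γ x) v =
      ((‖D.det * frameDet v‖ ^ 2 * diagKernel n (Quotient.out (proj Γ x)) : ℝ) : ℂ) := by
    rw [pushDown, bergmanForm_apply, hinv]
    exact congrArg (fun t : ℂ => ((‖t‖ ^ 2 * diagKernel n (Quotient.out (proj Γ x)) : ℝ) : ℂ))
      (frameDet_comp (y := Quotient.out (proj Γ x)) D v)
  have h2 : jac n (proj Γ) x =
      jac n (proj Γ) (Quotient.out (proj Γ x)) * jac n (fun z : X => g • z) x := by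
    rw [← hg, ← jac_comp (Φ := fun z : X => g • z) (holAt_proj _) (holAt_smul n g x)]
    exact congrArg (fun Φ => jac n Φ x) (funext fun z => (proj_smul g z).symm)
  have h3 := diagKernel_smul (n := n) g x
  have h4 := jac_proj_ne_zero (n := n) (Γ := Γ) x
  rw [h2] at h4
  rw [h1, h2, ← h3, hg]
  have h5 : ‖D.det‖ ^ 2 * ‖jac n (proj Γ) (Quotient.out (proj Γ x))‖ ^ 2 = 1 := by
    rw [← mul_pow, ← norm_mul, hD]
    simp
  have h6 := norm_ne_zero_iff.2 (left_ne_zero_of_mul h4)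
  have h7 := norm_ne_zero_iff.2 (right_ne_zero_of_mul h4)
  congr 1
  rw [norm_mul, norm_mul, mul_pow, mul_pow, eq_div_of_mul_eq (pow_ne_zero 2 h6) h5]
  field_simp

theorem isForm_pushDown : (pushDown Γ (bergmanForm n X)).IsForm := by
  intro q v
  obtain ⟨x, rfl⟩ := proj_surjective (Γ := Γ) q
  rw [Density.toFun, pushDown_bergmanForm_apply, pushDown_bergmanForm_apply, frameDet_stdFrame]
  simp

theorem pushDown_param {φ : (Fin n → ℂ) → X} {u : Fin n → ℂ} (hφ : HolAt n φ u) :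
    (pushDown Γ (bergmanForm n X)).param (proj Γ ∘ φ) u = (kernelParam φ u : ℂ) := by
  have h4 := norm_ne_zero_iff.2 (jac_proj_ne_zero (n := n) (Γ := Γ) (φ u))
  rw [Density.param, jac_comp (holAt_proj _) hφ, Function.comp_apply, Density.toFun,
    pushDown_bergmanForm_apply, frameDet_stdFrame, ← Complex.ofReal_mul, kernelParam]
  congr 1
  rw [norm_mul, mul_pow, norm_one]
  field_simp

/-- The automorphism of the quotient by a normal subgroup induced by an element of the group. -/
def quotientMap {H : Subgroup Γ} (hH : H.Normal) (g : Γ) :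
    QuotientManifold H X → QuotientManifold H X :=
  Quotient.map (fun x => g • x) (by
    rintro _ y ⟨h, rfl⟩
    refine ⟨⟨g * h * g⁻¹, hH.conj_mem h h.2 g⟩, ?_⟩
    change (g * (h : Γ) * g⁻¹) • g • y = g • (h : Γ) • y
    rw [smul_smul, smul_smul]
    simp)

theorem quotientMap_proj {H : Subgroup Γ} (hH : H.Normal) (g : Γ) (x : X) :
    quotientMap hH g (proj H x) = proj H (g • x) := rfl

theorem holAt_quotientMap {H : Subgroup Γ} (hH : H.Normal) (g : Γ) (q : QuotientManifold H X) :
    HolAt n (quotientMap hH g) q := by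
  obtain ⟨x, rfl⟩ := proj_surjective q
  refine holAt_of_comp_proj ?_
  exact (holAt_proj (Γ := H) (g • x)).comp x (holAt_smul n g x)

theorem quotientMap_inv {H : Subgroup Γ} (hH : H.Normal) (g : Γ) :
    Function.LeftInverse (quotientMap (X := X) hH g⁻¹) (quotientMap hH g) := by
  intro q
  obtain ⟨x, rfl⟩ := proj_surjective q
  rw [quotientMap_proj, quotientMap_proj, inv_smul_smul]

/-- By normality g descends to an automorphism of X/H, under which the kernel is invariant. Hence
the kernel of X/H, read upstairs, is invariant under all of Γ and not just under H. -/
theorem kernelParam_proj_smul {H : Subgroup Γ} (hH : H.Normal) (g : Γ) {φ : (Fin n → ℂ) → X}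
    {u : Fin n → ℂ} (hφ : HolAt n φ u) :
    kernelParam (proj H ∘ (fun x : X => g • x) ∘ φ) u = kernelParam (proj H ∘ φ) u := by
  have h := kernelParam_biholomorphic (φ := proj H ∘ φ) (u := u)
    (holAt_quotientMap (n := n) (X := X) hH g)
    (holAt_quotientMap hH g⁻¹) (quotientMap_inv hH g) (by
      have := quotientMap_inv (X := X) hH g⁻¹
      rwa [inv_inv] at this) ((holAt_proj _).comp u hφ)
  exact h

end Projection

/-! ### Decomposition of the quotient into finitely many pieces -/

section FundamentalFamily

variable {n : ℕ} {X : Type*} [TopologicalSpace X] [T2Space X] [LocallyCompactSpace X]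
  [SecondCountableTopology X] [ChartedSpace (Fin n → ℂ) X] [IsManifold 𝓘(ℂ, Fin n → ℂ) ω X]
  {Γ : Type*} [Group Γ] [MulAction Γ X] [ContinuousConstSMul Γ X] [ProperlyDiscontinuousSMul Γ X]
  [IsCancelSMul Γ X] [HolomorphicSMul n Γ X]

theorem proj_eq_of_subgroup {H : Subgroup Γ} {x y : X} (h : proj H x = proj H y) :
    proj Γ x = proj Γ y := by
  obtain ⟨g, hg⟩ := proj_eq_iff.1 h
  exact proj_eq_iff.2 ⟨g, hg⟩

theorem exists_isParam_proj {e : OpenPartialHomeomorph X (Fin n → ℂ)}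
    (he : e ∈ IsManifold.maximalAtlas 𝓘(ℂ, Fin n → ℂ) ω X) {u : Fin n → ℂ} (hu : u ∈ e.target) :
    ∃ R > 0, Metric.ball u R ⊆ e.target ∧ IsParam (n := n) (proj Γ ∘ e.symm) u R := by
  obtain ⟨s, hs, hsp⟩ := isLocalHomeomorph_proj (Γ := Γ) (e.symm u)
  have h1 : e.target ∩ e.symm ⁻¹' s.source ∈ 𝓝 u :=
    (e.isOpen_inter_preimage_symm s.open_source).mem_nhds ⟨hu, hs⟩
  obtain ⟨R, hR, hsub⟩ := Metric.mem_nhds_iff.1 h1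
  refine ⟨R, hR, fun w hw => (hsub hw).1, hR, fun w hw => ?_, fun w hw z hz h => ?_⟩
  · exact (holAt_proj _).comp w (holAt_chart_symm he (hsub hw).1)
  · have h2 : s (e.symm w) = s (e.symm z) := by
      rw [← hsp]; exact h
    exact e.symm.injOn (hsub hw).1 (hsub hz).1 (s.injOn (hsub hw).2 (hsub hz).2 h2)

theorem IsParam.lift {φ : (Fin n → ℂ) → X} {c : Fin n → ℂ} {R : ℝ}
    (h : IsParam (n := n) (proj Γ ∘ φ) c R) (hφ : ∀ u ∈ Metric.ball c R, HolAt n φ u) :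
    IsParam (n := n) φ c R :=
  ⟨h.pos, hφ, fun _ hu _ hw huw => h.inj hu hw (congrArg (proj Γ) huw)⟩

/-- Points identified modulo H are identified modulo Γ, so a ball embedding in X/Γ embeds in every
intermediate quotient. One radius, and hence one set of constants, serves the whole tower. -/
theorem IsParam.proj_subgroup {φ : (Fin n → ℂ) → X} {c : Fin n → ℂ} {R : ℝ}
    (h : IsParam (n := n) (proj Γ ∘ φ) c R) (hφ : ∀ u ∈ Metric.ball c R, HolAt n φ u)
    (H : Subgroup Γ) : IsParam (n := n) (proj H ∘ φ) c R :=
  ⟨h.pos, fun u hu => (holAt_proj _).comp u (hφ u hu),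
    fun _ hu _ hw huw => h.inj hu hw (proj_eq_of_subgroup huw)⟩

/-- A family of Borel sets in coordinate balls of `X` whose images decompose `X / Γ`. -/
structure FundamentalFamily (n : ℕ) (Γ X ι : Type*) [TopologicalSpace X] [T2Space X]
    [LocallyCompactSpace X] [SecondCountableTopology X] [ChartedSpace (Fin n → ℂ) X]
    [IsManifold 𝓘(ℂ, Fin n → ℂ) ω X] [Group Γ] [MulAction Γ X] [ContinuousConstSMul Γ X]
    [ProperlyDiscontinuousSMul Γ X] [IsCancelSMul Γ X] [HolomorphicSMul n Γ X] where
  chart : ι → OpenPartialHomeomorph X (Fin n → ℂ)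
  center : ι → Fin n → ℂ
  radius : ι → ℝ
  dom : ι → Set (Fin n → ℂ)
  mem_atlas : ∀ i, chart i ∈ IsManifold.maximalAtlas 𝓘(ℂ, Fin n → ℂ) ω X
  ball_subset : ∀ i, Metric.ball (center i) (radius i) ⊆ (chart i).target
  isParam : ∀ i, IsParam (n := n) (proj Γ ∘ (chart i).symm) (center i) (radius i)
  measurableSet_dom : ∀ i, MeasurableSet (dom i)
  dom_subset : ∀ i, dom i ⊆ Metric.ball (center i) (radius i / 8)
  disjoint : Pairwise (Function.onFun Disjoint fun i => (proj Γ ∘ (chart i).symm) '' dom i)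
  cover : ⋃ i, (proj Γ ∘ (chart i).symm) '' dom i = Set.univ

/-- Finitely many coordinate balls cover the compact quotient and are made disjoint. The prescribed
ball is listed first so that it survives intact as a piece. -/
theorem exists_fundamentalFamily [CompactSpace (QuotientManifold Γ X)]
    {e : OpenPartialHomeomorph X (Fin n → ℂ)}
    (he : e ∈ IsManifold.maximalAtlas 𝓘(ℂ, Fin n → ℂ) ω X) {c : Fin n → ℂ} {R : ℝ}
    (hball : Metric.ball c R ⊆ e.target) (hpar : IsParam (n := n) (proj Γ ∘ e.symm) c R) :
    ∃ m : ℕ, ∃ F : FundamentalFamily n Γ X (Fin (m + 1)),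
      F.chart 0 = e ∧ F.center 0 = c ∧ F.radius 0 = R ∧ F.dom 0 = Metric.ball c (R / 8) := by
  let D := {d : OpenPartialHomeomorph X (Fin n → ℂ) × (Fin n → ℂ) × ℝ //
    d.1 ∈ IsManifold.maximalAtlas 𝓘(ℂ, Fin n → ℂ) ω X ∧ Metric.ball d.2.1 d.2.2 ⊆ d.1.target ∧
      IsParam (n := n) (proj Γ ∘ d.1.symm) d.2.1 d.2.2}
  -- One eighth of the radius is where the Lipschitz bound for the kernels holds.
  let V : D → Set (Fin n → ℂ) := fun d => Metric.ball d.1.2.1 (d.1.2.2 / 8)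
  let W : D → Set (QuotientManifold Γ X) := fun d => (proj Γ ∘ d.1.1.symm) '' V d
  have hVR : ∀ d : D, V d ⊆ Metric.ball d.1.2.1 d.1.2.2 := fun d =>
    Metric.ball_subset_ball (by linarith [d.2.2.2.pos])
  have hW : ∀ d : D, IsOpen (W d) := by
    intro d
    simp only [W, Set.image_comp]
    refine isLocalHomeomorph_proj.isOpenMap _ ?_
    exact d.1.1.symm.isOpen_image_of_subset_source Metric.isOpen_ball ((hVR d).trans d.2.2.1)
  have hex : ∀ x : X, ∃ d : D, proj Γ x ∈ W d := by
    intro x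
    have hx := mem_chart_target (Fin n → ℂ) x
    obtain ⟨r, hr, h1, h2⟩ := exists_isParam_proj (Γ := Γ) (chartAt_mem x) hx
    refine ⟨⟨(chartAt (Fin n → ℂ) x, chartAt (Fin n → ℂ) x x, r), chartAt_mem x, h1, h2⟩,
      chartAt (Fin n → ℂ) x x, Metric.mem_ball_self (by positivity), ?_⟩
    simp [(chartAt (Fin n → ℂ) x).left_inv (mem_chart_source _ x)]
  obtain ⟨t, ht⟩ := isCompact_univ.elim_finite_subcover W hW (by
    intro q _
    obtain ⟨x, rfl⟩ := proj_surjective q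
    exact Set.mem_iUnion.2 (hex x))
  let d0 : D := ⟨(e, c, R), he, hball, hpar⟩
  -- The prescribed datum is prepended to the subcover; being at the minimal index, it loses nothing
  -- to the other pieces.
  let dat : Fin (t.card + 1) → D := Fin.cons d0 fun k => (t.equivFin.symm k : D)
  obtain ⟨B, hBm, hBs, hB0, hBd, hBc⟩ := exists_disjoint_pieces (n := n)
    (φ := fun k => proj Γ ∘ (dat k).1.1.symm) (U := fun k => V (dat k))
    (fun k => Metric.isOpen_ball)
    (fun k u hu => ((dat k).2.2.2.hol u (hVR _ hu)).continuousAt.continuousWithinAt)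
    (fun k => hW (dat k))
  refine ⟨t.card, ⟨fun k => (dat k).1.1, fun k => (dat k).1.2.1, fun k => (dat k).1.2.2, B,
    fun k => (dat k).2.1, fun k => (dat k).2.2.1, fun k => (dat k).2.2.2, hBm, hBs, hBd, ?_⟩,
    rfl, rfl, rfl, hB0 0 fun k _ => Fin.zero_le k⟩
  rw [hBc, Set.eq_univ_iff_forall]
  intro q
  have hq := ht (Set.mem_univ q)
  simp only [Set.mem_iUnion] at hq ⊢
  obtain ⟨d, hd, hq⟩ := hq
  refine ⟨(t.equivFin ⟨d, hd⟩).succ, ?_⟩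
  have : dat (t.equivFin ⟨d, hd⟩).succ = d := by simp [dat]
  simp only [this]
  exact hq

/-! ### Integrals over the quotients by normal subgroups of finite index -/

namespace FundamentalFamily

variable {ι : Type*} (F : FundamentalFamily n Γ X ι)

theorem dom_subset_ball (i : ι) : F.dom i ⊆ Metric.ball (F.center i) (F.radius i) :=
  (F.dom_subset i).trans (Metric.ball_subset_ball (by linarith [(F.isParam i).pos]))

theorem holAt_symm (i : ι) {u : Fin n → ℂ} (hu : u ∈ Metric.ball (F.center i) (F.radius i)) :
    HolAt n (F.chart i).symm u :=
  holAt_chart_symm (F.mem_atlas i) (F.ball_subset i hu)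

theorem lintegral_pushDown [Countable ι] : (pushDown Γ (bergmanForm n X)).lintegral =
    ∑' i, ∫⁻ u in F.dom i, ENNReal.ofReal (kernelParam (n := n) (F.chart i).symm u) := by
  rw [lintegral_eq_tsum_param isForm_pushDown F.measurableSet_dom
    (fun i u hu => (F.isParam i).hol u (F.dom_subset_ball i hu))
    (fun i => (F.isParam i).inj.mono (F.dom_subset_ball i)) F.disjoint F.cover]
  congr with i
  refine setLIntegral_congr_fun (F.measurableSet_dom i) fun u hu => ?_
  simp only [pushDown_param (F.holAt_symm i (F.dom_subset_ball i hu)), Complex.ofReal_re]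

/-- A point above q is a translate by some g of a point in a piece. The coset representative of g is
g h with h in H, and g h g⁻¹ lies in H by normality, so replacing g by the representative keeps the
H-orbit. -/
theorem exists_coset_translate {H : Subgroup Γ} (hH : H.Normal) (q : QuotientManifold H X) :
    ∃ i, ∃ r : Γ ⧸ H, ∃ u ∈ F.dom i, proj H (r.out • (F.chart i).symm u) = q := by
  obtain ⟨x, rfl⟩ := proj_surjective q
  have h1 : proj Γ x ∈ ⋃ i, (proj Γ ∘ (F.chart i).symm) '' F.dom i := by rw [F.cover]; trivial
  obtain ⟨i, u, hu, h2⟩ := Set.mem_iUnion.1 h1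
  obtain ⟨g, hg⟩ := proj_eq_iff.1 h2.symm
  obtain ⟨h, hh⟩ := QuotientGroup.mk_out_eq_mul H g
  refine ⟨i, (g : Γ ⧸ H), u, hu, proj_eq_iff.2 ⟨⟨g * (h : Γ) * g⁻¹,
    hH.conj_mem _ h.2 g⟩, ?_⟩⟩
  rw [hh]
  change (g * (h : Γ) * g⁻¹) • x = (g * (h : Γ)) • (F.chart i).symm u
  rw [← hg, smul_smul, inv_mul_cancel_right]

/-- The quotient is covered by the images of finitely many closed balls, one for each piece and each
coset. -/
theorem compactSpace_quotient {ι : Type*} (F : FundamentalFamily n Γ X ι) [Finite ι] {H : Subgroup Γ} (hH : H.Normal) [H.FiniteIndex] :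
    CompactSpace (QuotientManifold H X) := by
  have : Finite (Γ ⧸ H) := Subgroup.finite_quotient_of_finiteIndex
  have h1 : ∀ p : ι × (Γ ⧸ H), IsCompact ((fun u => proj H (p.2.out • (F.chart p.1).symm u)) ''
      Metric.closedBall (F.center p.1) (F.radius p.1 / 8)) := by
    intro p
    refine (isCompact_closedBall _ _).image_of_continuousOn fun u hu => ?_
    have h2 : u ∈ Metric.ball (F.center p.1) (F.radius p.1) :=
      Metric.closedBall_subset_ball (by linarith [(F.isParam p.1).pos]) hu
    have h3 := (holAt_proj (n := n) (Γ := H) (p.2.out • (F.chart p.1).symm u)).continuousAt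
    have h4 : ContinuousAt (fun u => p.2.out • (F.chart p.1).symm u) u :=
      (F.holAt_symm p.1 h2).continuousAt.const_smul _
    exact (ContinuousAt.comp (f := fun u => p.2.out • (F.chart p.1).symm u) h3 h4).continuousWithinAt
  refine ⟨?_⟩
  have h2 : (Set.univ : Set (QuotientManifold H X)) = ⋃ p : ι × (Γ ⧸ H),
      (fun u => proj H (p.2.out • (F.chart p.1).symm u)) ''
        Metric.closedBall (F.center p.1) (F.radius p.1 / 8) := by
    symm
    rw [Set.eq_univ_iff_forall]
    intro q
    obtain ⟨i, r, u, hu, hq⟩ := F.exists_coset_translate hH q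
    exact Set.mem_iUnion.2 ⟨(i, r), u, Metric.ball_subset_closedBall (F.dom_subset i hu), hq⟩
  rw [h2]
  exact isCompact_iUnion h1

/-- The translates of the pieces by coset representatives decompose X/H, and the Γ-invariance of its
kernel gives all translates of a piece the same integral. The number of cosets factors out. -/
theorem lintegral_bergmanForm_quotient [Countable ι] {H : Subgroup Γ} (hH : H.Normal)
    [H.FiniteIndex] : (bergmanForm n (QuotientManifold H X)).lintegral = H.index *
      ∑' i, ∫⁻ u in F.dom i,
        ENNReal.ofReal (kernelParam (n := n) (proj H ∘ (F.chart i).symm) u) := by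
  have : Finite (Γ ⧸ H) := Subgroup.finite_quotient_of_finiteIndex
  have : Fintype (Γ ⧸ H) := Fintype.ofFinite _
  have hproj : ∀ (g : Γ) (x : X), proj Γ (g • x) = proj Γ x := proj_smul
  rw [lintegral_eq_tsum_param (ι := ι × (Γ ⧸ H)) (B := fun p => F.dom p.1)
    (φ := fun p => proj H ∘ (fun x : X => p.2.out • x) ∘ (F.chart p.1).symm)
    isForm_bergmanForm (fun p => F.measurableSet_dom p.1)]
  · rw [ENNReal.tsum_prod' (f := fun p : ι × (Γ ⧸ H) => ∫⁻ u in F.dom p.1, ENNReal.ofReal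
      ((bergmanForm n (QuotientManifold H X)).param
        (proj H ∘ (fun x : X => p.2.out • x) ∘ (F.chart p.1).symm) u).re), ← ENNReal.tsum_mul_left]
    congr with i
    rw [tsum_fintype, Finset.sum_congr rfl (g := fun _ => ∫⁻ u in F.dom i,
        ENNReal.ofReal (kernelParam (n := n) (proj H ∘ (F.chart i).symm) u))]
    · rw [Finset.sum_const, Finset.card_univ, nsmul_eq_mul, Subgroup.index,
        Nat.card_eq_fintype_card]
    · intro r _
      refine setLIntegral_congr_fun (F.measurableSet_dom i) fun u hu => ?_
      simp only [bergmanForm_param, Complex.ofReal_re,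
        kernelParam_proj_smul hH r.out (F.holAt_symm i (F.dom_subset_ball i hu))]
  · rintro ⟨i, r⟩ u hu
    exact (holAt_proj _).comp u ((holAt_smul n r.out _).comp u
      (F.holAt_symm i (F.dom_subset_ball i hu)))
  · rintro ⟨i, r⟩ u hu w hw h
    have h1 := proj_eq_of_subgroup h
    simp only [Function.comp_apply, hproj] at h1
    exact (F.isParam i).inj (F.dom_subset_ball i hu) (F.dom_subset_ball i hw) h1
  · rintro ⟨i, r⟩ ⟨j, s⟩ hne
    rw [Function.onFun, Set.disjoint_left]
    rintro _ ⟨u, hu, rfl⟩ ⟨w, hw, h⟩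
    have h1 := proj_eq_of_subgroup h
    simp only [Function.comp_apply, hproj] at h1
    have hij : i = j := by
      by_contra hij
      exact Set.disjoint_left.1 (F.disjoint hij) ⟨u, hu, rfl⟩ ⟨w, hw, h1⟩
    subst hij
    have huw := (F.isParam i).inj (F.dom_subset_ball i hw) (F.dom_subset_ball i hu) h1
    subst huw
    obtain ⟨g, hg⟩ := proj_eq_iff.1 h
    change (g : Γ) • r.out • (F.chart i).symm w = s.out • (F.chart i).symm w at hg
    rw [smul_smul] at hg
    -- Freeness turns equality of two translates of one point into equality of group elements;
    -- conjugating g by the representative then identifies the cosets.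
    have h2 : (g : Γ) * r.out = s.out := IsCancelSMul.right_cancel _ _ _ hg
    apply hne
    congr 1
    rw [← QuotientGroup.out_eq' r, ← QuotientGroup.out_eq' s, QuotientGroup.eq, ← h2]
    have := hH.conj_mem g g.2 (r.out)⁻¹
    rwa [inv_inv, mul_assoc] at this
  · rw [Set.eq_univ_iff_forall]
    intro q
    obtain ⟨i, r, u, hu, hq⟩ := F.exists_coset_translate hH q
    exact Set.mem_iUnion.2 ⟨(i, r), u, hu, hq⟩

end FundamentalFamily

/-- A compact set is mapped injectively to the coverings far up in a tower. -/
theorem IsTower.eventually_injOn {G : ℕ → Subgroup Γ} (hG : IsTower G) {L : Set X}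
    (hL : IsCompact L) : ∀ᶠ j in atTop, Set.InjOn (proj (G j)) L := by
  -- Only finitely many group elements can identify points of L. Each nontrivial one leaves the
  -- tower at some level, so all of them have left it eventually.
  have hfin : Set.Finite {g : Γ | ((fun x => g • x) '' L ∩ L).Nonempty} :=
    ProperlyDiscontinuousSMul.finite_disjoint_inter_image hL hL
  have h1 : ∀ g : Γ, g ≠ 1 → ∀ᶠ j in atTop, g ∉ G j := by
    intro g hg
    have h2 : g ∉ ⨅ j, G j := by rwa [hG.iInf_eq_bot, Subgroup.mem_bot]
    rw [Subgroup.mem_iInf, not_forall] at h2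
    obtain ⟨j, hj⟩ := h2
    filter_upwards [eventually_ge_atTop j] with k hk h3
    exact hj (hG.antitone hk h3)
  have h2 : ∀ᶠ j in atTop, ∀ g ∈ {g : Γ | ((fun x => g • x) '' L ∩ L).Nonempty}, g ≠ 1 → g ∉ G j :=
    (Filter.eventually_all_finite hfin).2 fun g _ => by
      by_cases hg : g = 1
      · exact Eventually.of_forall fun j h => absurd hg h
      · exact (h1 g hg).mono fun j hj _ => hj
  filter_upwards [h2] with j hj x hx y hy hxy
  obtain ⟨g, hg⟩ := proj_eq_iff.1 hxy
  by_cases hg1 : (g : Γ) = 1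
  · rw [← hg]
    change (g : Γ) • y = y
    rw [hg1, one_smul]
  · exact absurd g.2 (hj g ⟨x, ⟨y, hy, hg⟩, hx⟩ hg1)

end FundamentalFamily

/-! ### Upper semicontinuity of the Bergman kernel along a tower -/

section Fatou

variable {n : ℕ} {X : Type*} [TopologicalSpace X] [SecondCountableTopology X]
  [ChartedSpace (Fin n → ℂ) X] [IsManifold 𝓘(ℂ, Fin n → ℂ) ω X]

/-- The square of the norm of a form over a Borel set. -/
def normSqOn (A : Set X) (f : TopForm n X) : ENNReal :=
  ∑' y : centers n X, ∫⁻ u in piece n (y : X) ∩ (chartAt (Fin n → ℂ) (y : X)).symm ⁻¹' A,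
    ‖f.coeff (chartAt (Fin n → ℂ) (y : X)) u‖ₑ ^ 2

theorem TopForm.tendsto_param {F : ℕ → TopForm n X} {f : TopForm n X}
    (hlim : ∀ x, Tendsto (fun k => (F k).toFun x) atTop (𝓝 (f.toFun x)))
    (φ : (Fin n → ℂ) → X) (u : Fin n → ℂ) :
    Tendsto (fun k => (F k).param φ u) atTop (𝓝 (f.param φ u)) :=
  (hlim (φ u)).const_mul _

/-- Fatou's lemma on the disjoint union of the pieces cut by A. -/
theorem normSqOn_le_of_tendsto {F : ℕ → TopForm n X} {f : TopForm n X}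
    (hF : ∀ k, F k ∈ holomorphicForms n X)
    (hlim : ∀ x, Tendsto (fun k => (F k).toFun x) atTop (𝓝 (f.toFun x)))
    {A : Set X} (hA : MeasurableSet[borel X] A) {C : ENNReal}
    (hC : ∀ᶠ k in atTop, normSqOn A (F k) ≤ C) : normSqOn A f ≤ C := by
  let B : centers n X → Set (Fin n → ℂ) := fun y =>
    piece n (y : X) ∩ (chartAt (Fin n → ℂ) (y : X)).symm ⁻¹' A
  let μ : Measure (ChartSum n X) := Measure.sum fun y => (volume.restrict (B y)).map (Sigma.mk y)
  have hμ : ∀ g : TopForm n X, normSqOn A g = ∫⁻ z, ‖g.coeffs z‖ₑ ^ 2 ∂μ := by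
    intro g
    rw [lintegral_sum_measure]
    refine tsum_congr fun y => ?_
    rw [(measurableEmbedding_sigmaMk (β := fun _ : centers n X => Fin n → ℂ) y).lintegral_map]
    rfl
  have hB : ∀ y, MeasurableSet (B y) := fun y =>
    measurableSet_inter_preimage (measurableSet_piece _)
      ((chartAt (Fin n → ℂ) (y : X)).continuousOn_symm.mono (piece_subset _)) hA
  have hmeas : ∀ k, AEMeasurable (fun z => ‖(F k).coeffs z‖ₑ ^ 2) μ := by
    intro k
    have h1 : AEStronglyMeasurable (F k).coeffs μ := by
      refine aestronglyMeasurable_sum_measure_iff.2 fun y =>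
        (measurableEmbedding_sigmaMk y).aestronglyMeasurable_map_iff.2 ?_
      exact (((hF k _ (chartAt_mem (y : X))).continuousOn).mono
        (Set.inter_subset_left.trans (piece_subset _))).aestronglyMeasurable (hB y)
    exact h1.enorm.pow_const 2
  have hpt : ∀ z : ChartSum n X,
      Tendsto (fun k => ‖(F k).coeffs z‖ₑ ^ 2) atTop (𝓝 (‖f.coeffs z‖ₑ ^ 2)) := by
    intro z
    have h1 : Tendsto (fun k => (F k).coeffs z) atTop (𝓝 (f.coeffs z)) := by
      simp only [TopForm.coeffs, TopForm.coeff_eq_param]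
      exact TopForm.tendsto_param hlim _ _
    exact ENNReal.Tendsto.pow h1.enorm
  rw [hμ]
  calc ∫⁻ z, ‖f.coeffs z‖ₑ ^ 2 ∂μ = ∫⁻ z, liminf (fun k => ‖(F k).coeffs z‖ₑ ^ 2) atTop ∂μ :=
        lintegral_congr fun z => (hpt z).liminf_eq.symm
    _ ≤ liminf (fun k => ∫⁻ z, ‖(F k).coeffs z‖ₑ ^ 2 ∂μ) atTop := lintegral_liminf_le' hmeas
    _ ≤ C := by
        refine liminf_le_of_frequently_le' (Eventually.frequently ?_)
        filter_upwards [hC] with k hk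
        rwa [← hμ]

/-- Monotone convergence along a compact exhaustion, applied to finite partial sums over the pieces.
-/
theorem normSq_le_of_forall_compact [T2Space X] [LocallyCompactSpace X] {f : TopForm n X}
    {C : ENNReal} (h : ∀ L : Set X, IsCompact L → normSqOn L f ≤ C) : normSq f ≤ C := by
  let K : CompactExhaustion X := default
  rw [normSq_eq_tsum, ENNReal.tsum_eq_iSup_sum]
  refine iSup_le fun T => ?_
  have h1 : ∀ y : centers n X, Tendsto (fun m => ∫⁻ u in piece n (y : X) ∩
      (chartAt (Fin n → ℂ) (y : X)).symm ⁻¹' (K m),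
      ‖f.coeff (chartAt (Fin n → ℂ) (y : X)) u‖ₑ ^ 2) atTop
      (𝓝 (∫⁻ u in piece n (y : X), ‖f.coeff (chartAt (Fin n → ℂ) (y : X)) u‖ₑ ^ 2)) := by
    intro y
    have hmono : Monotone fun m => piece n (y : X) ∩
        (chartAt (Fin n → ℂ) (y : X)).symm ⁻¹' (K m) := fun a b hab =>
      Set.inter_subset_inter_right _ (Set.preimage_mono (K.subset hab))
    have h2 : piece n (y : X) =
        ⋃ m, piece n (y : X) ∩ (chartAt (Fin n → ℂ) (y : X)).symm ⁻¹' (K m) := by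
      rw [← Set.inter_iUnion, ← Set.preimage_iUnion, K.iUnion_eq]
      simp
    conv in 𝓝 _ => rw [h2]
    rw [setLIntegral_iUnion_of_directed _ hmono.directed_le]
    exact tendsto_atTop_iSup fun a b hab => lintegral_mono_set (hmono hab)
  refine le_of_tendsto (tendsto_finsetSum T fun y _ => h1 y) (Eventually.of_forall fun m => ?_)
  exact (ENNReal.sum_le_tsum T).trans (h (K m) (K.isCompact m))

theorem IsParam.continuousOn_kernelParam {φ : (Fin n → ℂ) → X} {c : Fin n → ℂ} {R : ℝ}
    (h : IsParam (n := n) φ c R) : ContinuousOn (kernelParam (n := n) φ) (Metric.ball c (R / 8)) := by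
  refine LipschitzOnWith.continuousOn (K := (lipConst n R).toNNReal)
    (LipschitzOnWith.of_dist_le_mul fun u hu w hw => ?_)
  rw [Real.dist_eq, dist_eq_norm, Real.coe_toNNReal _ (lipConst_nonneg h.pos)]
  exact h.abs_kernelParam_sub_le hu hw

end Fatou

section Tower

variable {n : ℕ} {X : Type*} [TopologicalSpace X] [T2Space X] [LocallyCompactSpace X]
  [SecondCountableTopology X] [ChartedSpace (Fin n → ℂ) X] [IsManifold 𝓘(ℂ, Fin n → ℂ) ω X]
  {Γ : Type*} [Group Γ] [MulAction Γ X] [ContinuousConstSMul Γ X] [ProperlyDiscontinuousSMul Γ X]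
  [IsCancelSMul Γ X] [HolomorphicSMul n Γ X]

/-- If the bound failed for infinitely many j, extremal forms on those quotients, pulled back to X,
would have a subsequence with a holomorphic limit of norm at most one. The squared modulus of the
limit at u would then exceed the kernel of X, against its extremal property. -/
theorem IsTower.eventually_kernelParam_le {G : ℕ → Subgroup Γ} (hG : IsTower G)
    {e : OpenPartialHomeomorph X (Fin n → ℂ)}
    (he : e ∈ IsManifold.maximalAtlas 𝓘(ℂ, Fin n → ℂ) ω X) {u : Fin n → ℂ} (hu : u ∈ e.target)
    {ε : ℝ} (hε : 0 < ε) : ∀ᶠ j in atTop,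
      kernelParam (n := n) (proj (G j) ∘ e.symm) u ≤ kernelParam (n := n) e.symm u + ε := by
  by_contra hcon
  obtain ⟨ψ, hψ, hgt⟩ := extraction_of_frequently_atTop (not_eventually.1 hcon)
  choose f hf hf1 hfu using fun k => exists_extremal_param (n := n) (proj (G (ψ k)) ∘ e.symm) u
  have hparam : ∀ k, ∀ e' ∈ IsManifold.maximalAtlas 𝓘(ℂ, Fin n → ℂ) ω X, ∀ w ∈ e'.target,
      ((f k).pull (proj (G (ψ k)))).param e'.symm w = (f k).param (proj (G (ψ k)) ∘ e'.symm) w :=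
    fun k e' he' w hw => TopForm.pull_param _ (holAt_proj _) (holAt_chart_symm he' hw)
  obtain ⟨θ, hθ, g, hg, hlim⟩ := exists_subseq_tendsto_holomorphicForms
    (F := fun k => (f k).pull (proj (G (ψ k))))
    (fun k => pull_mem_holomorphicForms (hf k).1 holAt_proj) (by
      intro e' he' w hw
      -- The ball is chosen to embed already in X/Γ, which makes the local bound independent of k.
      obtain ⟨R, hR, hsub, hpar⟩ := exists_isParam_proj (Γ := Γ) he' hw
      refine ⟨√(ballConst n R), R / 2, by positivity,
        (Metric.ball_subset_ball (by linarith)).trans hsub, fun k z hz => ?_⟩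
      have hz' : z ∈ Metric.ball w R := Metric.ball_subset_ball (by linarith) hz
      rw [TopForm.coeff_eq_param, hparam k e' he' z (hsub hz')]
      exact (hpar.proj_subgroup (fun v hv => holAt_chart_symm he' (hsub hv)) _).norm_le
        (hf k) (hf1 k) hz)
  -- On a compact set L the projection is injective for large indices, so the norm over L of the
  -- pull-back is at most that of the form downstairs. Fatou, followed by an exhaustion by compacts,
  -- passes this to g.
  have hnorm : normSq g ≤ 1 := by
    refine normSq_le_of_forall_compact fun L hL => ?_
    have hLm : MeasurableSet[borel X] L :=
      (borel_eq_generateFrom_isClosed (α := X)) ▸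
        MeasurableSpace.measurableSet_generateFrom hL.isClosed
    refine normSqOn_le_of_tendsto (fun k => pull_mem_holomorphicForms (hf (θ k)).1 holAt_proj)
      hlim hLm ?_
    have hinj := (hψ.comp hθ).tendsto_atTop.eventually (hG.eventually_injOn hL)
    filter_upwards [hinj] with k hk
    exact (tsum_lintegral_pull_le (f (θ k)) holAt_proj hLm hk).trans (hf1 _)
  have hgB : g ∈ bergmanSpace n X := ⟨hg, hnorm.trans_lt ENNReal.one_lt_top⟩
  have h1 : ‖g.param e.symm u‖ ^ 2 ≤ kernelParam (n := n) e.symm u :=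
    (norm_param_sq_le hgB _ _).trans
      (mul_le_of_le_one_right (kernelParam_nonneg _ _) (toReal_le_one hnorm))
  have h2 : kernelParam (n := n) e.symm u + ε ≤ ‖g.param e.symm u‖ ^ 2 := by
    refine ge_of_tendsto ((TopForm.tendsto_param hlim e.symm u).norm.pow 2)
      (Eventually.of_forall fun k => ?_)
    rw [hparam _ e he u hu, hfu]
    exact (not_le.1 (hgt _)).le
  linarith

/-! ### Convergence of the kernels and of their integrals -/

namespace FundamentalFamily

variable {ι : Type*} (F : FundamentalFamily n Γ X ι)

theorem isParam_symm (i : ι) : IsParam (n := n) (F.chart i).symm (F.center i) (F.radius i) :=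
  (F.isParam i).lift fun _ hu => F.holAt_symm i hu

theorem isParam_proj (H : Subgroup Γ) (i : ι) :
    IsParam (n := n) (proj H ∘ (F.chart i).symm) (F.center i) (F.radius i) :=
  (F.isParam i).proj_subgroup (fun _ hu => F.holAt_symm i hu) H

theorem dom_subset_half (i : ι) : F.dom i ⊆ Metric.ball (F.center i) (F.radius i / 2) :=
  (F.dom_subset i).trans (Metric.ball_subset_ball (by linarith [(F.isParam i).pos]))

theorem volume_dom_ne_top (i : ι) : volume (F.dom i) ≠ ⊤ :=
  ((measure_mono (F.dom_subset i)).trans_lt measure_ball_lt_top).ne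

/-- Bounded convergence on a piece. -/
theorem tendsto_lintegral_dom (i : ι) {k : ℕ → (Fin n → ℂ) → ℝ} {k' : (Fin n → ℂ) → ℝ}
    (hcont : ∀ j, ContinuousOn (k j) (Metric.ball (F.center i) (F.radius i / 8)))
    (hle : ∀ j, ∀ u ∈ F.dom i, k j u ≤ ballConst n (F.radius i))
    (hlim : ∀ u ∈ F.dom i, Tendsto (fun j => k j u) atTop (𝓝 (k' u))) :
    Tendsto (fun j => ∫⁻ u in F.dom i, ENNReal.ofReal (k j u)) atTop
      (𝓝 (∫⁻ u in F.dom i, ENNReal.ofReal (k' u))) := by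
  refine tendsto_lintegral_of_dominated_convergence'
    (fun _ => ENNReal.ofReal (ballConst n (F.radius i))) (fun j => ?_) (fun j => ?_) ?_ ?_
  · exact (((hcont j).mono (F.dom_subset i)).aemeasurable (F.measurableSet_dom i)).ennreal_ofReal
  · filter_upwards [ae_restrict_mem (F.measurableSet_dom i)] with u hu
    exact ENNReal.ofReal_le_ofReal (hle j u hu)
  · rw [setLIntegral_const]
    exact ENNReal.mul_ne_top ENNReal.ofReal_ne_top (F.volume_dom_ne_top i)
  · filter_upwards [ae_restrict_mem (F.measurableSet_dom i)] with u hu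
    exact ENNReal.tendsto_ofReal (hlim u hu)

theorem lintegral_dom_ne_top (i : ι) :
    ∫⁻ u in F.dom i, ENNReal.ofReal (kernelParam (n := n) (F.chart i).symm u) ≠ ⊤ := by
  refine ((setLIntegral_mono' (g := fun _ => ENNReal.ofReal (ballConst n (F.radius i)))
    (F.measurableSet_dom i) fun u hu => ENNReal.ofReal_le_ofReal
      ((F.isParam_symm i).kernelParam_le (F.dom_subset_half i hu))).trans_lt ?_).ne
  rw [setLIntegral_const]
  exact ENNReal.mul_lt_top ENNReal.ofReal_lt_top (F.volume_dom_ne_top i).lt_top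

/-- The domain of integration on the right is the same for every H, so along the tower only the
integrand changes. -/
theorem hodgeNumber_div_index [Finite ι] {H : Subgroup Γ} (hH : H.Normal) [H.FiniteIndex] :
    (hodgeNumber n (QuotientManifold H X) : ENNReal) / (H.index : ENNReal) =
      ∑' i, ∫⁻ u in F.dom i,
        ENNReal.ofReal (kernelParam (n := n) (proj H ∘ (F.chart i).symm) u) := by
  have := F.compactSpace_quotient hH
  rw [hodgeNumber_eq_lintegral, F.lintegral_bergmanForm_quotient hH, mul_comm]
  exact ENNReal.mul_div_cancel_right (Nat.cast_ne_zero.2 Subgroup.FiniteIndex.index_ne_zero)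
    (ENNReal.natCast_ne_top _)

end FundamentalFamily

theorem exists_fundamentalFamily_fin [CompactSpace (QuotientManifold Γ X)] :
    ∃ m : ℕ, Nonempty (FundamentalFamily n Γ X (Fin m)) := by
  -- An empty X offers no ball to put at index 0; the empty family serves instead.
  cases isEmpty_or_nonempty X with
  | inl h =>
    refine ⟨0, ⟨⟨Fin.elim0, Fin.elim0, Fin.elim0, Fin.elim0, fun i => i.elim0, fun i => i.elim0,
      fun i => i.elim0, fun i => i.elim0, fun i => i.elim0, fun i => i.elim0, ?_⟩⟩⟩
    rw [Set.eq_univ_iff_forall]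
    intro q
    obtain ⟨x, -⟩ := proj_surjective q
    exact h.elim x
  | inr h =>
    obtain ⟨x⟩ := h
    obtain ⟨R, -, hsub, hpar⟩ := exists_isParam_proj (Γ := Γ) (chartAt_mem x)
      (mem_chart_target (Fin n → ℂ) x)
    obtain ⟨m, F, -⟩ := exists_fundamentalFamily (chartAt_mem x) hsub hpar
    exact ⟨m + 1, ⟨F⟩⟩

theorem bergmanForm_coeff (e : OpenPartialHomeomorph X (Fin n → ℂ)) (u : Fin n → ℂ) :
    (bergmanForm n X).coeff e u = (kernelParam (n := n) e.symm u : ℂ) := by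
  rw [isForm_bergmanForm.coeff_eq_param, bergmanForm_param]

theorem IsBergmanStable.tendsto_kernelParam {G : ℕ → Subgroup Γ} (h : IsBergmanStable n X G)
    {e : OpenPartialHomeomorph X (Fin n → ℂ)}
    (he : e ∈ IsManifold.maximalAtlas 𝓘(ℂ, Fin n → ℂ) ω X) {u : Fin n → ℂ} (hu : u ∈ e.target) :
    Tendsto (fun j => kernelParam (n := n) (proj (G j) ∘ e.symm) u) atTop
      (𝓝 (kernelParam (n := n) e.symm u)) := by
  have h1 := (h e he).tendsto_at hu
  simp only [pullBack_bergmanForm_coeff he hu, bergmanForm_coeff] at h1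
  exact (Complex.continuous_re.tendsto _).comp h1

/-- Only pointwise convergence is used; the kernel bound, uniform in j on each piece, provides the
dominating constant. -/
theorem IsBergmanStable.tendsto_hodgeNumber [CompactSpace (QuotientManifold Γ X)]
    {G : ℕ → Subgroup Γ} (hG : IsTower G) (h : IsBergmanStable n X G) :
    Tendsto (fun j => (hodgeNumber n (QuotientManifold (G j) X) : ENNReal) /
      ((G j).index : ENNReal)) atTop (𝓝 (pushDown Γ (bergmanForm n X)).lintegral) := by
  obtain ⟨m, ⟨F⟩⟩ := exists_fundamentalFamily_fin (n := n) (Γ := Γ) (X := X)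
  have h1 : ∀ j, (hodgeNumber n (QuotientManifold (G j) X) : ENNReal) / ((G j).index : ENNReal) =
      ∑' i, ∫⁻ u in F.dom i,
        ENNReal.ofReal (kernelParam (n := n) (proj (G j) ∘ (F.chart i).symm) u) := fun j =>
    have := hG.finiteIndex j
    F.hodgeNumber_div_index (hG.normal j)
  simp only [h1, F.lintegral_pushDown, tsum_fintype]
  refine tendsto_finsetSum _ fun i _ => F.tendsto_lintegral_dom i
    (fun j => (F.isParam_proj (G j) i).continuousOn_kernelParam)
    (fun j u hu => (F.isParam_proj (G j) i).kernelParam_le (F.dom_subset_half i hu))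
    fun u hu => h.tendsto_kernelParam (F.mem_atlas i) (F.ball_subset i (F.dom_subset_ball i hu))

/-- If the limit of the integrals is as large as possible, then so are the limits of the kernels. -/
theorem IsTower.tendsto_kernelParam [CompactSpace (QuotientManifold Γ X)]
    {G : ℕ → Subgroup Γ} (hG : IsTower G)
    (h : Tendsto (fun j => (hodgeNumber n (QuotientManifold (G j) X) : ENNReal) /
      ((G j).index : ENNReal)) atTop (𝓝 (pushDown Γ (bergmanForm n X)).lintegral))
    {e : OpenPartialHomeomorph X (Fin n → ℂ)}
    (he : e ∈ IsManifold.maximalAtlas 𝓘(ℂ, Fin n → ℂ) ω X) {u : Fin n → ℂ} (hu : u ∈ e.target) :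
    Tendsto (fun j => kernelParam (n := n) (proj (G j) ∘ e.symm) u) atTop
      (𝓝 (kernelParam (n := n) e.symm u)) := by
  obtain ⟨R, hR, hsub, hpar⟩ := exists_isParam_proj (Γ := Γ) he hu
  -- The family is adapted to the given point: u becomes the centre of the piece of index 0, which
  -- is a full ball.
  obtain ⟨m, F, rfl, rfl, rfl, hdom⟩ := exists_fundamentalFamily he hsub hpar
  set k : ℕ → Fin (m + 1) → (Fin n → ℂ) → ℝ := fun j i =>
    kernelParam (n := n) (proj (G j) ∘ (F.chart i).symm) with hk
  set k' : Fin (m + 1) → (Fin n → ℂ) → ℝ := fun i => kernelParam (n := n) (F.chart i).symm with hk'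
  have h1 : ∀ j, (hodgeNumber n (QuotientManifold (G j) X) : ENNReal) / ((G j).index : ENNReal) =
      ∑ i, ∫⁻ u in F.dom i, ENNReal.ofReal (k j i u) := fun j => by
    have := hG.finiteIndex j
    rw [F.hodgeNumber_div_index (hG.normal j), tsum_fintype]
  simp only [h1, F.lintegral_pushDown, tsum_fintype] at h
  have hlimsup : ∀ i, ∀ w ∈ F.dom i, ∀ ε > 0, ∀ᶠ j in atTop, k j i w ≤ k' i w + ε :=
    fun i w hw ε hε => hG.eventually_kernelParam_le (F.mem_atlas i)
      (F.ball_subset i (F.dom_subset_ball i hw)) hε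
  -- Upper semicontinuity alone makes the maximum of the two kernels converge pointwise to the limit
  -- kernel. With `h`, the integral of the excess of the maximum over `k j` must tend to zero.
  have hmax : Tendsto (fun j => ∑ i, ∫⁻ u in F.dom i, ENNReal.ofReal (max (k j i u) (k' i u)))
      atTop (𝓝 (∑ i, ∫⁻ u in F.dom i, ENNReal.ofReal (k' i u))) := by
    refine tendsto_finsetSum _ fun i _ => F.tendsto_lintegral_dom i
      (fun j => (F.isParam_proj (G j) i).continuousOn_kernelParam.sup
        (F.isParam_symm i).continuousOn_kernelParam)
      (fun j u hu => max_le ((F.isParam_proj (G j) i).kernelParam_le (F.dom_subset_half i hu))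
        ((F.isParam_symm i).kernelParam_le (F.dom_subset_half i hu))) fun w hw => ?_
    refine Metric.tendsto_atTop'.2 fun ε hε => ?_
    obtain ⟨N, hN⟩ := eventually_atTop.1 (hlimsup i w hw (ε / 2) (by positivity))
    refine ⟨N, fun j hj => ?_⟩
    rw [Real.dist_eq, abs_of_nonneg (sub_nonneg.2 (le_max_right _ _)), sub_lt_iff_lt_add]
    exact max_lt (by linarith [hN j hj.le]) (by linarith)
  have hc : F.center 0 ∈ F.dom 0 := by
    rw [hdom]; exact Metric.mem_ball_self (by positivity)
  have hlow : ∀ δ > 0, ∀ᶠ j in atTop, k' 0 (F.center 0) - δ < k j 0 (F.center 0) := by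
    intro δ hδ
    by_contra hcon
    set lip := lipConst n (F.radius 0)
    have hlip : 0 ≤ lip := lipConst_nonneg hR
    -- On a ball of this radius, independent of j, each of the two kernels changes by at most δ/4.
    obtain ⟨r, hr, hrR, hrl⟩ : ∃ r > 0, r ≤ F.radius 0 / 8 ∧ lip * r ≤ δ / 4 := by
      refine ⟨min (F.radius 0 / 8) (δ / (4 * (lip + 1))), by positivity, min_le_left _ _, ?_⟩
      calc lip * min (F.radius 0 / 8) (δ / (4 * (lip + 1)))
          ≤ (lip + 1) * (δ / (4 * (lip + 1))) :=
            mul_le_mul (by linarith) (min_le_right _ _) (by positivity) (by positivity)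
        _ = δ / 4 := by field_simp
    set S := Metric.ball (F.center 0) r
    have hS : S ⊆ F.dom 0 := by rw [hdom]; exact Metric.ball_subset_ball hrR
    -- A deficit δ at the centre leaves at least δ - δ/4 - δ/4 = δ/2 on all of S. This mass
    -- separates the two integrals for infinitely many j.
    have hfreq : ∃ᶠ j in atTop, ENNReal.ofReal (δ / 2) * volume S +
        ∑ i, ∫⁻ u in F.dom i, ENNReal.ofReal (k j i u) ≤
          ∑ i, ∫⁻ u in F.dom i, ENNReal.ofReal (max (k j i u) (k' i u)) := by
      refine (not_eventually.1 hcon).mono fun j hj => ?_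
      rw [Fin.sum_univ_succ, Fin.sum_univ_succ, ← add_assoc]
      refine add_le_add ?_ (Finset.sum_le_sum fun i _ => lintegral_mono fun u =>
        ENNReal.ofReal_le_ofReal (le_max_left _ _))
      have h2 : ENNReal.ofReal (δ / 2) * volume S =
          ∫⁻ u in F.dom 0, S.indicator (fun _ => ENNReal.ofReal (δ / 2)) u := by
        rw [lintegral_indicator_const Metric.isOpen_ball.measurableSet,
          Measure.restrict_apply Metric.isOpen_ball.measurableSet, Set.inter_eq_left.2 hS]
      rw [h2, ← lintegral_add_left
        (measurable_const.indicator Metric.isOpen_ball.measurableSet)]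
      refine setLIntegral_mono' (F.measurableSet_dom 0) fun w hw => ?_
      by_cases hwS : w ∈ S
      · rw [Set.indicator_of_mem hwS, ← ENNReal.ofReal_add (by positivity) (kernelParam_nonneg _ _)]
        refine ENNReal.ofReal_le_ofReal (le_max_of_le_right ?_)
        have hw8 := F.dom_subset 0 hw
        have hc8 := F.dom_subset 0 hc
        have hwr : ‖w - F.center 0‖ < r := by
          rw [← dist_eq_norm]; exact hwS
        have h3 := abs_le.1 ((F.isParam_proj (G j) 0).abs_kernelParam_sub_le hw8 hc8)
        have h4 := abs_le.1 ((F.isParam_symm 0).abs_kernelParam_sub_le hw8 hc8)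
        have h5 : lip * ‖w - F.center 0‖ ≤ lip * r := mul_le_mul_of_nonneg_left hwr.le hlip
        have h6 := not_lt.1 hj
        have h7 := h3.2
        have h8 := h4.1
        simp only [hk, hk'] at h6 ⊢
        linarith
      · rw [Set.indicator_of_notMem hwS, zero_add]
        exact ENNReal.ofReal_le_ofReal (le_max_left _ _)
    -- Both sides converge, to the same finite integral except for the fixed positive mass on the
    -- left, so an inequality holding infinitely often gives a contradiction in the limit.
    have hle := (isClosed_le_prod (α := ENNReal)).mem_of_frequently_of_tendsto
      (f := fun j => (ENNReal.ofReal (δ / 2) * volume S +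
        ∑ i, ∫⁻ u in F.dom i, ENNReal.ofReal (k j i u),
          ∑ i, ∫⁻ u in F.dom i, ENNReal.ofReal (max (k j i u) (k' i u)))) hfreq
      ((h.const_add _).prodMk_nhds hmax)
    have hfin : ∑ i, ∫⁻ u in F.dom i, ENNReal.ofReal (k' i u) ≠ ⊤ :=
      ENNReal.sum_ne_top.2 fun i _ => F.lintegral_dom_ne_top i
    have hpos : 0 < ENNReal.ofReal (δ / 2) * volume S :=
      ENNReal.mul_pos (ENNReal.ofReal_pos.2 (by positivity)).ne'
        (Metric.measure_ball_pos volume _ hr).ne'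
    have h9 := ENNReal.lt_add_right hfin hpos.ne'
    exact absurd hle (not_le.2 (h9.trans_eq (add_comm _ _)))
  refine tendsto_order.2 ⟨fun a ha => ?_, fun a ha => ?_⟩
  · filter_upwards [hlow (k' 0 (F.center 0) - a) (sub_pos.2 ha)] with j hj
    simpa using hj
  · filter_upwards [hlimsup 0 _ hc ((a - k' 0 (F.center 0)) / 2)
      (half_pos (sub_pos.2 ha))] with j hj
    have ha' : k' 0 (F.center 0) < a := ha
    exact lt_of_le_of_lt hj (by linarith)

/-- Pointwise convergence of the kernels is locally uniform. -/
theorem isBergmanStable_of_tendsto_kernelParam {G : ℕ → Subgroup Γ}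
    (h : ∀ e ∈ IsManifold.maximalAtlas 𝓘(ℂ, Fin n → ℂ) ω X, ∀ u ∈ e.target,
      Tendsto (fun j => kernelParam (n := n) (proj (G j) ∘ e.symm) u) atTop
        (𝓝 (kernelParam (n := n) e.symm u))) : IsBergmanStable n X G := by
  intro e he
  refine Metric.tendstoLocallyUniformlyOn_iff.2 fun ε hε u hu => ?_
  obtain ⟨R, hR, hsub, hpar⟩ := exists_isParam_proj (Γ := Γ) he hu
  set lip := lipConst n R
  have hlip : 0 ≤ lip := lipConst_nonneg hR
  -- Three errors of at most ε/4 occur: the variation of each of the two kernels between w and u,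
  -- and their difference at u.
  obtain ⟨r, hr, hrR, hrl⟩ : ∃ r > 0, r ≤ R / 8 ∧ lip * r ≤ ε / 4 := by
    refine ⟨min (R / 8) (ε / (4 * (lip + 1))), by positivity, min_le_left _ _, ?_⟩
    calc lip * min (R / 8) (ε / (4 * (lip + 1))) ≤ (lip + 1) * (ε / (4 * (lip + 1))) :=
          mul_le_mul (by linarith) (min_le_right _ _) (by positivity) (by positivity)
      _ = ε / 4 := by field_simp
  have hhol : ∀ v ∈ Metric.ball u R, HolAt n e.symm v := fun v hv => holAt_chart_symm he (hsub hv)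
  refine ⟨Metric.ball u r, mem_nhdsWithin_of_mem_nhds (Metric.ball_mem_nhds u hr), ?_⟩
  filter_upwards [Metric.tendsto_nhds.1 (h e he u hu) (ε / 4) (by positivity)] with j hj w hw
  have hw8 : w ∈ Metric.ball u (R / 8) := Metric.ball_subset_ball hrR hw
  have hu8 : u ∈ Metric.ball u (R / 8) := Metric.mem_ball_self (by positivity)
  have hwt : w ∈ e.target := hsub (Metric.ball_subset_ball (by linarith) hw8)
  have hwr : ‖w - u‖ < r := by rw [← dist_eq_norm]; exact hw
  rw [pullBack_bergmanForm_coeff he hwt, bergmanForm_coeff, dist_eq_norm, ← Complex.ofReal_sub,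
    Complex.norm_real, Real.norm_eq_abs]
  rw [Real.dist_eq] at hj
  have h3 := abs_le.1 ((hpar.proj_subgroup hhol (G j)).abs_kernelParam_sub_le hw8 hu8)
  have h4 := abs_le.1 ((hpar.lift hhol).abs_kernelParam_sub_le hw8 hu8)
  have h5 : lip * ‖w - u‖ ≤ lip * r := mul_le_mul_of_nonneg_left hwr.le hlip
  have h6 := abs_lt.1 hj
  rw [abs_lt]
  constructor <;> linarith [h3.1, h3.2, h4.1, h4.2, h6.1, h6.2]

end Tower

end BergmanTower

end

theorem proposition4p1 {n : ℕ} {X : Type*} [TopologicalSpace X] [T2Space X]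
    [LocallyCompactSpace X] [SecondCountableTopology X] [ChartedSpace (Fin n → ℂ) X]
    [IsManifold 𝓘(ℂ, Fin n → ℂ) ω X] {Γ : Type*} [Group Γ] [MulAction Γ X]
    [ContinuousConstSMul Γ X] [ProperlyDiscontinuousSMul Γ X] [IsCancelSMul Γ X]
    [BergmanTower.HolomorphicSMul n Γ X] [CompactSpace (BergmanTower.QuotientManifold Γ X)]
    (G : ℕ → Subgroup Γ) (hG : BergmanTower.IsTower G) :
    BergmanTower.IsBergmanStable n X G ↔
      Tendsto (fun j => (BergmanTower.hodgeNumber n (BergmanTower.QuotientManifold (G j) X) : ENNReal) /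
          ((G j).index : ENNReal)) atTop
        (𝓝 (BergmanTower.pushDown Γ (BergmanTower.bergmanForm n X)).lintegral) :=
  ⟨fun h => h.tendsto_hodgeNumber hG, fun h =>
    BergmanTower.isBergmanStable_of_tendsto_kernelParam fun _ he _ hu =>
      hG.tendsto_kernelParam h he hu⟩
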